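/- \textbf{Setting.} Let $N\ge 1$ and $\beta\in\mathbb C^N$ with $\sum_i\beta_i=N(N-1)/2$, and put $D=x\partial_x$. For a finite family $\delta=(\delta_i)_{i\in I}$ of complex numbers let $L_\delta=x^{-|I|}\prod_{i\in I}(D-\delta_i)$; in particular $L_\beta=x^{-N}\prod_{i=1}^N(D-\beta_i)$. The Bessel wave function $\Psi_\beta(x,z)=e^{xz}\bigl(1+\sum_{k\ge1}a_k(xz)^{-k}\bigr)$ is the unique formal solution of this form of $L_\beta\Psi_\beta=z^N\Psi_\beta$. All differential operators below have coefficients in $\mathbb C(x)$. For $d\ge 0$ put $$\gamma=\beta^d=(\beta_1,\beta_1+N,\dots,\beta_1+(d-1)N,\;\dots,\;\beta_N,\dots,\beta_N+(d-1)N)\in\mathbb C^{dN}.$$ Let $\Psi_W(x,z)=e^{xz}\bigl(1+\sum_{k\ge1}w_k(x)z^{-k}\bigr)$ with $w_k\in\mathbb C(x)$ be a monomial Darboux transformation of $\Psi_\beta$ without logarithms. That is, $\Psi_W=\frac1{g(z)}P(x,\partial_x)\Psi_\beta$, where $\ker P$ has a basis $f_k(x)=\sum_{i=1}^{dN}a_{ki}x^{\gamma_i}$,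 $0\le k\le n-1$, such that $\gamma_i-\gamma_j\in N\mathbb Z\setminus\{0\}$ whenever $i\ne j$ and $a_{ki}a_{kj}\ne0$, and where $g(z)=z^n$ with $n=\dim\ker P$. Let $A=(a_{ki})$. For an $n$-element subset $I=\{i_1<\dots<i_n\}$ of $\{1,\dots,dN\}$ let $A^I$ be the submatrix of $A$ on the columns in $I$, $I^0$ the complement of $I$, $\gamma_I=(\gamma_i)_{i\in I}$, $\gamma_{I^0}-n\delta_{I^0}=(\gamma_i-n)_{i\in I^0}$, and $\Delta_I=\prod_{r<s}(\gamma_{i_r}-\gamma_{i_s})$. Let $I_{\min}$ be an $n$-element subset with $\det A^{I_{\min}}\neq0$ for which $\sum_{i\in I_{\min}}\gamma_i$ is minimal among all sums $\sum_{i\in I}\gamma_i$ with $\det A^I\ne0$ (these sums differ from each other by integers), and put $p_I=\sum_{i\in I}\gamma_i-\sum_{i\in I_{\min}}\gamma_i$. \textbf{Proposition.} Such an $I_{\min}$ exists, and for every choice of it the following hold. If $\det A^I\ne0$, then $p_I$ is a nonnegative integer divisible by $N$. One has $n\le dN$, and the polynomial $\theta(x)=\sum_I\det A^I\,\Delta_I\,x^{p_I}$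 is nonzero. Here and below, sums are over the $n$-element subsets $I$ of $\{1,\dots,dN\}$, and terms with $\det A^I=0$ are zero. Moreover: (a) $g(z)=z^n$ and $$P=\theta(x)^{-1}\Bigl(\sum_I\det A^I\,\Delta_I\,x^{p_I}L_{\gamma_I}\Bigr).$$ (b) There is exactly one pair of a monic polynomial $f(z)$ and a differential operator $Q(x,\partial_x)$ with $\Psi_\beta=\frac1{f(z)}Q\Psi_W$, $f(z)g(z)=h(z^N)$ and $QP=h(L_\beta)$ for $h(z)=z^d$, namely $f(z)=z^{dN-n}$ and $$Q=\Bigl(\sum_I\det A^I\,\Delta_I\,L_{\gamma_{I^0}-n\delta_{I^0}}\,x^{p_I}\Bigr)\theta(x)^{-1}.$$ Let $$\text{(c)}\quad g_{\rm b}(z)=z^n\sum_I\det A^I\,\Delta_I\,z^{p_I},\qquad P_{\rm b}=\sum_I\det A^I\,\Delta_I\,L_{\gamma_I}(L_\beta)^{p_I/N},$$ $$\text{(d)}\quad f_{\rm b}(z)=z^{dN-n}\sum_I\det A^I\,\Delta_I\,z^{p_I},\qquad Q_{\rm b}=\sum_I\det A^I\,\Delta_I\,(L_\beta)^{p_I/N}L_{\gamma_{I^0}-n\delta_{I^0}}.$$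 Then $\Psi_{bW}(x,z)=\Psi_W(z,x)$ (coefficients being expanded at infinity) is again a wave function $e^{xz}\bigl(1+\sum_{k\ge1}v_k(x)z^{-k}\bigr)$ with $v_k\in\mathbb C(x)$, and $$\Psi_{bW}=\frac1{g_{\rm b}(z)}P_{\rm b}(x,\partial_x)\Psi_\beta,\qquad \Psi_\beta=\frac1{f_{\rm b}(z)}Q_{\rm b}(x,\partial_x)\Psi_{bW};$$ for the given $g_{\rm b}$ and $f_{\rm b}$, the operators $P_{\rm b}$ and $Q_{\rm b}$ are the only ones with this property. They are obtained from $P$, $Q$ by the bispectral involution: with $m=dN-n$ there are polynomials $p_0,\dots,p_n$, $q_0,\dots,q_m$ with $p_n,q_m\neq0$ such that $$P=\frac1{x^np_n(x^N)}\sum_{k=0}^np_k(x^N)D^k,\quad P_{\rm b}=\frac1{g(x)}\sum_{k=0}^nD^kp_k(L_\beta),\quad g_{\rm b}(z)=z^np_n(z^N),$$ $$Q=\sum_{s=0}^mD^sq_s(x^N)\frac1{x^mq_m(x^N)},\quad Q_{\rm b}=\sum_{s=0}^mq_s(L_\beta)D^s\frac1{f(x)},\quad f_{\rm b}(z)=z^mq_m(z^N).$$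 Finally, with $L=PQ$, $\Lambda=P_{\rm b}(z,\partial_z)Q_{\rm b}(z,\partial_z)$ and $\Theta(x^N)=f_{\rm b}(x)g_{\rm b}(x)$, where $\Theta$ is a polynomial, $$L(x,\partial_x)\Psi_W(x,z)=z^{dN}\,\Psi_W(x,z),\qquad \Lambda(z,\partial_z)\Psi_W(x,z)=\Theta(x^N)\,\Psi_W(x,z).$$ -/

import Mathlib

open Polynomial Filter

namespace BesselDarboux

noncomputable section

/-! ### Rational functions of `x` and formal wave functions -/

/-- The field `ℂ(x)`. -/
abbrev K : Type := RatFunc ℂ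

theorem quotientRule_aux {p q n d : ℂ[X]} (h1 : n * q = p * d)
    (h3 : derivative n * q + n * derivative q = derivative p * d + p * derivative d) :
    (derivative n * d - n * derivative d) * q ^ 2 =
      (derivative p * q - p * derivative q) * d ^ 2 := by
  linear_combination (d * q) * h3 - (q * derivative d + d * derivative q) * h1

/-- The quotient rule computes the same value on every presentation of a fraction. -/
theorem quotientRule_eq {p q : ℂ[X]} (hq : q ≠ 0) (r : K)
    (hr : r = algebraMap ℂ[X] K p / algebraMap ℂ[X] K q) :
    algebraMap ℂ[X] K (derivative r.num * r.denom - r.num * derivative r.denom) /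
        algebraMap ℂ[X] K r.denom ^ 2 =
      algebraMap ℂ[X] K (derivative p * q - p * derivative q) / algebraMap ℂ[X] K q ^ 2 := by
  have hd : r.denom ≠ 0 := r.denom_ne_zero
  have hq' : algebraMap ℂ[X] K q ≠ 0 := RatFunc.algebraMap_ne_zero hq
  have hd' : algebraMap ℂ[X] K r.denom ≠ 0 := RatFunc.algebraMap_ne_zero hd
  have h1 : r.num * q = p * r.denom := by
    have h2 : algebraMap ℂ[X] K r.num / algebraMap ℂ[X] K r.denom =
        algebraMap ℂ[X] K p / algebraMap ℂ[X] K q := by rw [RatFunc.num_div_denom, hr]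
    rw [div_eq_div_iff hd' hq', ← map_mul, ← map_mul] at h2
    exact RatFunc.algebraMap_injective ℂ h2
  have h3 : derivative r.num * q + r.num * derivative q =
      derivative p * r.denom + p * derivative r.denom := by
    rw [← derivative_mul, h1, derivative_mul]
  have h4 := congrArg (algebraMap ℂ[X] K) (quotientRule_aux h1 h3)
  rw [map_mul, map_mul, map_pow, map_pow] at h4
  exact (div_eq_div_iff (pow_ne_zero 2 hd') (pow_ne_zero 2 hq')).2 h4

/-- The derivation `d/dx` of `ℂ(x)`, given by the quotient rule. -/
def dx : K →+ K where
  toFun r := algebraMap ℂ[X] K (derivative r.num * r.denom - r.num * derivative r.denom) /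
    algebraMap ℂ[X] K r.denom ^ 2
  map_zero' := by simp
  map_add' r s := by
    have hr : algebraMap ℂ[X] K r.denom ≠ 0 := RatFunc.algebraMap_ne_zero r.denom_ne_zero
    have hs : algebraMap ℂ[X] K s.denom ≠ 0 := RatFunc.algebraMap_ne_zero s.denom_ne_zero
    rw [quotientRule_eq (p := r.num * s.denom + s.num * r.denom) (q := r.denom * s.denom)
      (mul_ne_zero r.denom_ne_zero s.denom_ne_zero) (r + s)]
    · simp only [derivative_mul, map_add, map_sub, map_mul]
      field_simp
      ring
    · conv_lhs => rw [← r.num_div_denom, ← s.num_div_denom]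
      simp only [map_add, map_mul]
      field_simp

theorem dx_C_mul (c : ℂ) (r : K) : dx (RatFunc.C c * r) = RatFunc.C c * dx r := by
  have h := quotientRule_eq (p := C c * r.num) (q := r.denom) r.denom_ne_zero (RatFunc.C c * r) (by
    conv_lhs => rw [← r.num_div_denom]
    rw [map_mul, RatFunc.algebraMap_C, mul_div_assoc])
  refine h.trans ?_
  have h2 : derivative (C c * r.num) * r.denom - C c * r.num * derivative r.denom =
      C c * (derivative r.num * r.denom - r.num * derivative r.denom) := by
    rw [derivative_C_mul]; ring
  rw [h2, map_mul, RatFunc.algebraMap_C, mul_div_assoc]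
  rfl

/-- The space `e^{xz} ℂ(x)((z⁻¹))` of formal functions. The Laurent series `u` (in the parameter
`z⁻¹`) stands for `e^{xz} ∑ k, u_k(x) * z ^ (-k)`; the factor `e^{xz}` is not written. Products
below are always products of such a function with a series without exponential factor. -/
def M : Type := LaurentSeries K

instance : Field M := inferInstanceAs (Field (LaurentSeries K))

/-- A rational function of `x` as a series that is constant in `z`. -/
def cX : K →+* M := (HahnSeries.C : K →+* LaurentSeries K)

instance : Algebra ℂ M := (cX.comp RatFunc.C).toAlgebra

/-- The coefficient of `z ^ (-k)`. -/
def M.coeff (u : M) (k : ℤ) : K := HahnSeries.coeff (u : LaurentSeries K) k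

/-- The variable `z`. -/
def zM : M := (HahnSeries.single (-1) 1 : LaurentSeries K)

/-- The coefficientwise derivative with respect to `x`. -/
def coeffDx : M →+ M where
  toFun u := HahnSeries.map (u : LaurentSeries K) dx
  map_zero' := by
    apply HahnSeries.ext; funext k
    exact map_zero dx
  map_add' u v := by
    apply HahnSeries.ext; funext k
    exact map_add dx (u.coeff k) (v.coeff k)

theorem coeffDx_smul (c : ℂ) (u : M) : coeffDx (c • u) = c • coeffDx u := by
  rw [Algebra.smul_def, Algebra.smul_def]
  apply HahnSeries.ext; funext k
  have h (v : LaurentSeries K) (r : K) : ((HahnSeries.C r : LaurentSeries K) * v).coeff k =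
      r * v.coeff k := by rw [HahnSeries.C_mul_eq_smul]; rfl
  have e1 := h u (RatFunc.C c)
  have e2 := h (coeffDx u) (RatFunc.C c)
  refine Eq.trans ?_ e2.symm
  exact (congrArg dx e1).trans (dx_C_mul c (u.coeff k))

/-- A polynomial `g(z)`. -/
def polyZ (g : ℂ[X]) : M := aeval zM g

/-- A rational function of `z`, expanded at `z = ∞`. -/
def ratZ (r : RatFunc ℂ) : M :=
  RatFunc.eval (cX.comp RatFunc.C) zM r

/-- `∂_x (e^{xz} u) = e^{xz} (∂_x u + z u)`. -/
def nablaX : Module.End ℂ M where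
  toFun u := coeffDx u + zM * u
  map_add' u v := by rw [map_add, mul_add]; abel
  map_smul' c u := by rw [coeffDx_smul, mul_smul_comm, ← smul_add, RingHom.id_apply]

/-- `∂_z` on `ℂ(x)((z⁻¹))`; in the parameter `t = z⁻¹` of the Laurent series it is `-t² d/dt`. -/
def coeffDz (u : M) : M :=
  (-(HahnSeries.single 2 1 * LaurentSeries.derivative K (u : LaurentSeries K)) : LaurentSeries K)

/-- `∂_z (e^{xz} u) = e^{xz} (∂_z u + x u)`. -/
def nablaZ (u : M) : M := coeffDz u + cX RatFunc.X * u

/-! ### Differential operators with rational coefficients -/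

/-- The algebra `ℂ(x)[∂_x]` of differential operators with rational coefficients, realized
(faithfully) on `e^{xz} ℂ(x)((z⁻¹))`: it is generated by the multiplications by rational
functions of `x` and by `∂_x`. -/
abbrev DiffOp : Type :=
  Algebra.adjoin ℂ
    (insert nablaX (Set.range fun r : K => LinearMap.mulLeft ℂ (cX r)))

/-- `P Ψ` for a differential operator `P(x, ∂_x)`. -/
def DiffOp.app (P : DiffOp) (Ψ : M) : M := (P : Module.End ℂ M) Ψ

/-- `∂_x` as a differential operator. -/
def ddx : DiffOp := ⟨nablaX, Algebra.subset_adjoin (Set.mem_insert _ _)⟩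

/-- Multiplication by a rational function of `x` as a differential operator. -/
def mulX (r : K) : DiffOp :=
  ⟨LinearMap.mulLeft ℂ (cX r),
    Algebra.subset_adjoin (Set.mem_insert_of_mem _ ⟨r, rfl⟩)⟩

/-- A polynomial `p(x)` as a rational function. -/
def polyX (p : ℂ[X]) : K := algebraMap ℂ[X] K p

/-- The coefficient `c j ∈ ℂ(x)` in `P = ∑ j, c j ∂_x ^ j`, read off from
`P e^{xz} = e^{xz} ∑ j, c j z ^ j`. -/
def DiffOp.coeff (P : DiffOp) (j : ℕ) : K := (P.app 1).coeff (-(j : ℤ))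

/-- The action of `P(z, ∂_z)`, that is of `P` with `x` replaced by `z`, on `M`. -/
def DiffOp.appZ (P : DiffOp) (Ψ : M) : M := ∑ᶠ j : ℕ, ratZ (P.coeff j) * nablaZ^[j] Ψ

/-- The value at the point `x` of `P φ` for a function `φ` of a real variable. -/
def DiffOp.appFun (P : DiffOp) (φ : ℝ → ℂ) (x : ℝ) : ℂ :=
  ∑ᶠ j : ℕ, (P.coeff j).eval (RingHom.id ℂ) (x : ℂ) * iteratedDeriv j φ x

/-- `φ` represents an element of `ker P`: near `+∞`, where the coefficients of `P` have no poles,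
it is smooth and `P φ = 0`. -/
def InKer (P : DiffOp) (φ : ℝ → ℂ) : Prop :=
  (∀ᶠ x : ℝ in atTop, ContDiffAt ℝ (⊤ : ℕ∞) φ x) ∧ ∀ᶠ x : ℝ in atTop, P.appFun φ x = 0

/-- `f 0, …, f (n - 1)` is a basis of `ker P`; functions are identified when they agree
near `+∞`. -/
def IsKernelBasis {n : ℕ} (P : DiffOp) (f : Fin n → ℝ → ℂ) : Prop :=
  (∀ c : Fin n → ℂ, (∀ᶠ x : ℝ in atTop, ∑ k, c k * f k x = 0) → c = 0) ∧
    ∀ φ : ℝ → ℂ, InKer P φ ↔ ∃ c : Fin n → ℂ, ∀ᶠ x : ℝ in atTop, φ x = ∑ k, c k * f k x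

/-! ### Bessel operators and Bessel wave functions -/

/-- The Euler operator `D = x ∂_x`. -/
def euler : DiffOp := mulX RatFunc.X * ddx

/-- `L_{δ_I} = x ^ (-|I|) ∏ i ∈ I, (D - δ i)`. -/
def besselOp {ι : Type*} (δ : ι → ℂ) (I : Finset ι) : DiffOp :=
  mulX ((RatFunc.X ^ I.card)⁻¹) * aeval euler (∏ i ∈ I, (X - C (δ i)))

/-- The Bessel operator `L_β`. -/
def besselL {N : ℕ} (β : Fin N → ℂ) : DiffOp := besselOp β Finset.univ

/-- `e^{xz} ∑ k, a k * (x z) ^ (-k)`. -/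
def seriesXZ (a : ℕ → ℂ) : M :=
  (HahnSeries.ofPowerSeries ℤ K
    (PowerSeries.mk fun k => RatFunc.C (a k) * (RatFunc.X ^ k)⁻¹) : LaurentSeries K)

/-- The Bessel wave function `Ψ_β(x, z) = e^{xz} (1 + ∑ k ≥ 1, a k * (x z) ^ (-k))`, the formal
solution of `L_β Ψ = z ^ N Ψ` of this form. (It exists and is unique when `∑ β = N (N - 1) / 2`
and `N ≥ 1`.) -/
def besselWave {N : ℕ} (β : Fin N → ℂ) : M :=
  seriesXZ (Classical.epsilon fun a : ℕ → ℂ =>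
    a 0 = 1 ∧ (besselL β).app (seriesXZ a) = zM ^ N * seriesXZ a)

/-- `Ψ = e^{xz} (1 + ∑ k ≥ 1, w k (x) z ^ (-k))`. -/
def IsWave (Ψ : M) : Prop := Ψ.coeff 0 = 1 ∧ ∀ k : ℤ, k < 0 → Ψ.coeff k = 0

/-- The coefficient of `x ^ (-l)` in the expansion at `x = ∞` of a rational function. -/
def coeffInfty (r : K) (l : ℤ) : ℂ :=
  (RatFunc.eval (HahnSeries.C : ℂ →+* LaurentSeries ℂ) (HahnSeries.single (-1) 1) r).coeff l

/-- `Ψ'(x, z) = Ψ(z, x)`: the coefficient of `x ^ (-l) z ^ (-k)` in `e^{-xz} Ψ` is that of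
`x ^ (-k) z ^ (-l)` in `e^{-xz} Ψ'`. -/
def IsSwap (Ψ Ψ' : M) : Prop :=
  ∀ k l : ℤ, coeffInfty (Ψ.coeff k) l = coeffInfty (Ψ'.coeff l) k

/-- `Ψ_W` is the monomial Darboux transformation of `Ψ_β` given by `g` and `P`, where `ker P` has
the basis `f 0, …, f (n - 1)` (all of it supported at `0`). -/
structure IsMonomialDarboux {N n : ℕ} (β : Fin N → ℂ) (f : Fin n → ℝ → ℂ) (g : ℂ[X]) (P : DiffOp)
    (ΨW : M) : Prop where
  wave : IsWave ΨW
  darboux : polyZ g * ΨW = P.app (besselWave β)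
  ker : IsKernelBasis P f
  monomial : g = X ^ n

/-- `f` and `Q` transform `Ψ_W` back into `Ψ_β`, with `f(z) g(z) = h(z ^ N)` and
`Q P = h(L_β)`. -/
structure IsInverseDarboux {N : ℕ} (β : Fin N → ℂ) (h g : ℂ[X]) (P : DiffOp) (ΨW : M)
    (f : ℂ[X]) (Q : DiffOp) : Prop where
  monic : f.Monic
  darboux : polyZ f * besselWave β = Q.app ΨW
  mul_eq : f * g = h.comp (X ^ N)
  comp_eq : Q * P = aeval (besselL β) h

/-- Writing `P = (x^n p_n(x^N))⁻¹ ∑ k ≤ n, p_k(x^N) D^k` with polynomials `p_k`, one has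
`P_b = g(x)⁻¹ ∑ k ≤ n, D^k p_k(L_β)` and `g_b(z) = z^n p_n(z^N)`. -/
def IsDualLeft {N : ℕ} (β : Fin N → ℂ) (n : ℕ) (g : ℂ[X]) (P : DiffOp) (gb : ℂ[X])
    (Pb : DiffOp) : Prop :=
  ∃ p : ℕ → ℂ[X], p n ≠ 0 ∧
    P = mulX (polyX (X ^ n * (p n).comp (X ^ N)))⁻¹ *
      ∑ k ∈ Finset.range (n + 1), mulX (polyX ((p k).comp (X ^ N))) * euler ^ k ∧
    Pb = mulX (polyX g)⁻¹ *
      ∑ k ∈ Finset.range (n + 1), euler ^ k * aeval (besselL β) (p k) ∧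
    gb = X ^ n * (p n).comp (X ^ N)

/-- Writing `Q = (∑ s ≤ m, D^s q_s(x^N)) (x^m q_m(x^N))⁻¹` with polynomials `q_s`, one has
`Q_b = (∑ s ≤ m, q_s(L_β) D^s) f(x)⁻¹` and `f_b(z) = z^m q_m(z^N)`. -/
def IsDualRight {N : ℕ} (β : Fin N → ℂ) (m : ℕ) (f : ℂ[X]) (Q : DiffOp) (fb : ℂ[X])
    (Qb : DiffOp) : Prop :=
  ∃ q : ℕ → ℂ[X], q m ≠ 0 ∧
    Q = (∑ s ∈ Finset.range (m + 1), euler ^ s * mulX (polyX ((q s).comp (X ^ N)))) *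
      mulX (polyX (X ^ m * (q m).comp (X ^ N)))⁻¹ ∧
    Qb = (∑ s ∈ Finset.range (m + 1), aeval (besselL β) (q s) * euler ^ s) *
      mulX (polyX f)⁻¹ ∧
    fb = X ^ m * (q m).comp (X ^ N)

/-! ### The combinatorial data -/

/-- `β^d = (β_1, β_1 + N, …, β_1 + (d-1) N, …, β_N, …, β_N + (d-1) N)`. -/
def betaPow {N : ℕ} (β : Fin N → ℂ) (d : ℕ) : Fin (N * d) → ℂ :=
  fun i => β i.divNat + (N : ℂ) * ((i.modNat : ℕ) : ℂ)

/-- `f_k(x) = ∑ i, a_{ki} x ^ γ_i`. -/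
def kerFun {n m : ℕ} (γ : Fin m → ℂ) (A : Matrix (Fin n) (Fin m) ℂ) : Fin n → ℝ → ℂ :=
  fun k x => ∑ i, A k i * (x : ℂ) ^ γ i

/-- `det A^I`, the minor of `A` on the columns `i_1 < ⋯ < i_n` in `I`. -/
def minor {n m : ℕ} (A : Matrix (Fin n) (Fin m) ℂ) (I : Finset (Fin m)) : ℂ :=
  if h : I.card = n then (A.submatrix id (I.orderEmbOfFin h)).det else 0

/-- `Δ_I = ∏ r < s, (γ_{i_r} - γ_{i_s})`. -/
def vdm {m : ℕ} (γ : Fin m → ℂ) (I : Finset (Fin m)) : ℂ :=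
  ∏ i ∈ I, ∏ j ∈ I with i < j, (γ i - γ j)

/-- The subsets of `{1, …, m}` with `n` elements. -/
def subsets (n m : ℕ) : Finset (Finset (Fin m)) := Finset.powersetCard n Finset.univ

/-- `J` has `n` elements, `det A^J ≠ 0`, and `∑ i ∈ J, γ i` is the minimum of all such sums
(which, in the situation considered, differ from each other by integers). -/
def IsMinimalSet {n m : ℕ} (γ : Fin m → ℂ) (A : Matrix (Fin n) (Fin m) ℂ)
    (J : Finset (Fin m)) : Prop :=
  J ∈ subsets n m ∧ minor A J ≠ 0 ∧
    ∀ I ∈ subsets n m, minor A I ≠ 0 → (∑ i ∈ J, γ i).re ≤ (∑ i ∈ I, γ i).re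

/-- `p_I = ∑ i ∈ I, γ i - ∑ i ∈ I_min, γ i`, as a natural number. -/
def pExp {m : ℕ} (γ : Fin m → ℂ) (Imin I : Finset (Fin m)) : ℕ :=
  ⌊(∑ i ∈ I, γ i - ∑ i ∈ Imin, γ i).re⌋₊

/-- The polynomial `∑ I, det A^I Δ_I x ^ p_I`. -/
def theta {n m : ℕ} (γ : Fin m → ℂ) (A : Matrix (Fin n) (Fin m) ℂ) (Imin : Finset (Fin m)) :
    ℂ[X] :=
  ∑ I ∈ subsets n m, C (minor A I * vdm γ I) * X ^ pExp γ Imin I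

end

end BesselDarboux

open BesselDarboux

/-! Write `D` for `x ∂_x`. Dividing `f_k` by a suitable power `x ^ b_k` turns row `k` of `A` into
monomials `a_{ki} x ^ e_{ki}` with `N ∣ e_{ki}`, while `D` still multiplies the `i`-th term of `f_k`
by `γ_i`. So the Wronskian matrix of the rows with respect to `D` is `W = A V` with `V` a
Vandermonde matrix, and Cauchy–Binet (`det_mul_eq_sum_minors`) gives `det W = ± x ^ κ θ(x)`. Linear
independence of the `f_k` makes `W` invertible (`wronskian_ratMat_ne_zero`).

Formula for `P`: `x ^ n P` is monic of order `n` in `D` and kills the rows. The operator `∑ det A^I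
Δ_I x ^ p_I ∏_{i ∈ I} (D - γ_i)` kills them too: by Cauchy–Binet its symbol is a multiple of the
characteristic polynomial of a companion matrix, and Cayley–Hamilton applies (`rowEval_kerSymbol`).
As `W` is invertible, the two agree up to the leading coefficient `θ` (`wtSymbol_ker`).

Formula for `Q`: Cauchy–Binet followed by Cramer's rule rewrites the sum over complementary products
by means of `W⁻¹` (`cokerSymbol_eq`). In that form it is visibly a left factor: its product with `x
^ n P` is `∏ (D - γ_i) = x ^ (dN) L_β ^ d` (`rightOp_mul_leftOp`).

Bispectrality: `Ψ_β` is a function of `xz`, so polynomials in `D` act on it alike in `x` and in `z`,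
and multiplication by `x ^ N` has the effect of `L_β(z, ∂_z)`. The relation `Corr` transfers
operators in `x` to operators in `z` with the order reversed. It carries the forms of `P` and `Q` in
`D` and `x ^ N` to `P_b` and `Q_b` (`dualOp_appZ`, `dualInverseOp_appZ`), which yields the equation
for `Λ` and the identity `Q_b P_b = Θ(L_β)`.

The exchange of `x` and `z` produces a wave function only if `w_k(x) = O(x ^ (-k))` at infinity.
This holds because an operator with polynomial coefficients that kills `n` independent sums of
powers has an indicial polynomial of degree at least `n` at infinity (`le_natDegree_leadingCoeff`);
hence no coefficient of `∑ det A^I Δ_I x ^ p_I ∏_{i ∈ I} (D - γ_i)` exceeds the degree of `θ`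
(`natDegree_wt_sum_le`). The formula for `P_b` is then a comparison of coefficients
(`polyZ_mul_swapWave`).

All uniqueness statements come from the fact that a nonzero differential operator, in `x` or in `z`,
kills no nonzero series (`DiffOp.eq_zero_of_app_eq_zero`, `DiffOp.eq_zero_of_appZ_eq_zero`). -/

namespace BesselDarboux

noncomputable section

/-! ### Minors and the Cauchy–Binet formula -/

section Minors

variable {R S : Type*} [CommRing R] [CommRing S] {n m : ℕ}

/-- The minor of `A` on the columns in `I`, over an arbitrary commutative ring. -/
def colMinor (A : Matrix (Fin n) (Fin m) R) (I : Finset (Fin m)) : R :=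
  if h : I.card = n then (A.submatrix id (I.orderEmbOfFin h)).det else 0

theorem colMinor_eq_minor (A : Matrix (Fin n) (Fin m) ℂ) (I : Finset (Fin m)) :
    colMinor A I = minor A I := rfl

theorem colMinor_of_card (A : Matrix (Fin n) (Fin m) R) {I : Finset (Fin m)} (h : I.card = n) :
    colMinor A I = (A.submatrix id (I.orderEmbOfFin h)).det := dif_pos h

theorem colMinor_map (f : R →+* S) (A : Matrix (Fin n) (Fin m) R) (I : Finset (Fin m)) :
    colMinor (A.map f) I = f (colMinor A I) := by
  unfold colMinor
  split_ifs
  · rw [RingHom.map_det]; rfl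
  · simp

/-- Multilinearity in the rows: row `k` of `A * B` is the combination of the rows of `B` with
coefficients `A k i`. -/
theorem det_mul_eq_sum_funs (A : Matrix (Fin n) (Fin m) R) (B : Matrix (Fin m) (Fin n) R) :
    (A * B).det = ∑ f : Fin n → Fin m, (∏ k, A k (f k)) * (B.submatrix f id).det := by
  have h : (A * B) = fun k => ∑ i, A k i • B i := by
    funext k j
    simp [Matrix.mul_apply, Finset.sum_apply]
  have h2 := MultilinearMap.map_sum
    (Matrix.detRowAlternating (n := Fin n) (R := R)).toMultilinearMap
    (fun k (i : Fin m) => A k i • B i)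
  have h3 : (A * B).det = (Matrix.detRowAlternating (n := Fin n) (R := R)).toMultilinearMap
    (fun k => ∑ i, A k i • B i) := by rw [h]; rfl
  rw [h3, h2]
  refine Finset.sum_congr rfl fun f _ => ?_
  rw [MultilinearMap.map_smul_univ]
  rfl

/-- A function from `Fin n` onto an `n`-element set `I` is the increasing enumeration of `I`
composed with a permutation, so the left side is the Leibniz expansion of the minor of `A`, the
signs coming from permuting the rows of `B`. -/
theorem sum_funs_with_image (A : Matrix (Fin n) (Fin m) R) (B : Matrix (Fin m) (Fin n) R)
    {I : Finset (Fin m)} (hI : I.card = n) :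
    ∑ f : Fin n → Fin m with Finset.univ.image f = I,
      (∏ k, A k (f k)) * (B.submatrix f id).det = colMinor A I * colMinor B.transpose I := by
  classical
  rw [colMinor_of_card A hI, colMinor_of_card _ hI]
  set e := I.orderEmbOfFin hI with he
  have hB : (B.transpose.submatrix id e).det = (B.submatrix e id).det := by
    rw [← Matrix.det_transpose]; rfl
  rw [hB, Matrix.det_apply, Finset.sum_mul]
  symm
  refine Finset.sum_bij (fun (σ : Equiv.Perm (Fin n)) _ => fun k => e (σ⁻¹ k)) ?_ ?_ ?_ ?_
  · intro σ _
    simp only [Finset.mem_filter, Finset.mem_univ, true_and]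
    ext i
    simp only [Finset.mem_image, Finset.mem_univ, true_and]
    constructor
    · rintro ⟨k, rfl⟩; exact Finset.orderEmbOfFin_mem I hI _
    · intro hi
      have : i ∈ Set.range e := by rw [he, Finset.range_orderEmbOfFin]; exact hi
      obtain ⟨k, hk⟩ := this
      exact ⟨σ k, by simpa using hk⟩
  · intro σ _ τ _ h
    have : σ⁻¹ = τ⁻¹ := by
      ext k
      exact congrArg Fin.val (e.injective (congrFun h k))
    exact inv_injective this
  · intro f hf
    simp only [Finset.mem_filter, Finset.mem_univ, true_and] at hf
    have h1 : ∀ k, ∃ j, e j = f k := by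
      intro k
      have : f k ∈ Set.range e := by
        rw [he, Finset.range_orderEmbOfFin, ← hf]
        exact Finset.mem_coe.2 (Finset.mem_image_of_mem _ (Finset.mem_univ _))
      exact this
    choose g hg using h1
    have hsurj : Function.Surjective g := by
      intro j
      have : e j ∈ Finset.univ.image f := by rw [hf]; exact Finset.orderEmbOfFin_mem I hI _
      obtain ⟨k, _, hk⟩ := Finset.mem_image.1 this
      exact ⟨k, e.injective ((hg k).trans hk)⟩
    refine ⟨(Equiv.ofBijective g (Finite.injective_iff_bijective.1
      (Finite.injective_iff_surjective.2 hsurj)))⁻¹, Finset.mem_univ _, ?_⟩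
    funext k
    simpa using hg k
  · intro σ _
    have h1 : (B.submatrix (fun k => e (σ⁻¹ k)) id).det =
        (Equiv.Perm.sign σ : ℤ) • (B.submatrix e id).det := by
      have := Matrix.det_permute σ⁻¹ (B.submatrix e id)
      rw [Equiv.Perm.sign_inv] at this
      rw [zsmul_eq_mul, ← this]; rfl
    have h2 : ∏ k, A k (e (σ⁻¹ k)) = ∏ k, A.submatrix id e (σ k) k := by
      rw [← Equiv.prod_comp σ]
      simp
    rw [h1, h2, Units.smul_def, smul_mul_assoc, mul_smul_comm]

/-- The Cauchy–Binet formula. -/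
theorem det_mul_eq_sum_minors (A : Matrix (Fin n) (Fin m) R) (B : Matrix (Fin m) (Fin n) R) :
    (A * B).det = ∑ I ∈ subsets n m, colMinor A I * colMinor B.transpose I := by
  classical
  rw [det_mul_eq_sum_funs]
  have h1 : ∑ f : Fin n → Fin m, (∏ k, A k (f k)) * (B.submatrix f id).det =
      ∑ f : Fin n → Fin m with Finset.univ.image f ∈ subsets n m,
        (∏ k, A k (f k)) * (B.submatrix f id).det := by
    symm
    refine Finset.sum_subset (Finset.filter_subset _ _) fun f _ hf => ?_
    have hinj : ¬ Function.Injective f := by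
      intro hinj
      apply hf
      simp only [Finset.mem_filter, Finset.mem_univ, true_and, subsets,
        Finset.mem_powersetCard, Finset.subset_univ]
      rw [Finset.card_image_of_injective _ hinj]; simp
    obtain ⟨a, b, hab, hne⟩ := Function.not_injective_iff.1 hinj
    rw [Matrix.det_zero_of_row_eq hne (by funext j; simp [hab]), mul_zero]
  rw [h1, ← Finset.sum_fiberwise_of_maps_to (g := fun f : Fin n → Fin m => Finset.univ.image f)
    (t := subsets n m) (fun f hf => (Finset.mem_filter.1 hf).2)]
  refine Finset.sum_congr rfl fun I hI => ?_
  have hc : I.card = n := (Finset.mem_powersetCard.1 hI).2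
  rw [← sum_funs_with_image A B hc]
  refine Finset.sum_congr ?_ fun _ _ => rfl
  ext f
  simp only [Finset.mem_filter, Finset.mem_univ, true_and]
  exact ⟨fun h => h.2, fun h => ⟨h ▸ hI, h⟩⟩

/-- The sign relating `vdm` to the Vandermonde determinant. -/
def vdmSign (n : ℕ) : ℂ := ∏ i : Fin n, ∏ _j ∈ Finset.Ioi i, (-1 : ℂ)

theorem vdmSign_mul_self (n : ℕ) : vdmSign n * vdmSign n = 1 := by
  unfold vdmSign
  rw [← Finset.prod_mul_distrib]
  refine Finset.prod_eq_one fun i _ => ?_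
  rw [← Finset.prod_mul_distrib]
  exact Finset.prod_eq_one fun j _ => by norm_num

theorem vdmSign_ne_zero (n : ℕ) : vdmSign n ≠ 0 := fun h => by
  have := vdmSign_mul_self n
  simp [h] at this

theorem prod_orderEmbOfFin {α : Type*} [CommMonoid α] {I : Finset (Fin m)} (h : I.card = n)
    (f : Fin m → α) : ∏ k, f (I.orderEmbOfFin h k) = ∏ i ∈ I, f i := by
  rw [← Finset.prod_coe_sort I f, ← Equiv.prod_comp (I.orderIsoOfFin h).toEquiv]
  rfl

/-- `Matrix.det_vandermonde` multiplies later minus earlier, while `vdm` takes earlier minus later;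
`vdmSign` accounts for the difference. -/
theorem vdm_eq_vandermonde (γ : Fin m → ℂ) {I : Finset (Fin m)} (h : I.card = n) :
    vdm γ I = vdmSign n * (Matrix.vandermonde fun k => γ (I.orderEmbOfFin h k)).det := by
  classical
  rw [Matrix.det_vandermonde, vdmSign, ← Finset.prod_mul_distrib, vdm,
    ← prod_orderEmbOfFin h]
  refine Finset.prod_congr rfl fun i _ => ?_
  rw [← Finset.prod_mul_distrib, Finset.prod_filter, ← prod_orderEmbOfFin h,
    ← Finset.prod_filter]
  have : (Finset.univ.filter fun k => I.orderEmbOfFin h i < I.orderEmbOfFin h k) =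
      Finset.Ioi i := by
    ext k; simp
  rw [this]
  exact Finset.prod_congr rfl fun j _ => by ring

/-- The `m × n` Vandermonde matrix. -/
def vmat (n : ℕ) (γ : Fin m → ℂ) : Matrix (Fin m) (Fin n) ℂ := .of fun i j => γ i ^ (j : ℕ)

theorem colMinor_vmat (γ : Fin m → ℂ) {I : Finset (Fin m)} (h : I.card = n) :
    colMinor (vmat n γ).transpose I = vdmSign n * vdm γ I := by
  rw [vdm_eq_vandermonde γ h, ← mul_assoc, vdmSign_mul_self, one_mul, colMinor_of_card _ h,
    ← Matrix.det_transpose]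
  rfl

/-- `∏ i ∈ I, (s - γ i)`. -/
def linProd (γ : Fin m → ℂ) (I : Finset (Fin m)) : ℂ[X] := ∏ i ∈ I, (X - C (γ i))

/-- The factor `X - C (γ i)` depends only on `i`, so it comes out of the determinant. Through this
minor Cauchy–Binet folds `kerSymbol` into one determinant. -/
theorem colMinor_shifted_vmat (γ : Fin m → ℂ) {I : Finset (Fin m)} (h : I.card = n) :
    colMinor (Matrix.of fun (i : Fin m) (j : Fin n) =>
        (X - C (γ i)) * C (γ i ^ (j : ℕ))).transpose I =
      C (vdmSign n * vdm γ I) * linProd γ I := by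
  rw [← colMinor_vmat γ h, ← colMinor_map, colMinor_of_card _ h, colMinor_of_card _ h,
    mul_comm, linProd, ← prod_orderEmbOfFin h, ← Matrix.det_mul_row]
  congr 1

/-- For `i ∈ I` the product over all indices other than `i` is the product over `Iᶜ` times the
product over `I.erase i`. The latter is the value at `γ i` of one monic polynomial of degree `n -
1`, so replacing the last Vandermonde column by it leaves the determinant unchanged. -/
theorem colMinor_lagrange_vmat (γ : Fin m → ℂ) {I : Finset (Fin m)} (h : I.card = n)
    (j₀ : Fin n) (hj₀ : (j₀ : ℕ) + 1 = n) :
    colMinor (Matrix.of fun (i : Fin m) (j : Fin n) =>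
        if j = j₀ then linProd γ (Finset.univ.erase i) else C (γ i ^ (j : ℕ))).transpose I =
      C (vdmSign n * vdm γ I) * linProd γ Iᶜ := by
  classical
  set e := I.orderEmbOfFin h with he
  set G : (ℂ[X])[X] := ∏ i ∈ I, (X - C (C (γ i))) with hG
  have hGm : G.Monic := monic_prod_of_monic _ _ fun i _ => monic_X_sub_C _
  have hGd : G.natDegree = n := by
    rw [hG, natDegree_prod_of_monic _ _ fun i _ => monic_X_sub_C _]
    simp [h]
  have hGX : G.eval X = linProd γ I := by
    rw [hG, eval_prod, linProd]; simp
  -- With `Y` the outer variable and `s` the inner one, `q = (G(Y) - G(s)) / (Y - s)`. At a root `γ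
  -- i` of `G` its value is `G(s) / (s - γ i)`, which is the product over `I.erase i`.
  set q : (ℂ[X])[X] := G /ₘ (X - C X) with hq
  have hqd : q.natDegree = n - 1 := by
    rw [hq, natDegree_divByMonic _ (monic_X_sub_C _), hGd, natDegree_X_sub_C]
  have hqm : q.Monic := by
    rw [Monic, hq, leadingCoeff_divByMonic_of_monic (monic_X_sub_C _)]
    · exact hGm
    · rw [degree_X_sub_C, degree_eq_natDegree hGm.ne_zero, hGd]
      have : 1 ≤ n := by omega
      exact_mod_cast this
  have hqe : ∀ i ∈ I, q.eval (C (γ i)) = linProd γ (I.erase i) := by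
    intro i hi
    have h1 := congrArg (eval (C (γ i))) (modByMonic_add_div G (X - C (X : ℂ[X])))
    rw [modByMonic_X_sub_C_eq_C_eval, hGX] at h1
    have h2 : G.eval (C (γ i)) = 0 := by
      rw [hG, eval_prod]
      exact Finset.prod_eq_zero hi (by simp)
    rw [h2, eval_add, eval_mul, eval_C, eval_sub, eval_X, eval_C, linProd,
      ← Finset.mul_prod_erase I _ hi] at h1
    have h3 : (X - C (γ i) : ℂ[X]) ≠ 0 := X_sub_C_ne_zero _
    apply mul_left_cancel₀ h3
    rw [linProd]
    linear_combination -h1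
  set p : Fin n → (ℂ[X])[X] := fun j => if j = j₀ then q else X ^ (j : ℕ) with hp
  have hdet := Matrix.det_eval_matrixOfPolynomials_eq_det_vandermonde
    (fun k => C (γ (e k))) p (by
      intro j
      by_cases hj : j = j₀
      · simp only [hp, hj, if_true, hqd]; omega
      · simp [hp, hj]) (by
      intro j
      by_cases hj : j = j₀
      · simpa only [hp, hj, if_true] using hqm
      · simpa only [hp, hj, if_false] using monic_X_pow _)
  have hv : (Matrix.vandermonde fun k => C (γ (e k))).det = C (vdmSign n * vdm γ I) := by
    rw [← colMinor_vmat γ h, colMinor_of_card _ h, ← Matrix.det_transpose, RingHom.map_det]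
    congr 1
    ext i j
    simp [vmat, Matrix.vandermonde_apply, he]
  have hprod : ∏ j, (fun j => if j = j₀ then linProd γ Iᶜ else 1) j = linProd γ Iᶜ := by
    rw [Finset.prod_ite_eq' Finset.univ j₀, if_pos (Finset.mem_univ _)]
  rw [← hv, hdet, colMinor_of_card _ h, ← Matrix.det_transpose, mul_comm, ← hprod,
    ← Matrix.det_mul_row]
  congr 1
  ext1 k j
  simp only [Matrix.transpose_apply, Matrix.submatrix_apply, id, Matrix.of_apply, hp, ← he]
  by_cases hj : j = j₀
  · have hk : e k ∈ I := Finset.orderEmbOfFin_mem I h k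
    simp only [hj, if_true]
    rw [hqe _ hk, linProd, linProd, linProd, ← Finset.prod_union]
    · refine Finset.prod_congr ?_ fun _ _ => rfl
      ext i
      simp only [Finset.mem_erase, Finset.mem_univ, and_true, Finset.mem_union,
        Finset.mem_compl]
      constructor
      · intro hi
        by_cases hI : i ∈ I
        · exact Or.inr ⟨hi, hI⟩
        · exact Or.inl hI
      · rintro (hi | hi)
        · rintro rfl; exact hi hk
        · exact hi.1
    · exact Finset.disjoint_left.2 fun i hi hi' =>
        Finset.mem_compl.1 hi (Finset.mem_of_mem_erase hi')
  · simp [hj]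

end Minors

/-! ### Polynomials annihilating the rows of a matrix of exponential type -/

section Annihilator

variable {F : Type*} [Field F] [Algebra ℂ F] {n m : ℕ}

/-- The Wronskian matrix of the functions `∑ i, A k i` with respect to a derivation that acts on
the `i`-th summand as multiplication by `γ i`. -/
def wronskian (γ : Fin m → ℂ) (A : Matrix (Fin n) (Fin m) F) : Matrix (Fin n) (Fin n) F :=
  A * (vmat n γ).map (algebraMap ℂ F)

/-- The result of applying the operator with symbol `q` to `∑ i, A k i`. -/
def rowEval (γ : Fin m → ℂ) (A : Matrix (Fin n) (Fin m) F) (k : Fin n) : F[X] →ₗ[F] F where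
  toFun q := ∑ i, A k i * q.eval (algebraMap ℂ F (γ i))
  map_add' p q := by simp [mul_add, Finset.sum_add_distrib]
  map_smul' c q := by
    simp only [eval_smul, smul_eq_mul, RingHom.id_apply, Finset.mul_sum]
    exact Finset.sum_congr rfl fun i _ => by ring

theorem rowEval_apply (γ : Fin m → ℂ) (A : Matrix (Fin n) (Fin m) F) (k : Fin n) (q : F[X]) :
    rowEval γ A k q = ∑ i, A k i * q.eval (algebraMap ℂ F (γ i)) := rfl

theorem rowEval_X_pow (γ : Fin m → ℂ) (A : Matrix (Fin n) (Fin m) F) (k j : Fin n) :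
    rowEval γ A k (X ^ (j : ℕ)) = wronskian γ A k j := by
  simp [rowEval_apply, wronskian, Matrix.mul_apply, vmat]

theorem rowEval_eq_mulVec (γ : Fin m → ℂ) (A : Matrix (Fin n) (Fin m) F) (k : Fin n) {q : F[X]}
    (hq : q.degree < n) :
    rowEval γ A k q = (wronskian γ A).mulVec (fun j => q.coeff j) k := by
  have h1 : q = ∑ j : Fin n, q.coeff j • X ^ (j : ℕ) := by
    rw [Fin.sum_univ_eq_sum_range (fun j => q.coeff j • (X : F[X]) ^ j) n]
    by_cases h0 : q = 0
    · simp [h0]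
    conv_lhs => rw [q.as_sum_range' n ((natDegree_lt_iff_degree_lt h0).2 hq)]
    simp [← C_mul_X_pow_eq_monomial, smul_eq_C_mul]
  conv_lhs => rw [h1]
  simp only [map_sum, map_smul, rowEval_X_pow, Matrix.mulVec, dotProduct, smul_eq_mul]
  exact Finset.sum_congr rfl fun j _ => mul_comm _ _

/-- The coefficient vector of `q` lies in the kernel of the Wronskian matrix. Below, operators are
identified by comparing leading coefficients and their effect on the rows. -/
theorem eq_zero_of_rowEval_eq_zero {γ : Fin m → ℂ} {A : Matrix (Fin n) (Fin m) F}
    (hW : (wronskian γ A).det ≠ 0) {q : F[X]} (hq : q.degree < n)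
    (h : ∀ k, rowEval γ A k q = 0) : q = 0 := by
  have h1 : (wronskian γ A).mulVec (fun j => q.coeff j) = 0 := by
    funext k
    rw [← rowEval_eq_mulVec γ A k hq, h k]; rfl
  have h2 := Matrix.eq_zero_of_mulVec_eq_zero hW h1
  ext j
  by_cases hj : j < n
  · exact congrFun h2 ⟨j, hj⟩
  · rw [coeff_zero]
    exact coeff_eq_zero_of_degree_lt (hq.trans_le (by exact_mod_cast not_lt.1 hj))

/-- The symbol `∑ I, det A^I Δ_I ∏ i ∈ I, (s - γ i)`. -/
def kerSymbol (γ : Fin m → ℂ) (A : Matrix (Fin n) (Fin m) F) : F[X] :=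
  ∑ I ∈ subsets n m, C (colMinor A I * algebraMap ℂ F (vdm γ I)) *
    (linProd γ I).map (algebraMap ℂ F)

/-- The symbol `∑ I, det A^I Δ_I ∏ i ∉ I, (s - γ i)`. -/
def cokerSymbol (γ : Fin m → ℂ) (A : Matrix (Fin n) (Fin m) F) : F[X] :=
  ∑ I ∈ subsets n m, C (colMinor A I * algebraMap ℂ F (vdm γ I)) *
    (linProd γ Iᶜ).map (algebraMap ℂ F)

theorem card_of_mem_subsets {I : Finset (Fin m)} (h : I ∈ subsets n m) : I.card = n :=
  (Finset.mem_powersetCard.1 h).2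

theorem linProd_monic (γ : Fin m → ℂ) (I : Finset (Fin m)) : (linProd γ I).Monic :=
  monic_prod_of_monic _ _ fun _ _ => monic_X_sub_C _

theorem linProd_natDegree (γ : Fin m → ℂ) (I : Finset (Fin m)) :
    (linProd γ I).natDegree = I.card := by
  rw [linProd, natDegree_prod_of_monic _ _ fun _ _ => monic_X_sub_C _]
  simp

theorem linProd_coeff_card (γ : Fin m → ℂ) (I : Finset (Fin m)) :
    (linProd γ I).coeff I.card = 1 := by
  rw [← linProd_natDegree γ I]; exact linProd_monic γ I

theorem det_wronskian (γ : Fin m → ℂ) (A : Matrix (Fin n) (Fin m) F) :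
    ∑ I ∈ subsets n m, colMinor A I * algebraMap ℂ F (vdm γ I) =
      algebraMap ℂ F (vdmSign n) * (wronskian γ A).det := by
  rw [wronskian, det_mul_eq_sum_minors, Finset.mul_sum]
  refine Finset.sum_congr rfl fun I hI => ?_
  rw [← Matrix.transpose_map, colMinor_map, colMinor_vmat γ (card_of_mem_subsets hI), map_mul]
  have := congrArg (algebraMap ℂ F) (vdmSign_mul_self n)
  rw [map_mul, map_one] at this
  linear_combination (-colMinor A I * algebraMap ℂ F (vdm γ I)) * this

theorem kerSymbol_coeff_card (γ : Fin m → ℂ) (A : Matrix (Fin n) (Fin m) F) :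
    (kerSymbol γ A).coeff n = algebraMap ℂ F (vdmSign n) * (wronskian γ A).det := by
  rw [← det_wronskian, kerSymbol, finsetSum_coeff]
  refine Finset.sum_congr rfl fun I hI => ?_
  rw [coeff_C_mul, coeff_map]
  have h := linProd_coeff_card γ I
  rw [card_of_mem_subsets hI] at h
  rw [h, map_one, mul_one]

theorem kerSymbol_natDegree_le (γ : Fin m → ℂ) (A : Matrix (Fin n) (Fin m) F) :
    (kerSymbol γ A).natDegree ≤ n := by
  refine natDegree_sum_le_of_forall_le _ _ fun I hI => ?_
  refine (natDegree_C_mul_le _ _).trans (natDegree_map_le.trans ?_)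
  rw [linProd_natDegree, card_of_mem_subsets hI]

/-- The transpose of the companion matrix of the annihilating polynomial. -/
def compMat (γ : Fin m → ℂ) (A : Matrix (Fin n) (Fin m) F) : Matrix (Fin n) (Fin n) F :=
  (wronskian γ A)⁻¹ * Matrix.of fun k (j : Fin n) => rowEval γ A k (X ^ ((j : ℕ) + 1))

theorem wronskian_mul_compMat {γ : Fin m → ℂ} {A : Matrix (Fin n) (Fin m) F}
    (hW : (wronskian γ A).det ≠ 0) :
    wronskian γ A * compMat γ A = Matrix.of fun k (j : Fin n) => rowEval γ A k (X ^ ((j : ℕ) + 1)) := by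
  rw [compMat, ← mul_assoc, Matrix.mul_nonsing_inv _ (isUnit_iff_ne_zero.2 hW), one_mul]

/-- By Cauchy–Binet the sum is `det (A · diag(s - γ) · V)` up to sign. Here `A · diag(γ) · V` is the
Wronskian matrix `W` shifted by one derivative, that is `W * compMat`, so the matrix inside is `W *
(s - compMat)`. -/
theorem kerSymbol_eq_charpoly {γ : Fin m → ℂ} {A : Matrix (Fin n) (Fin m) F}
    (hW : (wronskian γ A).det ≠ 0) :
    kerSymbol γ A = C (algebraMap ℂ F (vdmSign n) * (wronskian γ A).det) *
      (compMat γ A).charpoly := by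
  set B : Matrix (Fin m) (Fin n) ℂ[X] := Matrix.of fun (i : Fin m) (j : Fin n) =>
        (X - C (γ i)) * C (γ i ^ (j : ℕ)) with hB
  have h1 : kerSymbol γ A = C (algebraMap ℂ F (vdmSign n)) *
      (A.map C * B.map (mapRingHom (algebraMap ℂ F))).det := by
    rw [det_mul_eq_sum_minors, kerSymbol, Finset.mul_sum]
    refine Finset.sum_congr rfl fun I hI => ?_
    rw [← Matrix.transpose_map, colMinor_map, colMinor_map,
      colMinor_shifted_vmat γ (card_of_mem_subsets hI)]
    have := congrArg (fun z => (C (algebraMap ℂ F z) : F[X])) (vdmSign_mul_self n)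
    simp only [map_mul, map_one] at this
    simp only [map_mul, coe_mapRingHom, map_C]
    linear_combination (-C (colMinor A I) * C (algebraMap ℂ F (vdm γ I)) *
      (linProd γ I).map (algebraMap ℂ F)) * this
  have h2 : A.map C * B.map (mapRingHom (algebraMap ℂ F)) =
      (wronskian γ A).map C * (compMat γ A).charmatrix := by
    rw [Matrix.charmatrix, mul_sub]
    have h3 : (wronskian γ A).map C * (C : F →+* F[X]).mapMatrix (compMat γ A) =
        (Matrix.of fun k (j : Fin n) => rowEval γ A k (X ^ ((j : ℕ) + 1))).map C := by
      rw [← wronskian_mul_compMat hW, Matrix.map_mul]; rfl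
    rw [h3]
    refine Matrix.ext fun k j => ?_
    rw [Matrix.sub_apply, Matrix.scalar_apply, Matrix.mul_diagonal]
    simp only [Matrix.mul_apply, Matrix.map_apply, Matrix.of_apply, wronskian, vmat, hB,
      rowEval_apply, map_sum, map_mul, Finset.sum_mul, ← Finset.sum_sub_distrib,
      coe_mapRingHom, Polynomial.map_mul, Polynomial.map_sub, map_X, map_C, eval_pow, eval_X,
      map_pow]
    refine Finset.sum_congr rfl fun i _ => ?_
    rw [Polynomial.map_pow, map_C]
    ring
  rw [h1, h2, Matrix.det_mul, Matrix.charpoly, ← RingHom.mapMatrix_apply, ← RingHom.map_det,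
    ← mul_assoc, ← map_mul]

/-- `compMat` sends the `j`-th basis vector to the next one for `j + 1 < n`, because multiplication
by `W` turns them into the `j`-th and `(j + 1)`-st derivatives of the rows. The last power `j = n`
needs only the column of the shifted Wronskian matrix. -/
theorem wronskian_mulVec_compMat_pow {γ : Fin m → ℂ} {A : Matrix (Fin n) (Fin m) F}
    (hW : (wronskian γ A).det ≠ 0) (j₀ : Fin n) (hj₀ : (j₀ : ℕ) = 0) (j : ℕ) (hj : j ≤ n) :
    (wronskian γ A).mulVec ((compMat γ A ^ j).mulVec (Pi.single j₀ 1)) =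
      fun k => rowEval γ A k (X ^ j) := by
  induction j with
  | zero =>
    funext k
    rw [pow_zero, Matrix.one_mulVec, Matrix.mulVec_single_one, ← hj₀, rowEval_X_pow]
    rfl
  | succ j ih =>
    have h1 : (wronskian γ A).mulVec (Pi.single (⟨j, hj⟩ : Fin n) 1) =
        fun k => rowEval γ A k (X ^ j) := by
      funext k
      rw [Matrix.mulVec_single_one]
      exact (rowEval_X_pow γ A k ⟨j, hj⟩).symm
    have h2 : (compMat γ A ^ j).mulVec (Pi.single j₀ 1) = Pi.single (⟨j, hj⟩ : Fin n) 1 :=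
      Matrix.mulVec_injective_of_isUnit ((Matrix.isUnit_iff_isUnit_det _).2
        (isUnit_iff_ne_zero.2 hW)) ((ih (by omega)).trans h1.symm)
    rw [pow_succ', ← Matrix.mulVec_mulVec, h2, Matrix.mulVec_mulVec, wronskian_mul_compMat hW,
      Matrix.mulVec_single_one]
    rfl

/-- Cayley–Hamilton for `compMat`, applied to the first basis vector: multiplying by the Wronskian
matrix turns `χ(compMat) e₀` into the vector of values of the symbol `χ` on the rows. -/
theorem rowEval_kerSymbol {γ : Fin m → ℂ} {A : Matrix (Fin n) (Fin m) F}
    (hW : (wronskian γ A).det ≠ 0) (k : Fin n) : rowEval γ A k (kerSymbol γ A) = 0 := by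
  rw [kerSymbol_eq_charpoly hW, ← smul_eq_C_mul, map_smul]
  set p := (compMat γ A).charpoly
  let j₀ : Fin n := ⟨0, k.pos⟩
  have hd : p.natDegree = n := by
    rw [Matrix.charpoly_natDegree_eq_dim, Fintype.card_fin]
  have h1 : rowEval γ A k p =
      (wronskian γ A).mulVec ((aeval (compMat γ A) p).mulVec (Pi.single j₀ 1)) k := by
    rw [aeval_eq_sum_range, Matrix.sum_mulVec, Matrix.mulVec_sum, Finset.sum_apply, hd]
    conv_lhs => rw [p.as_sum_range, map_sum, hd]
    refine Finset.sum_congr rfl fun j hj => ?_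
    rw [Matrix.smul_mulVec, Matrix.mulVec_smul, wronskian_mulVec_compMat_pow hW j₀ rfl j
      (by simpa [Nat.lt_succ_iff] using hj), ← C_mul_X_pow_eq_monomial, ← smul_eq_C_mul, map_smul]
    rfl
  rw [h1, Matrix.aeval_self_charpoly, Matrix.zero_mulVec, Matrix.mulVec_zero]
  simp

/-- Cauchy–Binet with the matrix of `colMinor_lagrange_vmat` gives the determinant of the Wronskian
matrix with its last column replaced, and Cramer's rule expands it along that column. -/
theorem cokerSymbol_eq (γ : Fin m → ℂ) (A : Matrix (Fin n) (Fin m) F) (j₀ : Fin n)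
    (hj₀ : (j₀ : ℕ) + 1 = n) :
    cokerSymbol γ A = C (algebraMap ℂ F (vdmSign n)) *
      ∑ r, C ((wronskian γ A).adjugate j₀ r) *
        ∑ i, C (A r i) * (linProd γ (Finset.univ.erase i)).map (algebraMap ℂ F) := by
  set B : Matrix (Fin m) (Fin n) ℂ[X] := Matrix.of fun (i : Fin m) (j : Fin n) =>
        if j = j₀ then linProd γ (Finset.univ.erase i) else C (γ i ^ (j : ℕ)) with hB
  have h1 : cokerSymbol γ A = C (algebraMap ℂ F (vdmSign n)) *
      (A.map C * B.map (mapRingHom (algebraMap ℂ F))).det := by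
    rw [det_mul_eq_sum_minors, cokerSymbol, Finset.mul_sum]
    refine Finset.sum_congr rfl fun I hI => ?_
    rw [← Matrix.transpose_map, colMinor_map, colMinor_map,
      colMinor_lagrange_vmat γ (card_of_mem_subsets hI) j₀ hj₀]
    have := congrArg (fun z => (C (algebraMap ℂ F z) : F[X])) (vdmSign_mul_self n)
    simp only [map_mul, map_one] at this
    simp only [map_mul, coe_mapRingHom, map_C]
    linear_combination (-C (colMinor A I) * C (algebraMap ℂ F (vdm γ I)) *
      (linProd γ Iᶜ).map (algebraMap ℂ F)) * this
  have h2 : A.map C * B.map (mapRingHom (algebraMap ℂ F)) =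
      ((wronskian γ A).map C).updateCol j₀ fun r =>
        ∑ i, C (A r i) * (linProd γ (Finset.univ.erase i)).map (algebraMap ℂ F) := by
    refine Matrix.ext fun k j => ?_
    rw [Matrix.updateCol_apply, Matrix.mul_apply]
    by_cases hj : j = j₀
    · simp [hj, hB]
    · simp [hj, hB, wronskian, Matrix.mul_apply, vmat]
  rw [h1, h2, ← Matrix.cramer_apply, Matrix.cramer_eq_adjugate_mulVec, Matrix.mulVec, dotProduct,
    ← RingHom.mapMatrix_apply, ← RingHom.map_adjugate]
  rfl

end Annihilator

/-! ### Factorization of operators with constant exponents -/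

section CoeffDerivation

variable {F : Type*} [Field F] [Algebra ℂ F] {n m : ℕ}

/-- A derivation applied to the coefficients of a polynomial. -/
def coeffDer (δ : Derivation ℂ F F) (q : F[X]) : F[X] :=
  ∑ j ∈ Finset.range (q.natDegree + 1), C (δ (q.coeff j)) * X ^ j

theorem coeffDer_coeff (δ : Derivation ℂ F F) (q : F[X]) (j : ℕ) :
    (coeffDer δ q).coeff j = δ (q.coeff j) := by
  rw [coeffDer, finsetSum_coeff]
  simp only [coeff_C_mul_X_pow]
  rw [Finset.sum_ite_eq]
  split_ifs with h
  · rfl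
  · rw [coeff_eq_zero_of_natDegree_lt (by simpa [Nat.lt_succ_iff] using h), map_zero]

theorem derivation_eval (δ : Derivation ℂ F F) (q : F[X]) (c : ℂ) :
    δ (q.eval (algebraMap ℂ F c)) = (coeffDer δ q).eval (algebraMap ℂ F c) := by
  rw [coeffDer, eval_finsetSum, eval_eq_sum_range, map_sum]
  refine Finset.sum_congr rfl fun j _ => ?_
  rw [Derivation.leibniz, ← map_pow, Derivation.map_algebraMap, smul_zero, zero_add, smul_eq_mul,
    eval_mul, eval_C, eval_pow, eval_X, map_pow, mul_comm]

/-- The entries of row `k` are the terms of `f_k` divided by `x ^ b_k`, so differentiating `f_k`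
amounts to `δ + b k` on the row; `X * q + coeffDer δ q` is the symbol of `D` composed with the
operator of symbol `q`. -/
theorem derivation_rowEval (δ : Derivation ℂ F F) {γ : Fin m → ℂ} {b : Fin n → ℂ}
    {A : Matrix (Fin n) (Fin m) F}
    (hA : ∀ k i, δ (A k i) = algebraMap ℂ F (γ i - b k) * A k i) (k : Fin n) (q : F[X]) :
    rowEval γ A k (X * q + coeffDer δ q) =
      δ (rowEval γ A k q) + algebraMap ℂ F (b k) * rowEval γ A k q := by
  simp only [rowEval_apply, map_sum, Finset.mul_sum, ← Finset.sum_add_distrib,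
    Derivation.leibniz, hA, derivation_eval, smul_eq_mul, eval_add, eval_mul, eval_X, map_sub]
  exact Finset.sum_congr rfl fun i _ => by ring

/-- The symbols of the operators dual to the rows of `A`. -/
def dualSymbol (γ : Fin m → ℂ) (A : Matrix (Fin n) (Fin m) F) (r : Fin n) : F[X] :=
  ∑ j : Fin n, C ((wronskian γ A)⁻¹ j r) * X ^ (j : ℕ)

theorem dualSymbol_coeff (γ : Fin m → ℂ) (A : Matrix (Fin n) (Fin m) F) (r j : Fin n) :
    (dualSymbol γ A r).coeff j = (wronskian γ A)⁻¹ j r := by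
  simp only [dualSymbol, finsetSum_coeff, coeff_C_mul_X_pow]
  rw [Finset.sum_eq_single j (fun i _ hi => if_neg fun h => hi (Fin.ext h.symm)) (by simp),
    if_pos rfl]

theorem dualSymbol_degree_lt (γ : Fin m → ℂ) (A : Matrix (Fin n) (Fin m) F) (r : Fin n) :
    (dualSymbol γ A r).degree < n := by
  refine (degree_sum_le _ _).trans_lt ((Finset.sup_lt_iff (WithBot.bot_lt_coe n)).2 fun j _ => ?_)
  exact (degree_C_mul_X_pow_le _ _).trans_lt (Nat.cast_lt.2 j.2)

theorem rowEval_dualSymbol {γ : Fin m → ℂ} {A : Matrix (Fin n) (Fin m) F}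
    (hW : (wronskian γ A).det ≠ 0) (k r : Fin n) :
    rowEval γ A k (dualSymbol γ A r) = if k = r then 1 else 0 := by
  rw [rowEval_eq_mulVec γ A k (dualSymbol_degree_lt γ A r)]
  simp only [dualSymbol_coeff]
  have := congrFun (congrFun (Matrix.mul_nonsing_inv _ (isUnit_iff_ne_zero.2 hW)) k) r
  rw [Matrix.one_apply, Matrix.mul_apply] at this
  exact this

/-- Both sides kill every row: the dual operator sends row `k` to the constant `0` or `1`, and `D -
b r` kills `x ^ b r`. The coefficients in degree `n` agree, since the top coefficient of
`dualSymbol` is the `(j₀, r)` entry of the inverse Wronskian matrix. The difference thus has degree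
below `n` and vanishes. -/
theorem dualSymbol_step (δ : Derivation ℂ F F) {γ : Fin m → ℂ} {b : Fin n → ℂ}
    {A : Matrix (Fin n) (Fin m) F}
    (hA : ∀ k i, δ (A k i) = algebraMap ℂ F (γ i - b k) * A k i)
    (hW : (wronskian γ A).det ≠ 0) {p : F[X]} (hp : p.Monic) (hpd : p.natDegree = n)
    (hpk : ∀ k, rowEval γ A k p = 0) (r j₀ : Fin n) (hj₀ : (j₀ : ℕ) + 1 = n) :
    X * dualSymbol γ A r + coeffDer δ (dualSymbol γ A r) -
        C (algebraMap ℂ F (b r)) * dualSymbol γ A r = C ((wronskian γ A)⁻¹ j₀ r) * p := by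
  rw [← sub_eq_zero]
  refine eq_zero_of_rowEval_eq_zero hW ?_ fun k => ?_
  · rw [degree_lt_iff_coeff_zero]
    intro j hj
    have hd : ∀ i, n ≤ i → (dualSymbol γ A r).coeff i = 0 := fun i hi =>
      (degree_lt_iff_coeff_zero _ _).1 (dualSymbol_degree_lt γ A r) i (by exact_mod_cast hi)
    obtain ⟨i, rfl⟩ : ∃ i, j = i + 1 := ⟨j - 1, by omega⟩
    rw [coeff_sub, coeff_sub, coeff_add, coeff_X_mul, coeffDer_coeff, coeff_C_mul, coeff_C_mul,
      hd (i + 1) (by exact_mod_cast hj), map_zero, mul_zero, add_zero, sub_zero]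
    rcases Nat.lt_or_ge n (i + 1) with h | h
    · rw [hd i (by omega), coeff_eq_zero_of_natDegree_lt (by omega), mul_zero, sub_zero]
    · have hj : i = (j₀ : ℕ) := by have : n ≤ i + 1 := by exact_mod_cast hj
                                   omega
      have h1 : p.coeff (i + 1) = 1 := by rw [hj, hj₀, ← hpd]; exact hp
      rw [h1, mul_one, hj, dualSymbol_coeff, sub_self]
  · rw [map_sub, map_sub, derivation_rowEval δ hA, ← smul_eq_C_mul, ← smul_eq_C_mul, map_smul,
      map_smul, hpk, rowEval_dualSymbol hW]
    split_ifs with h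
    · subst h; simp
    · simp

/-- The row sum `∑ i, A r i` is the entry of the Wronskian matrix in the column of the zeroth
derivative, so this is the column `0` of `W⁻¹ * W = 1`. -/
theorem sum_wronskian_dualSymbol {γ : Fin m → ℂ} {A : Matrix (Fin n) (Fin m) F}
    (hW : (wronskian γ A).det ≠ 0) (hn : 0 < n) :
    ∑ r, C (∑ i, A r i) * dualSymbol γ A r = 1 := by
  let z : Fin n := ⟨0, hn⟩
  have h0 : ∀ r, ∑ i, A r i = wronskian γ A r z := by
    intro r
    rw [← rowEval_X_pow, rowEval_apply]
    simp [z]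
  have h := Matrix.nonsing_inv_mul _ (isUnit_iff_ne_zero.2 hW)
  simp only [h0, dualSymbol, Finset.mul_sum]
  rw [Finset.sum_comm]
  have h2 : ∀ j : Fin n, ∑ r, C (wronskian γ A r z) * (C ((wronskian γ A)⁻¹ j r) * X ^ (j : ℕ)) =
      C ((1 : Matrix (Fin n) (Fin n) F) j z) * X ^ (j : ℕ) := by
    intro j
    rw [← h, Matrix.mul_apply, map_sum, Finset.sum_mul]
    refine Finset.sum_congr rfl fun r _ => ?_
    rw [map_mul]; ring
  rw [Finset.sum_congr rfl fun j _ => h2 j, Finset.sum_eq_single z (fun j _ hj => by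
    rw [Matrix.one_apply_ne hj]; simp) (by simp)]
  simp [z]

end CoeffDerivation

/-! ### Operators in normal form with coefficients on the left or on the right. -/

section Symbols

variable {F E : Type*} [Field F] [Algebra ℂ F] [Ring E] [Algebra ℂ E] (μ : F →ₐ[ℂ] E) (D : E)

/-- The operator `∑ j, q_j D ^ j`. -/
def leftOp (q : F[X]) : E := q.eval₂ (μ : F →+* E) D

/-- The operator `∑ j, D ^ j q_j`. -/
def rightOp (q : F[X]) : E := q.sum fun j c => D ^ j * μ c

theorem leftOp_add (p q : F[X]) : leftOp μ D (p + q) = leftOp μ D p + leftOp μ D q :=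
  eval₂_add _ _

theorem leftOp_sum {ι : Type*} (s : Finset ι) (f : ι → F[X]) :
    leftOp μ D (∑ i ∈ s, f i) = ∑ i ∈ s, leftOp μ D (f i) := eval₂_finsetSum _ _ _ _

theorem leftOp_eq_sum_of_lt {q : F[X]} {B : ℕ} (h : q.natDegree < B) :
    leftOp μ D q = ∑ j ∈ Finset.range B, μ (q.coeff j) * D ^ j :=
  eval₂_eq_sum_range' _ h _

theorem rightOp_add (p q : F[X]) : rightOp μ D (p + q) = rightOp μ D p + rightOp μ D q :=
  sum_add_index _ _ _ (by simp) (by simp [mul_add])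

theorem rightOp_zero : rightOp μ D 0 = 0 := sum_zero_index _

theorem rightOp_sum {ι : Type*} (s : Finset ι) (f : ι → F[X]) :
    rightOp μ D (∑ i ∈ s, f i) = ∑ i ∈ s, rightOp μ D (f i) := by
  classical
  induction s using Finset.induction_on with
  | empty => simp [rightOp_zero]
  | insert a s ha ih => rw [Finset.sum_insert ha, Finset.sum_insert ha, rightOp_add, ih]

theorem leftOp_C_mul (c : F) (q : F[X]) : leftOp μ D (C c * q) = μ c * leftOp μ D q := by
  induction q using Polynomial.induction_on' with
  | add p q hp hq => rw [mul_add, leftOp_add, leftOp_add, hp, hq, mul_add]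
  | monomial j a => simp [leftOp, C_mul_monomial, eval₂_monomial, mul_assoc]

theorem rightOp_C_mul (c : F) (q : F[X]) : rightOp μ D (C c * q) = rightOp μ D q * μ c := by
  induction q using Polynomial.induction_on' with
  | add p q hp hq => rw [mul_add, rightOp_add, rightOp_add, hp, hq, add_mul]
  | monomial j a => simp [rightOp, C_mul_monomial, sum_monomial_index, mul_assoc, ← map_mul,
      mul_comm]

theorem leftOp_map (p : ℂ[X]) : leftOp μ D (p.map (algebraMap ℂ F)) = aeval D p := by
  rw [leftOp, eval₂_map, aeval_def]
  congr 1
  ext1 c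
  exact μ.commutes c

theorem rightOp_map (p : ℂ[X]) : rightOp μ D (p.map (algebraMap ℂ F)) = aeval D p := by
  induction p using Polynomial.induction_on' with
  | add p q hp hq => rw [Polynomial.map_add, rightOp_add, hp, hq, map_add]
  | monomial j a =>
    rw [map_monomial, rightOp, sum_monomial_index _ _ (by simp), aeval_monomial, AlgHom.commutes,
      Algebra.commutes]

variable {μ D}

theorem mul_leftOp {δ : Derivation ℂ F F} (hD : ∀ h, D * μ h = μ h * D + μ (δ h)) (q : F[X]) :
    D * leftOp μ D q = leftOp μ D (X * q + coeffDer δ q) := by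
  have h1 : coeffDer δ q = ∑ j ∈ Finset.range (q.natDegree + 1), C (δ (q.coeff j)) * X ^ j := rfl
  have h2 : X * q = ∑ j ∈ Finset.range (q.natDegree + 1), C (q.coeff j) * X ^ (j + 1) := by
    conv_lhs => rw [q.as_sum_range_C_mul_X_pow]
    rw [Finset.mul_sum]
    exact Finset.sum_congr rfl fun j _ => by ring
  have h3 : ∀ c (j : ℕ), leftOp μ D (C c * X ^ j) = μ c * D ^ j := by
    intro c j
    rw [leftOp_C_mul, leftOp, eval₂_X_pow]
  rw [h1, h2, ← Finset.sum_add_distrib, leftOp_sum, leftOp_eq_sum_of_lt μ D (Nat.lt_succ_self _),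
    Finset.mul_sum]
  refine Finset.sum_congr rfl fun j _ => ?_
  rw [leftOp_add, h3, h3, ← mul_assoc, hD, add_mul, mul_assoc, pow_succ']

/-- The operator with kernel spanned by the rows of `A` is a right factor of the operator
annihilating all exponentials, with the left factor given by complementary minors. -/
theorem rightOp_mul_leftOp {n m : ℕ} {δ : Derivation ℂ F F}
    (hD : ∀ h, D * μ h = μ h * D + μ (δ h)) {γ : Fin m → ℂ} {b : Fin n → ℂ}
    {A : Matrix (Fin n) (Fin m) F}
    (hA : ∀ k i, δ (A k i) = algebraMap ℂ F (γ i - b k) * A k i)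
    (hW : (wronskian γ A).det ≠ 0) {p : F[X]} (hp : p.Monic) (hpd : p.natDegree = n)
    (hpk : ∀ k, rowEval γ A k p = 0) (j₀ : Fin n) (hj₀ : (j₀ : ℕ) + 1 = n) :
    rightOp μ D (∑ r, C ((wronskian γ A)⁻¹ j₀ r) *
        ∑ i, C (A r i) * (linProd γ (Finset.univ.erase i)).map (algebraMap ℂ F)) * leftOp μ D p =
      aeval D (linProd γ Finset.univ) := by
  -- The operator of `p`, scaled by an entry of the inverse Wronskian matrix, has the left factor `D
  -- - b r`.
  have h1 : ∀ r, μ ((wronskian γ A)⁻¹ j₀ r) * leftOp μ D p =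
      (D - algebraMap ℂ E (b r)) * leftOp μ D (dualSymbol γ A r) := by
    intro r
    have e1 := congrArg (leftOp μ D) (dualSymbol_step δ hA hW hp hpd hpk r j₀ hj₀)
    rw [leftOp_C_mul] at e1
    rw [← e1, sub_mul, mul_leftOp hD, eq_comm, sub_eq_iff_eq_add, ← μ.commutes, ← leftOp_C_mul,
      ← leftOp_add, sub_add_cancel]
  -- Conjugation by the monomial `A r i` changes `D - b r` into `D - γ i`, exactly the factor
  -- missing from the product over `univ.erase i`.
  have h2 : ∀ r i, μ (A r i) * (D - algebraMap ℂ E (b r)) =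
      (D - algebraMap ℂ E (γ i)) * μ (A r i) := by
    intro r i
    rw [mul_sub, sub_mul, hD, hA, map_mul, AlgHom.commutes, ← Algebra.commutes (b r), map_sub]
    noncomm_ring
  have h3 : ∀ i, aeval D (linProd γ (Finset.univ.erase i)) * (D - algebraMap ℂ E (γ i)) =
      aeval D (linProd γ Finset.univ) := by
    intro i
    rw [linProd, linProd, ← Finset.mul_prod_erase Finset.univ _ (Finset.mem_univ i), mul_comm,
      map_mul]
    simp
  rw [rightOp_sum, Finset.sum_mul]
  have h4 : ∀ r, rightOp μ D (C ((wronskian γ A)⁻¹ j₀ r) *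
        ∑ i, C (A r i) * (linProd γ (Finset.univ.erase i)).map (algebraMap ℂ F)) * leftOp μ D p =
      aeval D (linProd γ Finset.univ) * leftOp μ D (C (∑ i, A r i) * dualSymbol γ A r) := by
    intro r
    rw [rightOp_C_mul, mul_assoc, h1, rightOp_sum, Finset.sum_mul, leftOp_C_mul, map_sum,
      Finset.sum_mul, Finset.mul_sum]
    refine Finset.sum_congr rfl fun i _ => ?_
    rw [rightOp_C_mul, rightOp_map, ← mul_assoc, mul_assoc _ (μ (A r i)), h2, ← mul_assoc, h3,
      mul_assoc]
  -- The common factor `∏ (D - γ i)` is now on the left, and the remaining sum of row sums times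
  -- dual operators is the identity.
  rw [Finset.sum_congr rfl fun r _ => h4 r, ← Finset.mul_sum, ← leftOp_sum,
    sum_wronskian_dualSymbol hW (by omega)]
  simp [leftOp]

end Symbols

/-! ### The derivation of `ℂ(x)` -/

theorem dx_div {p q : ℂ[X]} (hq : q ≠ 0) :
    dx (algebraMap ℂ[X] K p / algebraMap ℂ[X] K q) =
      algebraMap ℂ[X] K (derivative p * q - p * derivative q) / algebraMap ℂ[X] K q ^ 2 :=
  quotientRule_eq hq _ rfl

theorem dx_polyX (p : ℂ[X]) : dx (polyX p) = polyX (derivative p) := by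
  have h := dx_div (p := p) (q := 1) one_ne_zero
  simpa [polyX] using h

theorem dx_mul (r s : K) : dx (r * s) = r * dx s + s * dx r := by
  have hr : algebraMap ℂ[X] K r.denom ≠ 0 := RatFunc.algebraMap_ne_zero r.denom_ne_zero
  have hs : algebraMap ℂ[X] K s.denom ≠ 0 := RatFunc.algebraMap_ne_zero s.denom_ne_zero
  have h1 : r * s = algebraMap ℂ[X] K (r.num * s.num) / algebraMap ℂ[X] K (r.denom * s.denom) := by
    conv_lhs => rw [← r.num_div_denom, ← s.num_div_denom]
    simp only [map_mul]; field_simp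
  rw [h1, dx_div (mul_ne_zero r.denom_ne_zero s.denom_ne_zero)]
  conv_rhs => rw [← r.num_div_denom, ← s.num_div_denom]
  rw [dx_div r.denom_ne_zero, dx_div s.denom_ne_zero]
  simp only [derivative_mul, map_add, map_sub, map_mul]
  field_simp
  ring

/-- `d/dx` as a derivation. -/
def dxDer : Derivation ℂ K K where
  toFun := dx
  map_add' := map_add dx
  map_smul' c r := by
    rw [RatFunc.smul_eq_C_mul, dx_C_mul, RingHom.id_apply, RatFunc.smul_eq_C_mul]
  map_one_eq_zero' := by
    have h := dx_polyX 1
    simpa [polyX] using h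
  leibniz' r s := by
    rw [smul_eq_mul, smul_eq_mul]; exact dx_mul r s

theorem polyX_X : polyX X = RatFunc.X := RatFunc.algebraMap_X

theorem polyX_C (c : ℂ) : polyX (C c) = RatFunc.C c := RatFunc.algebraMap_C c

theorem dx_X : dx RatFunc.X = 1 := by
  rw [← polyX_X, dx_polyX, derivative_X, polyX, map_one]

/-- `x d/dx` as a derivation. -/
def eulerDer : Derivation ℂ K K := (RatFunc.X : K) • dxDer

theorem eulerDer_apply (r : K) : eulerDer r = RatFunc.X * dx r := rfl

theorem eulerDer_X_pow (j : ℕ) : eulerDer (RatFunc.X ^ j) = algebraMap ℂ K j * RatFunc.X ^ j := by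
  have h : (RatFunc.X : K) ^ j = polyX (X ^ j) := by rw [polyX, map_pow, RatFunc.algebraMap_X]
  rw [eulerDer_apply, h, dx_polyX, derivative_X_pow, ← polyX_X, RatFunc.algebraMap_eq_C, ← polyX_C]
  simp only [polyX, ← map_mul]
  congr 1
  rcases j with _ | j
  · simp
  · rw [Nat.add_sub_cancel, pow_succ]; push_cast; ring

theorem eulerDer_inv_X_pow (j : ℕ) :
    eulerDer (RatFunc.X ^ j)⁻¹ = -(algebraMap ℂ K j * (RatFunc.X ^ j)⁻¹) := by
  have hX : (RatFunc.X : K) ^ j ≠ 0 := pow_ne_zero _ RatFunc.X_ne_zero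
  rw [Derivation.leibniz_inv, eulerDer_X_pow, smul_eq_mul]
  field_simp

/-! ### Coefficients in `M` -/

namespace M

theorem ext {u v : M} (h : ∀ k, u.coeff k = v.coeff k) : u = v :=
  HahnSeries.ext (funext h)

theorem coeff_add (u v : M) (k : ℤ) : (u + v).coeff k = u.coeff k + v.coeff k := rfl

theorem coeff_zero (k : ℤ) : (0 : M).coeff k = 0 := rfl

/-- Taking a coefficient is additive. -/
def coeffHom (k : ℤ) : M →+ K where
  toFun u := u.coeff k
  map_zero' := coeff_zero k
  map_add' u v := coeff_add u v k

theorem coeff_sum {ι : Type*} (s : Finset ι) (f : ι → M) (k : ℤ) :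
    (∑ i ∈ s, f i).coeff k = ∑ i ∈ s, (f i).coeff k := map_sum (coeffHom k) f s

theorem coeff_cX_mul (r : K) (u : M) (k : ℤ) : (cX r * u).coeff k = r * u.coeff k := by
  have h : ∀ v : LaurentSeries K, ((HahnSeries.C r : LaurentSeries K) * v).coeff k =
      r * v.coeff k := fun v => by rw [HahnSeries.C_mul_eq_smul]; rfl
  exact h u

theorem coeff_one (k : ℤ) : (1 : M).coeff k = if k = 0 then 1 else 0 :=
  (HahnSeries.coeff_one (R := K) (a := k)).trans (by split_ifs <;> rfl)

theorem coeff_zM_mul (u : M) (k : ℤ) : (zM * u).coeff k = u.coeff (k + 1) := by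
  have h : ∀ v : LaurentSeries K, ((HahnSeries.single (-1 : ℤ) (1 : K) : LaurentSeries K) * v).coeff k
      = v.coeff (k + 1) := fun v => by
    rw [HahnSeries.coeff_single_mul, one_mul, sub_neg_eq_add]
  exact h u

theorem coeff_zM_pow_mul (j : ℕ) (u : M) (k : ℤ) : (zM ^ j * u).coeff k = u.coeff (k + j) := by
  induction j generalizing k with
  | zero => simp
  | succ j ih => rw [pow_succ', mul_assoc, coeff_zM_mul, ih]; push_cast; ring_nf

theorem coeff_coeffDx (u : M) (k : ℤ) : (coeffDx u).coeff k = dx (u.coeff k) := rfl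

theorem coeff_coeffDz (u : M) (k : ℤ) :
    (coeffDz u).coeff k = -(((k - 1 : ℤ) : K) * u.coeff (k - 1)) := by
  have h : ∀ v : LaurentSeries K, HahnSeries.coeff (-(HahnSeries.single 2 1 *
      LaurentSeries.derivative K v) : LaurentSeries K) k =
      -(((k - 1 : ℤ) : K) * v.coeff (k - 1)) := fun v => by
    rw [HahnSeries.coeff_neg, HahnSeries.coeff_single_mul, one_mul,
      LaurentSeries.derivative_apply, LaurentSeries.hasseDeriv_coeff]
    have : k - 2 + ((1 : ℕ) : ℤ) = k - 1 := by push_cast; ring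
    rw [this, Ring.choose_one_right, zsmul_eq_mul]
  exact h u

theorem algebraMap_eq (c : ℂ) : algebraMap ℂ M c = cX (RatFunc.C c) := rfl

theorem coeff_smul (c : ℂ) (u : M) (k : ℤ) : (c • u).coeff k = RatFunc.C c * u.coeff k := by
  rw [Algebra.smul_def, algebraMap_eq, coeff_cX_mul]

theorem exists_leading {u : M} (hu : u ≠ 0) :
    ∃ k, u.coeff k ≠ 0 ∧ ∀ j < k, u.coeff j = 0 :=
  ⟨HahnSeries.order (u : LaurentSeries K),
    fun h => hu ((HahnSeries.coeff_order_eq_zero (x := (u : LaurentSeries K))).1 h),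
    fun _ hj => HahnSeries.coeff_eq_zero_of_lt_order hj⟩

end M

theorem zM_ne_zero : zM ≠ 0 := by
  intro h
  have h1 := M.coeff_zM_mul 1 (-1)
  rw [h, zero_mul, M.coeff_zero, M.coeff_one] at h1
  simp at h1

/-! ### Rational functions of `z` -/

/-- Polynomials in `z` as a homomorphism. -/
def polyZHom : ℂ[X] →ₐ[ℂ] M := aeval zM

theorem polyZHom_apply (p : ℂ[X]) : polyZHom p = polyZ p := rfl

theorem polyZ_mul (p q : ℂ[X]) : polyZ (p * q) = polyZ p * polyZ q := map_mul polyZHom p q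

theorem polyZ_add (p q : ℂ[X]) : polyZ (p + q) = polyZ p + polyZ q := map_add polyZHom p q

theorem polyZ_X : polyZ X = zM := aeval_X _

theorem polyZ_X_pow (j : ℕ) : polyZ (X ^ j) = zM ^ j := by
  rw [polyZ, map_pow, aeval_X]

theorem coeff_polyZ_mul {p : ℂ[X]} {B : ℕ} (hB : p.natDegree < B) (u : M) (k : ℤ) :
    (polyZ p * u).coeff k = ∑ j ∈ Finset.range B, RatFunc.C (p.coeff j) * u.coeff (k + j) := by
  rw [polyZ, aeval_eq_sum_range' hB, Finset.sum_mul, M.coeff_sum]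
  refine Finset.sum_congr rfl fun j _ => ?_
  rw [smul_mul_assoc, M.coeff_smul, M.coeff_zM_pow_mul]

theorem polyZ_ne_zero {p : ℂ[X]} (hp : p ≠ 0) : polyZ p ≠ 0 := by
  intro h
  have h1 := coeff_polyZ_mul (Nat.lt_succ_self p.natDegree) 1 (-p.natDegree)
  rw [h, zero_mul, M.coeff_zero, Finset.sum_range_succ, Finset.sum_eq_zero, zero_add, M.coeff_one,
    if_pos (by ring), mul_one, eq_comm, map_eq_zero] at h1
  · exact hp (leadingCoeff_eq_zero.1 h1)
  · intro j hj
    have := Finset.mem_range.1 hj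
    rw [M.coeff_one, if_neg (by omega), mul_zero]

theorem eval₂_eq_polyZ (p : ℂ[X]) : p.eval₂ (cX.comp RatFunc.C) zM = polyZ p := rfl

/-- Expansion of rational functions at infinity, as a homomorphism. -/
def ratZHom : K →ₐ[ℂ] M where
  toFun := ratZ
  map_one' := RatFunc.eval_one _ _
  map_zero' := RatFunc.eval_zero _ _
  map_add' r s := RatFunc.eval_add _ _ (by rw [eval₂_eq_polyZ]; exact polyZ_ne_zero r.denom_ne_zero)
    (by rw [eval₂_eq_polyZ]; exact polyZ_ne_zero s.denom_ne_zero)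
  map_mul' r s := RatFunc.eval_mul _ _ (by rw [eval₂_eq_polyZ]; exact polyZ_ne_zero r.denom_ne_zero)
    (by rw [eval₂_eq_polyZ]; exact polyZ_ne_zero s.denom_ne_zero)
  commutes' c := by
    rw [RatFunc.algebraMap_eq_C]; exact RatFunc.eval_C _ _

theorem ratZHom_apply (r : K) : ratZHom r = ratZ r := rfl

theorem ratZ_polyX (p : ℂ[X]) : ratZ (polyX p) = polyZ p := by
  rw [ratZ, polyX, RatFunc.eval_algebraMap]; rfl

theorem ratZ_mul (r s : K) : ratZ (r * s) = ratZ r * ratZ s := map_mul ratZHom r s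

theorem ratZ_inv (r : K) : ratZ r⁻¹ = (ratZ r)⁻¹ := map_inv₀ ratZHom r

theorem ratZ_X : ratZ RatFunc.X = zM := by rw [← polyX_X, ratZ_polyX, polyZ_X]

/-- An additive property of multiplication by `ratZ r` that holds for constants and `z` and is
compatible with products and inverses holds for all `r`. -/
theorem ratZ_induction {p : M → Prop} (hC : ∀ c : ℂ, p (algebraMap ℂ M c)) (hz : p zM)
    (hadd : ∀ a b, p a → p b → p (a + b)) (hmul : ∀ a b, p a → p b → p (a * b))
    (hinv : ∀ a, a ≠ 0 → p a → p a⁻¹) (r : K) : p (ratZ r) := by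
  have hpoly : ∀ q : ℂ[X], p (polyZ q) := by
    intro q
    induction q using Polynomial.induction_on with
    | C a => rw [polyZ, aeval_C]; exact hC a
    | add f g hf hg => rw [polyZ_add]; exact hadd _ _ hf hg
    | monomial n a ih =>
      rw [pow_succ, ← mul_assoc, polyZ_mul, polyZ_X]; exact hmul _ _ ih hz
  have h : ratZ r = polyZ r.num * (polyZ r.denom)⁻¹ := by
    conv_lhs => rw [← r.num_div_denom, div_eq_mul_inv, ratZ_mul, ratZ_inv]
    rw [← ratZ_polyX, ← ratZ_polyX]; rfl
  rw [h]
  exact hmul _ _ (hpoly _) (hinv _ (polyZ_ne_zero r.denom_ne_zero) (hpoly _))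

/-! ### The two connections -/

theorem nablaX_apply (u : M) : nablaX u = coeffDx u + zM * u := rfl

theorem coeffDx_zM_mul (u : M) : coeffDx (zM * u) = zM * coeffDx u :=
  M.ext fun k => by
    rw [M.coeff_coeffDx, M.coeff_zM_mul, M.coeff_zM_mul, M.coeff_coeffDx]

theorem coeffDx_cX_mul (r : K) (u : M) :
    coeffDx (cX r * u) = cX r * coeffDx u + cX (dx r) * u :=
  M.ext fun k => by
    simp only [M.coeff_add, M.coeff_coeffDx, M.coeff_cX_mul, dx_mul]
    ring

theorem nablaX_cX_mul (r : K) (u : M) : nablaX (cX r * u) = cX r * nablaX u + cX (dx r) * u := by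
  rw [nablaX_apply, nablaX_apply, coeffDx_cX_mul]; ring

theorem coeffDx_ratZ_mul (r : K) : ∀ u : M, coeffDx (ratZ r * u) = ratZ r * coeffDx u := by
  refine ratZ_induction (p := fun a => ∀ u, coeffDx (a * u) = a * coeffDx u) ?_ coeffDx_zM_mul
    ?_ ?_ ?_ r
  · intro c u; rw [← Algebra.smul_def, coeffDx_smul, Algebra.smul_def]
  · intro a b ha hb u; rw [add_mul, map_add, ha, hb, add_mul]
  · intro a b ha hb u; rw [mul_assoc, ha, hb, mul_assoc]
  · intro a ha h u
    apply mul_left_cancel₀ ha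
    rw [← h, mul_inv_cancel_left₀ ha, mul_inv_cancel_left₀ ha]

theorem nablaX_ratZ_mul (r : K) (u : M) : nablaX (ratZ r * u) = ratZ r * nablaX u := by
  rw [nablaX_apply, nablaX_apply, coeffDx_ratZ_mul]; ring

theorem coeffDz_add (u v : M) : coeffDz (u + v) = coeffDz u + coeffDz v :=
  M.ext fun k => by simp only [M.coeff_add, M.coeff_coeffDz]; ring

theorem coeffDz_cX_mul (r : K) (u : M) : coeffDz (cX r * u) = cX r * coeffDz u :=
  M.ext fun k => by simp only [M.coeff_cX_mul, M.coeff_coeffDz]; ring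

theorem coeffDz_zM_mul (u : M) : coeffDz (zM * u) = zM * coeffDz u + u :=
  M.ext fun k => by
    simp only [M.coeff_add, M.coeff_zM_mul, M.coeff_coeffDz, sub_add_cancel, add_sub_cancel_right]
    push_cast; ring

/-- `nablaZ` as a linear map. -/
def nablaZEnd : Module.End ℂ M where
  toFun := nablaZ
  map_add' u v := by rw [nablaZ, nablaZ, nablaZ, coeffDz_add]; ring
  map_smul' c u := by
    rw [Algebra.smul_def, M.algebraMap_eq, nablaZ, coeffDz_cX_mul, RingHom.id_apply,
      Algebra.smul_def, M.algebraMap_eq, nablaZ]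
    ring

/-- The Leibniz rule is proved for polynomials by induction; for `r` it follows from `denom * r =
num` after cancelling the denominator. -/
theorem coeffDz_ratZ_mul (r : K) (u : M) :
    coeffDz (ratZ r * u) = ratZ r * coeffDz u + ratZ (dx r) * u := by
  have hp : ∀ (p : ℂ[X]) (u : M),
      coeffDz (polyZ p * u) = polyZ p * coeffDz u + polyZ (derivative p) * u := by
    intro p
    induction p using Polynomial.induction_on with
    | C a =>
      intro u
      rw [polyZ, aeval_C, M.algebraMap_eq, coeffDz_cX_mul, derivative_C, polyZ, map_zero]; ring
    | add f g hf hg =>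
      intro u
      rw [polyZ_add, add_mul, coeffDz_add, hf, hg, derivative_add, polyZ_add]; ring
    | monomial n a ih =>
      intro u
      rw [pow_succ, ← mul_assoc, polyZ_mul, mul_assoc, ih, polyZ_X, coeffDz_zM_mul,
        derivative_mul (f := C a * X ^ n) (g := X), derivative_X, mul_one, polyZ_add,
        polyZ_mul _ X, polyZ_X]
      ring
  have hd := polyZ_ne_zero r.denom_ne_zero
  have h1 : polyZ r.num = polyZ r.denom * ratZ r := by
    rw [← ratZ_polyX, ← ratZ_polyX, ← ratZ_mul]
    congr 1
    rw [mul_comm, polyX, polyX, ← div_eq_iff (RatFunc.algebraMap_ne_zero r.denom_ne_zero)]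
    exact r.num_div_denom
  have h2 : polyZ (derivative r.num) = polyZ (derivative r.denom) * ratZ r +
      polyZ r.denom * ratZ (dx r) := by
    rw [← ratZ_polyX, ← ratZ_polyX, ← ratZ_polyX, ← ratZ_mul, ← ratZ_mul]
    refine Eq.trans ?_ (map_add ratZHom _ _)
    rw [ratZHom_apply]
    congr 1
    rw [← dx_polyX, ← dx_polyX, mul_comm (dx _), add_comm, ← dx_mul]
    congr 1
    rw [mul_comm, polyX, polyX, ← div_eq_iff (RatFunc.algebraMap_ne_zero r.denom_ne_zero)]
    exact r.num_div_denom
  apply mul_left_cancel₀ hd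
  have e1 := hp r.denom (ratZ r * u)
  have e2 := hp r.num u
  rw [← mul_assoc, ← h1, e2, h2, h1] at e1
  linear_combination -e1

theorem nablaZ_ratZ_mul (r : K) (u : M) :
    nablaZ (ratZ r * u) = ratZ r * nablaZ u + ratZ (dx r) * u := by
  rw [nablaZ, nablaZ, coeffDz_ratZ_mul]; ring

theorem nablaZ_cX_mul (r : K) (u : M) : nablaZ (cX r * u) = cX r * nablaZ u := by
  rw [nablaZ, nablaZ, coeffDz_cX_mul]; ring

theorem coeffDx_coeffDz (u : M) : coeffDx (coeffDz u) = coeffDz (coeffDx u) :=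
  M.ext fun k => by
    simp only [M.coeff_coeffDx, M.coeff_coeffDz]
    rw [← neg_mul, ← Int.cast_neg, ← zsmul_eq_mul, map_zsmul, zsmul_eq_mul]
    push_cast; ring

/-- Both are ordinary partial derivatives conjugated by `e^{xz}`. In the commutator the derivative
of `x` in `x` cancels that of `z` in `z`. -/
theorem nablaX_nablaZ (u : M) : nablaX (nablaZ u) = nablaZ (nablaX u) := by
  rw [nablaX_apply, nablaX_apply, nablaZ, nablaZ, map_add, coeffDx_coeffDz, coeffDx_cX_mul,
    coeffDz_add, coeffDz_zM_mul, dx_X, map_one]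
  ring

/-! ### Normal forms of differential operators -/

/-- Multiplication by rational functions of `x`, as a homomorphism. -/
def mulXHom : K →ₐ[ℂ] DiffOp where
  toFun := mulX
  map_one' := by
    apply Subtype.ext; ext1 u
    change cX 1 * u = u
    rw [map_one, one_mul]
  map_zero' := by
    apply Subtype.ext; ext1 u
    change cX 0 * u = 0
    rw [map_zero, zero_mul]
  map_add' r s := by
    apply Subtype.ext; ext1 u
    change cX (r + s) * u = cX r * u + cX s * u
    rw [map_add, add_mul]
  map_mul' r s := by
    apply Subtype.ext; ext1 u
    change cX (r * s) * u = cX r * (cX s * u)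
    rw [map_mul, mul_assoc]
  commutes' c := by
    apply Subtype.ext; ext1 u
    change cX (algebraMap ℂ K c) * u = c • u
    rw [Algebra.smul_def, M.algebraMap_eq, RatFunc.algebraMap_eq_C]

theorem mulXHom_apply (r : K) : mulXHom r = mulX r := rfl

theorem ddx_mul_mulX (r : K) : ddx * mulXHom r = mulXHom r * ddx + mulXHom (dxDer r) := by
  apply Subtype.ext; ext1 u
  exact nablaX_cX_mul r u

theorem euler_mul_mulX (r : K) : euler * mulXHom r = mulXHom r * euler + mulXHom (eulerDer r) := by
  have h : euler = mulXHom RatFunc.X * ddx := rfl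
  rw [h, mul_assoc, ddx_mul_mulX, mul_add, ← mul_assoc, ← mul_assoc, ← map_mul, ← map_mul,
    ← map_mul, mul_comm RatFunc.X r]
  rfl

/-- Normal forms are stable under left multiplication by the generators. The induction therefore
concerns products with all normal forms, and is finally applied to the normal form `1`. -/
theorem DiffOp.exists_leftOp (P : DiffOp) : ∃ q : K[X], P = leftOp mulXHom ddx q := by
  have key : ∀ a (ha : a ∈ Algebra.adjoin ℂ
      (insert nablaX (Set.range fun r : K => LinearMap.mulLeft ℂ (cX r)))), ∀ q : K[X],
      ∃ q' : K[X], (⟨a, ha⟩ : DiffOp) * leftOp mulXHom ddx q = leftOp mulXHom ddx q' := by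
    intro a ha
    induction ha using Algebra.adjoin_induction with
    | mem a ha =>
      intro q
      rcases ha with rfl | ⟨r, rfl⟩
      · exact ⟨_, mul_leftOp ddx_mul_mulX q⟩
      · exact ⟨_, (leftOp_C_mul mulXHom ddx r q).symm⟩
    | algebraMap c =>
      intro q
      refine ⟨C (algebraMap ℂ K c) * q, ?_⟩
      rw [leftOp_C_mul, AlgHom.commutes]; rfl
    | add a b ha hb iha ihb =>
      intro q
      obtain ⟨p, hp⟩ := iha q
      obtain ⟨p', hp'⟩ := ihb q
      refine ⟨p + p', ?_⟩
      rw [leftOp_add, ← hp, ← hp', ← add_mul]; rfl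
    | mul a b ha hb iha ihb =>
      intro q
      obtain ⟨p, hp⟩ := ihb q
      obtain ⟨p', hp'⟩ := iha p
      refine ⟨p', ?_⟩
      rw [← hp', ← hp, ← mul_assoc]; rfl
  obtain ⟨q, hq⟩ := key P.1 P.2 1
  exact ⟨q, by rw [← hq]; simp [leftOp]⟩

/-- The action of `DiffOp` on `M`. -/
def appHom : DiffOp →ₐ[ℂ] Module.End ℂ M := Subalgebra.val _

theorem appHom_apply (P : DiffOp) (u : M) : appHom P u = P.app u := rfl

theorem DiffOp.app_mul (P Q : DiffOp) (u : M) : (P * Q).app u = P.app (Q.app u) := rfl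

theorem DiffOp.app_sub (P Q : DiffOp) (u : M) : (P - Q).app u = P.app u - Q.app u := rfl

theorem DiffOp.app_smul (c : ℂ) (P : DiffOp) (u : M) : (c • P).app u = c • P.app u := rfl

theorem DiffOp.app_sum {ι : Type*} (s : Finset ι) (f : ι → DiffOp) (u : M) :
    (∑ i ∈ s, f i).app u = ∑ i ∈ s, (f i).app u := by
  rw [← appHom_apply, map_sum, LinearMap.sum_apply]; rfl

theorem mulX_app (r : K) (u : M) : (mulX r).app u = cX r * u := rfl

theorem leftOp_app (q : K[X]) {B : ℕ} (hB : q.natDegree < B) (u : M) :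
    (leftOp mulXHom ddx q).app u = ∑ j ∈ Finset.range B, cX (q.coeff j) * (nablaX ^ j) u := by
  rw [leftOp_eq_sum_of_lt _ _ hB, DiffOp.app_sum]
  refine Finset.sum_congr rfl fun j _ => ?_
  rw [DiffOp.app_mul, mulXHom_apply, mulX_app, ← appHom_apply, map_pow]
  rfl

theorem nablaX_pow_succ (r : ℕ) (u : M) : (nablaX ^ (r + 1)) u = nablaX ((nablaX ^ r) u) := by
  rw [pow_succ']; rfl

/-- The index `k` stands for `z ^ (-k)`, so the lowest index is the highest power of `z`. The term
`zM * u` raises that power by one, `coeffDx` does not. -/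
theorem nablaX_pow_coeff {u : M} {k : ℤ} (hk : ∀ j < k, u.coeff j = 0) (r : ℕ) :
    ((nablaX ^ r) u).coeff (k - r) = u.coeff k ∧ ∀ j < k - r, ((nablaX ^ r) u).coeff j = 0 := by
  induction r with
  | zero => simpa using hk
  | succ r ih =>
    rw [nablaX_pow_succ, nablaX_apply]
    constructor
    · rw [M.coeff_add, M.coeff_coeffDx, M.coeff_zM_mul, ih.2 _ (by push_cast; omega), map_zero,
        zero_add]
      have : k - ((r + 1 : ℕ) : ℤ) + 1 = k - r := by push_cast; ring
      rw [this, ih.1]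
    · intro j hj
      push_cast at hj
      rw [M.coeff_add, M.coeff_coeffDx, M.coeff_zM_mul, ih.2 _ (by omega), ih.2 _ (by omega),
        map_zero, zero_add]

theorem leftOp_app_coeff (q : K[X]) {u : M} {k : ℤ} (hk : ∀ j < k, u.coeff j = 0) :
    ((leftOp mulXHom ddx q).app u).coeff (k - q.natDegree) = q.leadingCoeff * u.coeff k ∧
      ∀ j < k - q.natDegree, ((leftOp mulXHom ddx q).app u).coeff j = 0 := by
  rw [leftOp_app q (Nat.lt_succ_self _)]
  constructor
  · rw [M.coeff_sum, Finset.sum_range_succ, Finset.sum_eq_zero, zero_add, M.coeff_cX_mul,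
      (nablaX_pow_coeff hk _).1]
    · rfl
    · intro j hj
      rw [M.coeff_cX_mul, (nablaX_pow_coeff hk _).2, mul_zero]
      have := Finset.mem_range.1 hj
      omega
  · intro j hj
    rw [M.coeff_sum]
    refine Finset.sum_eq_zero fun i hi => ?_
    rw [M.coeff_cX_mul, (nablaX_pow_coeff hk _).2, mul_zero]
    have := Finset.mem_range.1 hi
    omega

theorem leftOp_app_ne_zero {q : K[X]} (hq : q ≠ 0) {u : M} (hu : u ≠ 0) :
    (leftOp mulXHom ddx q).app u ≠ 0 := by
  obtain ⟨k, hk, hlt⟩ := M.exists_leading hu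
  intro h
  have h1 := (leftOp_app_coeff q hlt).1
  rw [h, M.coeff_zero] at h1
  exact mul_ne_zero (leadingCoeff_ne_zero.2 hq) hk h1.symm

/-- The highest power of `z` in `P u` has as coefficient the product of the leading coefficients of
`P` and of `u`. Testing on a single nonzero series thus determines an operator. -/
theorem DiffOp.eq_zero_of_app_eq_zero {P : DiffOp} {u : M} (hu : u ≠ 0) (h : P.app u = 0) :
    P = 0 := by
  obtain ⟨q, rfl⟩ := P.exists_leftOp
  by_contra hP
  refine leftOp_app_ne_zero (fun hq => hP ?_) hu h
  rw [hq]; simp [leftOp]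

theorem DiffOp.app_injective {P : DiffOp} (hP : P ≠ 0) {u v : M} (h : P.app u = P.app v) :
    u = v := by
  by_contra huv
  refine hP (DiffOp.eq_zero_of_app_eq_zero (sub_ne_zero.2 huv) ?_)
  rw [← appHom_apply, map_sub, appHom_apply, appHom_apply, h, sub_self]

theorem M.coeff_zM_pow (i : ℕ) (k : ℤ) : (zM ^ i).coeff k = if k + i = 0 then 1 else 0 := by
  have h := M.coeff_zM_pow_mul i 1 k
  rwa [mul_one, M.coeff_one] at h

theorem coeffDx_zM_pow (i : ℕ) : coeffDx (zM ^ i) = 0 := M.ext fun k => by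
  rw [M.coeff_coeffDx, M.coeff_zero, M.coeff_zM_pow]
  split_ifs
  · exact dxDer.map_one_eq_zero
  · exact map_zero dx

theorem nablaX_pow_one (i : ℕ) : (nablaX ^ i) (1 : M) = zM ^ i := by
  induction i with
  | zero => rfl
  | succ i ih => rw [nablaX_pow_succ, ih, nablaX_apply, coeffDx_zM_pow, zero_add, pow_succ']

theorem DiffOp.coeff_leftOp (q : K[X]) (j : ℕ) : (leftOp mulXHom ddx q).coeff j = q.coeff j := by
  rw [DiffOp.coeff, leftOp_app q (Nat.lt_succ_self _) 1, M.coeff_sum]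
  have h2 : ∀ i ∈ Finset.range q.natDegree.succ,
      (cX (q.coeff i) * (nablaX ^ i) 1).coeff (-(j : ℤ)) = if j = i then q.coeff i else 0 := by
    intro i _
    rw [M.coeff_cX_mul, nablaX_pow_one, M.coeff_zM_pow]
    by_cases hij : j = i
    · rw [if_pos (by omega), if_pos hij, mul_one]
    · rw [if_neg (by omega), if_neg hij, mul_zero]
  rw [Finset.sum_congr rfl h2, Finset.sum_ite_eq]
  split_ifs with h
  · rfl
  · rw [coeff_eq_zero_of_natDegree_lt]
    simpa [Nat.lt_succ_iff] using h

/-! ### The action of differential operators in `z` -/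

section SymbolProduct

variable {F E : Type*} [Field F] [Algebra ℂ F] [Ring E] [Algebra ℂ E]

/-- The symbol of the product of two operators in normal form. -/
def symbolMul (δ : Derivation ℂ F F) (p q : F[X]) : F[X] :=
  p.sum fun j c => C c * (fun q => X * q + coeffDer δ q)^[j] q

theorem pow_mul_leftOp {μ : F →ₐ[ℂ] E} {D : E} {δ : Derivation ℂ F F}
    (hD : ∀ h, D * μ h = μ h * D + μ (δ h)) (q : F[X]) (j : ℕ) :
    D ^ j * leftOp μ D q = leftOp μ D ((fun q => X * q + coeffDer δ q)^[j] q) := by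
  induction j with
  | zero => simp
  | succ j ih => rw [pow_succ', mul_assoc, ih, mul_leftOp hD, Function.iterate_succ_apply']

theorem leftOp_mul_leftOp {μ : F →ₐ[ℂ] E} {D : E} {δ : Derivation ℂ F F}
    (hD : ∀ h, D * μ h = μ h * D + μ (δ h)) (p q : F[X]) :
    leftOp μ D p * leftOp μ D q = leftOp μ D (symbolMul δ p q) := by
  rw [symbolMul, Polynomial.sum_def, leftOp_sum]
  conv_lhs => rw [leftOp, eval₂_eq_sum, Polynomial.sum_def, Finset.sum_mul]
  refine Finset.sum_congr rfl fun j _ => ?_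
  rw [mul_assoc, pow_mul_leftOp hD, leftOp_C_mul]
  rfl

end SymbolProduct

/-- Multiplication by rational functions of `z`, as a homomorphism. -/
def mulZHom : K →ₐ[ℂ] Module.End ℂ M := (Algebra.lmul ℂ M).comp ratZHom

theorem mulZHom_apply (r : K) (u : M) : mulZHom r u = ratZ r * u := rfl

theorem nablaZ_mul_mulZ (r : K) :
    nablaZEnd * mulZHom r = mulZHom r * nablaZEnd + mulZHom (dxDer r) := by
  ext1 u
  exact nablaZ_ratZ_mul r u

theorem nablaZ_iterate (j : ℕ) (u : M) : nablaZ^[j] u = (nablaZEnd ^ j) u := by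
  rw [Module.End.pow_apply]; rfl

theorem appZ_leftOp (q : K[X]) (u : M) :
    (leftOp mulXHom ddx q).appZ u = leftOp mulZHom nablaZEnd q u := by
  rw [leftOp_eq_sum_of_lt mulZHom _ (Nat.lt_succ_self _), LinearMap.sum_apply, DiffOp.appZ]
  rw [finsum_eq_sum_of_support_subset (s := Finset.range q.natDegree.succ)]
  · refine Finset.sum_congr rfl fun j _ => ?_
    rw [DiffOp.coeff_leftOp, nablaZ_iterate]; rfl
  · intro j hj
    rw [Function.mem_support] at hj
    by_contra h
    apply hj
    rw [DiffOp.coeff_leftOp, coeff_eq_zero_of_natDegree_lt (by simpa [Nat.lt_succ_iff] using h)]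
    rw [← ratZHom_apply, map_zero, zero_mul]

theorem DiffOp.appZ_map_add (P : DiffOp) (u v : M) : P.appZ (u + v) = P.appZ u + P.appZ v := by
  obtain ⟨q, rfl⟩ := P.exists_leftOp
  simp only [appZ_leftOp, map_add]

theorem DiffOp.appZ_map_smul (c : ℂ) (P : DiffOp) (u : M) : P.appZ (c • u) = c • P.appZ u := by
  obtain ⟨q, rfl⟩ := P.exists_leftOp
  simp only [appZ_leftOp, map_smul]

theorem DiffOp.appZ_add (P Q : DiffOp) (u : M) : (P + Q).appZ u = P.appZ u + Q.appZ u := by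
  obtain ⟨p, rfl⟩ := P.exists_leftOp
  obtain ⟨q, rfl⟩ := Q.exists_leftOp
  rw [← leftOp_add, appZ_leftOp, appZ_leftOp, appZ_leftOp, leftOp_add, LinearMap.add_apply]

/-- The normal form of a product, `symbolMul`, is computed from the relation between the derivative
and the coefficients alone, and `nablaZ` with `ratZ` satisfies the same relation as `ddx` with
`mulX`. -/
theorem DiffOp.appZ_mul (P Q : DiffOp) (u : M) : (P * Q).appZ u = P.appZ (Q.appZ u) := by
  obtain ⟨p, rfl⟩ := P.exists_leftOp
  obtain ⟨q, rfl⟩ := Q.exists_leftOp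
  rw [leftOp_mul_leftOp ddx_mul_mulX, appZ_leftOp, appZ_leftOp, appZ_leftOp,
    ← leftOp_mul_leftOp nablaZ_mul_mulZ, Module.End.mul_apply]

theorem mulX_appZ (r : K) (u : M) : (mulX r).appZ u = ratZ r * u := by
  have h : mulX r = leftOp mulXHom ddx (C r) := by
    rw [leftOp, eval₂_C]; rfl
  rw [h, appZ_leftOp, leftOp, eval₂_C]
  rfl

theorem ddx_appZ (u : M) : ddx.appZ u = nablaZ u := by
  have h : ddx = leftOp mulXHom ddx X := by rw [leftOp, eval₂_X]
  rw [h, appZ_leftOp, leftOp, eval₂_X]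
  rfl

/-- The action of `DiffOp` on `M` in the variable `z`. -/
def appZHom : DiffOp →+* Module.End ℂ M where
  toFun P :=
    { toFun := P.appZ
      map_add' := P.appZ_map_add
      map_smul' := fun c u => P.appZ_map_smul c u }
  map_one' := by
    ext1 u
    have h : (1 : DiffOp) = mulX 1 := (map_one mulXHom).symm
    change (1 : DiffOp).appZ u = u
    rw [h, mulX_appZ, ← ratZHom_apply, map_one, one_mul]
  map_zero' := by
    ext1 u
    have h : (0 : DiffOp) = mulX 0 := (map_zero mulXHom).symm
    change (0 : DiffOp).appZ u = 0
    rw [h, mulX_appZ, ← ratZHom_apply, map_zero, zero_mul]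
  map_add' P Q := by ext1 u; exact P.appZ_add Q u
  map_mul' P Q := by ext1 u; exact P.appZ_mul Q u

theorem appZHom_apply (P : DiffOp) (u : M) : appZHom P u = P.appZ u := rfl

theorem appZHom_algebraMap (c : ℂ) : appZHom (algebraMap ℂ DiffOp c) = algebraMap ℂ _ c := by
  ext1 u
  rw [← mulXHom.commutes, appZHom_apply, mulXHom_apply, mulX_appZ, ← ratZHom_apply,
    AlgHom.commutes, Module.algebraMap_end_apply, Algebra.smul_def]

/-- The action in the variable `z` as an algebra homomorphism. -/
def appZAlgHom : DiffOp →ₐ[ℂ] Module.End ℂ M := { appZHom with commutes' := appZHom_algebraMap }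

theorem appZAlgHom_apply (P : DiffOp) (u : M) : appZAlgHom P u = P.appZ u := rfl

theorem DiffOp.commute_of_generators {a : Module.End ℂ M} (h1 : Commute nablaX a)
    (h2 : ∀ r, Commute (LinearMap.mulLeft ℂ (cX r)) a) (P : DiffOp) : Commute (appHom P) a := by
  have h : Algebra.adjoin ℂ (insert nablaX (Set.range fun r : K => LinearMap.mulLeft ℂ (cX r))) ≤
      Subalgebra.centralizer ℂ {a} := by
    refine Algebra.adjoin_le ?_
    rintro b (rfl | ⟨r, rfl⟩)
    · exact (Subalgebra.mem_centralizer_iff ℂ).2 fun _ hg => hg ▸ h1.eq.symm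
    · exact (Subalgebra.mem_centralizer_iff ℂ).2 fun _ hg => hg ▸ (h2 r).eq.symm
  exact ((Subalgebra.mem_centralizer_iff ℂ).1 (h P.2) a rfl).symm

theorem DiffOp.commute_mulZ (P : DiffOp) (r : K) : Commute (appHom P) (mulZHom r) := by
  refine P.commute_of_generators ?_ fun s => ?_
  · ext1 u; exact nablaX_ratZ_mul r u
  · ext1 u; exact mul_left_comm _ _ _

theorem DiffOp.commute_nablaZ (P : DiffOp) : Commute (appHom P) nablaZEnd := by
  refine P.commute_of_generators ?_ fun s => ?_
  · ext1 u; exact nablaX_nablaZ u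
  · ext1 u; exact (nablaZ_cX_mul s u).symm

theorem DiffOp.app_ratZ_mul (P : DiffOp) (r : K) (u : M) :
    P.app (ratZ r * u) = ratZ r * P.app u := LinearMap.congr_fun (P.commute_mulZ r).eq u

theorem DiffOp.app_polyZ_mul (P : DiffOp) (p : ℂ[X]) (u : M) :
    P.app (polyZ p * u) = polyZ p * P.app u := by
  rw [← ratZ_polyX, P.app_ratZ_mul]

/-- Operators in `x` commute with operators in `z`. -/
theorem DiffOp.app_appZ (P Q : DiffOp) (u : M) : P.app (Q.appZ u) = Q.appZ (P.app u) := by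
  obtain ⟨q, rfl⟩ := Q.exists_leftOp
  rw [appZ_leftOp, appZ_leftOp]
  have h : Commute (appHom P) (leftOp mulZHom nablaZEnd q) := by
    rw [leftOp_eq_sum_of_lt _ _ (Nat.lt_succ_self _)]
    exact Commute.sum_right _ _ _ fun j _ =>
      (P.commute_mulZ _).mul_right (P.commute_nablaZ.pow_right _)
  exact LinearMap.congr_fun h.eq u

theorem DiffOp.appZ_cX_mul (Q : DiffOp) (r : K) (u : M) :
    Q.appZ (cX r * u) = cX r * Q.appZ u := by
  rw [← mulX_app, ← DiffOp.app_appZ, mulX_app]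

theorem nablaZ_pow_coeff {u : M} {k : ℤ} (hk : ∀ j < k, u.coeff j = 0) (r : ℕ) :
    ((nablaZEnd ^ r) u).coeff k = RatFunc.X ^ r * u.coeff k ∧
      ∀ j < k, ((nablaZEnd ^ r) u).coeff j = 0 := by
  induction r with
  | zero => simpa using hk
  | succ r ih =>
    have h1 : (nablaZEnd ^ (r + 1)) u = nablaZ ((nablaZEnd ^ r) u) := by
      rw [pow_succ']; rfl
    have h2 : ∀ j ≤ k, ((nablaZEnd ^ (r + 1)) u).coeff j =
        RatFunc.X * ((nablaZEnd ^ r) u).coeff j := by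
      intro j hj
      rw [h1, nablaZ, M.coeff_add, M.coeff_coeffDz, M.coeff_cX_mul, ih.2 _ (by omega), mul_zero,
        neg_zero, zero_add]
    constructor
    · rw [h2 k le_rfl, ih.1, pow_succ', mul_assoc]
    · intro j hj
      rw [h2 j hj.le, ih.2 j hj, mul_zero]

theorem exists_common_denominator {ι : Type*} (s : Finset ι) (f : ι → K) :
    ∃ b : ℂ[X], b ≠ 0 ∧ ∃ p : ι → ℂ[X], ∀ i ∈ s, polyX b * f i = polyX (p i) := by
  obtain ⟨b, hb⟩ := IsLocalization.exist_integer_multiples (nonZeroDivisors ℂ[X]) s f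
  choose! p hp using hb
  refine ⟨b, nonZeroDivisors.ne_zero b.2, p, fun i hi => ?_⟩
  have h := hp i hi
  rw [Algebra.smul_def] at h
  exact h.symm

/-- On the highest power of `z` in `u`, `nablaZ` acts as multiplication by `x`. If `e` is the
largest degree of the `p j`, the top coefficient of the sum is `∑ j, (p j).coeff e * x ^ j` times
that of `u`, and the powers of `x` are independent over `ℂ`. -/
theorem leftOp_nablaZ_ne_zero {B : ℕ} {p : ℕ → ℂ[X]} (hp : ∃ j ∈ Finset.range B, p j ≠ 0)
    {u : M} (hu : u ≠ 0) : ∑ j ∈ Finset.range B, polyZ (p j) * (nablaZEnd ^ j) u ≠ 0 := by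
  obtain ⟨k, hk, hlt⟩ := M.exists_leading hu
  set e := (Finset.range B).sup fun j => (p j).natDegree with he
  have hle : ∀ j ∈ Finset.range B, (p j).natDegree ≤ e := fun j hj =>
    Finset.le_sup (f := fun j => (p j).natDegree) hj
  intro h
  have h1 : ∀ j ∈ Finset.range B, (polyZ (p j) * (nablaZEnd ^ j) u).coeff (k - e) =
      polyX (C ((p j).coeff e) * X ^ j) * u.coeff k := by
    intro j hj
    rw [coeff_polyZ_mul (Nat.lt_succ_of_le (hle j hj)), Finset.sum_range_succ,
      Finset.sum_eq_zero, zero_add, sub_add_cancel, (nablaZ_pow_coeff hlt j).1, ← mul_assoc]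
    · congr 1
      rw [polyX, map_mul, map_pow, RatFunc.algebraMap_C, RatFunc.algebraMap_X]
    · intro i hi
      have := Finset.mem_range.1 hi
      rw [(nablaZ_pow_coeff hlt j).2 _ (by omega), mul_zero]
  have h2 : (∑ j ∈ Finset.range B, polyZ (p j) * (nablaZEnd ^ j) u).coeff (k - e) = 0 := by
    rw [h, M.coeff_zero]
  rw [M.coeff_sum, Finset.sum_congr rfl h1, ← Finset.sum_mul, mul_eq_zero, or_iff_left hk]
    at h2
  have h3 : ∑ j ∈ Finset.range B, (C ((p j).coeff e) * X ^ j : ℂ[X]) = 0 := by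
    apply RatFunc.algebraMap_injective ℂ
    rw [map_sum, map_zero]
    exact h2
  have h4 : ∀ j ∈ Finset.range B, (p j).coeff e = 0 := by
    intro j hj
    have := congrArg (fun q => coeff q j) h3
    simp only [finsetSum_coeff, coeff_C_mul_X_pow, coeff_zero] at this
    rwa [Finset.sum_ite_eq, if_pos hj] at this
  obtain ⟨j₀, hj₀, hpj₀⟩ := hp
  obtain ⟨j, hj, hje⟩ := Finset.exists_mem_eq_sup (Finset.range B) ⟨j₀, hj₀⟩
    fun j => (p j).natDegree
  have h5 := h4 j hj
  rw [he, hje] at h5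
  have h6 : p j = 0 := leadingCoeff_eq_zero.1 h5
  have h7 : e = 0 := by rw [he, hje, h6, natDegree_zero]
  have h8 := hle j₀ hj₀
  rw [h7, Nat.le_zero] at h8
  have h9 := h4 j₀ hj₀
  rw [h7, ← h8] at h9
  exact hpj₀ (leadingCoeff_eq_zero.1 h9)

theorem DiffOp.eq_zero_of_appZ_eq_zero {P : DiffOp} {u : M} (hu : u ≠ 0) (h : P.appZ u = 0) :
    P = 0 := by
  obtain ⟨q, rfl⟩ := P.exists_leftOp
  by_contra hP
  have hq : q ≠ 0 := fun hq => hP (by rw [hq]; simp [leftOp])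
  obtain ⟨b, hb, p, hp⟩ := exists_common_denominator (Finset.range q.natDegree.succ) q.coeff
  refine leftOp_nablaZ_ne_zero (B := q.natDegree.succ) (p := p) ⟨q.natDegree, by simp, ?_⟩ hu ?_
  · intro h0
    have h1 := hp q.natDegree (by simp)
    rw [h0, polyX, polyX, map_zero] at h1
    exact mul_ne_zero (RatFunc.algebraMap_ne_zero hb) (leadingCoeff_ne_zero.2 hq) h1
  · have h1 : polyZ b * leftOp mulZHom nablaZEnd q u = 0 := by
      rw [← appZ_leftOp, h, mul_zero]
    rw [leftOp_eq_sum_of_lt _ _ (Nat.lt_succ_self _), LinearMap.sum_apply, Finset.mul_sum] at h1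
    rw [← h1]
    refine Finset.sum_congr rfl fun j hj => ?_
    rw [Module.End.mul_apply, mulZHom_apply, ← mul_assoc, ← ratZ_polyX b, ← ratZ_mul, hp j hj,
      ratZ_polyX]

/-! ### Functions of `x z` -/

/-- `u = e^{xz} ∑ k, A k * (x z) ^ (-k)`. -/
def IsXZ (u : M) (A : ℤ → ℂ) : Prop := ∀ k, u.coeff k = RatFunc.C (A k) * RatFunc.X ^ (-k)

/-- The operator `ξ ∂_ξ` on `e^ξ ∑ k, A k * ξ ^ (-k)`. -/
def eulerXi : Module.End ℂ (ℤ → ℂ) where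
  toFun A k := A (k + 1) - k * A k
  map_add' A B := by funext k; simp only [Pi.add_apply]; ring
  map_smul' c A := by funext k; simp only [Pi.smul_apply, smul_eq_mul, RingHom.id_apply]; ring

theorem eulerXi_apply (A : ℤ → ℂ) (k : ℤ) : eulerXi A k = A (k + 1) - k * A k := rfl

theorem eulerDer_zpow (k : ℤ) :
    RatFunc.X * dx (RatFunc.X ^ k) = (k : K) * RatFunc.X ^ k := by
  have hX : (RatFunc.X : K) ≠ 0 := RatFunc.X_ne_zero
  have h : dx (RatFunc.X ^ k) = k • RatFunc.X ^ (k - 1) • dx RatFunc.X :=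
    dxDer.leibniz_zpow RatFunc.X k
  rw [h, dx_X, zsmul_eq_mul, smul_eq_mul, mul_one, zpow_sub_one₀ hX]
  field_simp

theorem euler_app (u : M) : euler.app u = cX RatFunc.X * nablaX u := rfl

theorem euler_appZ (u : M) : euler.appZ u = zM * nablaZ u := by
  rw [euler, DiffOp.appZ_mul, mulX_appZ, ddx_appZ, ratZ_X]

namespace IsXZ

variable {u v : M} {A B : ℤ → ℂ}

theorem euler_app (h : IsXZ u A) : IsXZ (euler.app u) (eulerXi A) := by
  intro k
  have hX : (RatFunc.X : K) ≠ 0 := RatFunc.X_ne_zero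
  rw [BesselDarboux.euler_app, M.coeff_cX_mul, nablaX_apply, M.coeff_add, M.coeff_coeffDx,
    M.coeff_zM_mul, h, h, dx_C_mul, mul_add, mul_left_comm, eulerDer_zpow, eulerXi_apply,
    neg_add, zpow_add₀ hX, zpow_neg_one, map_sub, map_mul, map_intCast]
  push_cast
  field_simp
  ring

theorem euler_appZ (h : IsXZ u A) : IsXZ (euler.appZ u) (eulerXi A) := by
  intro k
  have hX : (RatFunc.X : K) ≠ 0 := RatFunc.X_ne_zero
  rw [BesselDarboux.euler_appZ, M.coeff_zM_mul, nablaZ, M.coeff_add, M.coeff_coeffDz,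
    M.coeff_cX_mul, add_sub_cancel_right, h, h, eulerXi_apply,
    neg_add, zpow_add₀ hX, zpow_neg_one, map_sub, map_mul, map_intCast]
  field_simp
  ring

theorem add (hu : IsXZ u A) (hv : IsXZ v B) : IsXZ (u + v) (A + B) := fun k => by
  rw [M.coeff_add, hu, hv, Pi.add_apply, map_add, add_mul]

theorem smul (c : ℂ) (hu : IsXZ u A) : IsXZ (c • u) (c • A) := fun k => by
  rw [M.coeff_smul, hu, Pi.smul_apply, smul_eq_mul, map_mul, mul_assoc]

theorem eq (hu : IsXZ u A) (hv : IsXZ v A) : u = v := M.ext fun k => by rw [hu, hv]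

theorem aeval_app (h : IsXZ u A) (p : ℂ[X]) :
    IsXZ ((aeval euler p).app u) (aeval eulerXi p A) := by
  induction p using Polynomial.induction_on generalizing u A with
  | C a =>
    have e : (aeval euler (C a)).app u = a • u := by rw [aeval_C]; rfl
    rw [e, aeval_C, Module.algebraMap_end_apply]
    exact h.smul a
  | add p q hp hq => rw [map_add, map_add]; exact (hp h).add (hq h)
  | monomial n a ih =>
    rw [pow_succ, ← mul_assoc, map_mul (aeval euler), map_mul (aeval eulerXi), aeval_X, aeval_X]
    exact ih h.euler_app

theorem aeval_appZ (h : IsXZ u A) (p : ℂ[X]) :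
    IsXZ ((aeval euler p).appZ u) (aeval eulerXi p A) := by
  induction p using Polynomial.induction_on generalizing u A with
  | C a =>
    have e : (aeval euler (C a)).appZ u = a • u := by
      rw [aeval_C, ← appZAlgHom_apply, AlgHom.commutes, Module.algebraMap_end_apply]
    rw [e, aeval_C, Module.algebraMap_end_apply]
    exact h.smul a
  | add p q hp hq => rw [map_add, map_add, DiffOp.appZ_add]; exact (hp h).add (hq h)
  | monomial n a ih =>
    rw [pow_succ, ← mul_assoc, map_mul (aeval euler), map_mul (aeval eulerXi), aeval_X, aeval_X,
      DiffOp.appZ_mul]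
    exact ih h.euler_appZ

/-- On functions of `ξ = xz` the operators `x ∂_x` and `z ∂_z` both equal `ξ ∂_ξ`. This symmetry is
the source of bispectrality. -/
theorem aeval_appZ_eq (h : IsXZ u A) (p : ℂ[X]) :
    (aeval euler p).appZ u = (aeval euler p).app u := (h.aeval_appZ p).eq (h.aeval_app p)

end IsXZ

/-- A sequence extended by zero to negative indices. -/
def extendZ (a : ℕ → ℂ) (k : ℤ) : ℂ := if k < 0 then 0 else a k.toNat

theorem isXZ_seriesXZ (a : ℕ → ℂ) : IsXZ (seriesXZ a) (extendZ a) := by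
  intro k
  have h : (seriesXZ a).coeff k = if k < 0 then 0 else
      PowerSeries.coeff k.natAbs (PowerSeries.mk fun k => RatFunc.C (a k) * (RatFunc.X ^ k)⁻¹) :=
    PowerSeries.coeff_coe _ k
  rw [h, extendZ]
  split_ifs with hk
  · simp
  · obtain ⟨j, rfl⟩ := Int.eq_ofNat_of_zero_le (not_lt.1 hk)
    simp

/-! ### Existence of the Bessel wave function -/

theorem exists_strongRec (F : ℕ → (ℕ → ℂ) → ℂ)
    (hF : ∀ n a b, (∀ i < n, a i = b i) → F n a = F n b) : ∃ a : ℕ → ℂ, ∀ n, a n = F n a := by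
  let G : (n : ℕ) → ((m : ℕ) → m < n → ℂ) → ℂ := fun n ih =>
    F n fun i => if h : i < n then ih i h else 0
  refine ⟨Nat.lt_wfRel.wf.fix G, fun n => ?_⟩
  have h : Nat.lt_wfRel.wf.fix G n = F n fun i => if i < n then Nat.lt_wfRel.wf.fix G i else 0 := by
    rw [WellFounded.fix_eq]
    rfl
  rw [h]
  exact hF _ _ _ fun i hi => if_pos hi

/-- Each factor is the shift minus `k + β i`, so a product of `r` factors reaches `r` indices ahead.
The hypothesis removes all but the two furthest values, and the coefficient of the second one
collects `-(k + t)` for `t < r` and the `-β i`. -/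
theorem aeval_eulerXi_leading {ι : Type*} (β : ι → ℂ) (s : Finset ι) (A : ℤ → ℂ) (k : ℤ)
    (hA : ∀ j, j + 2 ≤ k + s.card → A j = 0) :
    aeval eulerXi (∏ i ∈ s, (X - C (β i))) A k = A (k + s.card) +
      ((s.card : ℂ) * (s.card - 1) / 2 - s.card * (k + s.card - 1) - ∑ i ∈ s, β i) *
        A (k + s.card - 1) := by
  classical
  induction s using Finset.induction_on generalizing k with
  | empty => simp
  | insert b s hb ih =>
    rw [Finset.card_insert_of_notMem hb] at hA ⊢
    rw [Finset.prod_insert hb, Finset.sum_insert hb, map_mul, Module.End.mul_apply, map_sub,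
      aeval_X, aeval_C, LinearMap.sub_apply, Module.algebraMap_end_apply, Pi.sub_apply,
      Pi.smul_apply, eulerXi_apply, ih (k + 1) fun j hj => hA j (by push_cast; omega),
      ih k fun j hj => hA j (by push_cast; omega)]
    have h1 : A (k + s.card - 1) = 0 := hA _ (by push_cast; omega)
    have h2 : k + 1 + (s.card : ℤ) = k + ((s.card + 1 : ℕ) : ℤ) := by push_cast; ring
    have h3 : k + ((s.card + 1 : ℕ) : ℤ) - 1 = k + s.card := by push_cast; ring
    rw [h1, h2, h3, smul_eq_mul]
    push_cast
    ring

/-- In the equation at `k = j + 1 - N` the values at `j + 1` cancel, and the assumption on `∑ β`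
makes the coefficient of the value at `j` equal to `-N * j`. So the value at `0` is free and each
later one is determined by its predecessors. -/
theorem exists_bessel_coeffs {N : ℕ} (hN : 0 < N) (β : Fin N → ℂ)
    (hβ : ∑ s, β s = (N : ℂ) * ((N : ℂ) - 1) / 2) :
    ∃ a : ℕ → ℂ, a 0 = 1 ∧ ∀ k : ℤ,
      aeval eulerXi (∏ i, (X - C (β i))) (extendZ a) k = extendZ a (k + N) := by
  set E := aeval eulerXi (∏ i, (X - C (β i))) with hE
  obtain ⟨a, ha⟩ := exists_strongRec (fun n a => if n = 0 then 1 else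
    E (extendZ fun i => if i < n then a i else 0) (n + 1 - N) / (N * n)) (by
      intro n a b h
      have : (fun i => if i < n then a i else 0) = fun i => if i < n then b i else 0 := by
        funext i; split_ifs with hi
        · exact h i hi
        · rfl
      simp only [this])
  have hN' : (N : ℂ) ≠ 0 := by exact_mod_cast hN.ne'
  refine ⟨a, by simpa using ha 0, fun k => ?_⟩
  obtain ⟨j, rfl⟩ : ∃ j, k = j + 1 - N := ⟨k + N - 1, by ring⟩
  -- The part of the sequence before index `j`; the rest has only two relevant terms, which
  -- `aeval_eulerXi_leading` computes.
  set T : ℤ → ℂ := fun i => if i < j then extendZ a i else 0 with hT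
  have hlead := aeval_eulerXi_leading β Finset.univ (extendZ a - T) (j + 1 - N) (by
    intro i hi
    rw [Finset.card_univ, Fintype.card_fin] at hi
    rw [Pi.sub_apply, hT]
    simp only
    rw [if_pos (by omega), sub_self])
  rw [← hE, map_sub, Pi.sub_apply, Finset.card_univ, Fintype.card_fin, hβ] at hlead
  have e1 : j + 1 - N + (N : ℤ) = j + 1 := by ring
  have e2 : T (j + 1) = 0 := if_neg (by omega)
  have e3 : T j = 0 := if_neg (by omega)
  rw [e1, add_sub_cancel_right, Pi.sub_apply, Pi.sub_apply, e2, e3, sub_zero, sub_zero] at hlead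
  rw [e1]
  push_cast at hlead
  have key : E T (j + 1 - N) = N * j * extendZ a j := by
    rcases lt_trichotomy j 0 with hj | hj | hj
    · have hT0 : T = 0 := by
        funext i
        rw [hT]
        simp only [extendZ]
        split_ifs with h1 h2
        · rfl
        · omega
        · rfl
      have : extendZ a j = 0 := if_pos hj
      rw [hT0, map_zero, this, mul_zero]; rfl
    · have hT0 : T = 0 := by
        funext i
        rw [hT]
        simp only [extendZ]
        split_ifs with h1 h2
        · rfl
        · omega
        · rfl
      rw [hT0, map_zero, hj]; simp
    · obtain ⟨n, rfl⟩ := Int.eq_ofNat_of_zero_le hj.le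
      have hn : n ≠ 0 := by omega
      have hn' : (n : ℂ) ≠ 0 := by exact_mod_cast hn
      have h1 := ha n
      rw [if_neg hn, eq_div_iff (mul_ne_zero hN' hn')] at h1
      have h2 : extendZ a (n : ℤ) = a n := by simp [extendZ]
      have h3 : T = extendZ fun i => if i < n then a i else 0 := by
        funext i
        rw [hT]
        simp only [extendZ]
        split_ifs <;> first | rfl | omega
      rw [h2, h3, ← h1]
      push_cast
      ring
  linear_combination hlead + key

theorem besselOp_eq {m : ℕ} (δ : Fin m → ℂ) (I : Finset (Fin m)) :
    besselOp δ I = mulX (RatFunc.X ^ I.card)⁻¹ * aeval euler (linProd δ I) := rfl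

theorem besselL_eq {N : ℕ} (β : Fin N → ℂ) :
    besselL β = mulX (RatFunc.X ^ N)⁻¹ * aeval euler (linProd β Finset.univ) := by
  rw [besselL, besselOp_eq, Finset.card_univ, Fintype.card_fin]

theorem besselWave_spec {N : ℕ} (hN : 0 < N) (β : Fin N → ℂ)
    (hβ : ∑ s, β s = (N : ℂ) * ((N : ℂ) - 1) / 2) :
    ∃ A : ℤ → ℂ, A 0 = 1 ∧ (∀ k < 0, A k = 0) ∧ IsXZ (besselWave β) A ∧
      (besselL β).app (besselWave β) = zM ^ N * besselWave β := by
  have hex : ∃ a : ℕ → ℂ, a 0 = 1 ∧ (besselL β).app (seriesXZ a) = zM ^ N * seriesXZ a := by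
    obtain ⟨a, h0, ha⟩ := exists_bessel_coeffs hN β hβ
    refine ⟨a, h0, M.ext fun k => ?_⟩
    have hX : (RatFunc.X : K) ≠ 0 := RatFunc.X_ne_zero
    rw [besselL_eq, DiffOp.app_mul, mulX_app, M.coeff_cX_mul, M.coeff_zM_pow_mul,
      (isXZ_seriesXZ a).aeval_app, isXZ_seriesXZ a, linProd, ha, neg_add, zpow_add₀ hX,
      zpow_neg RatFunc.X (N : ℤ), zpow_natCast]
    ring
  have h := Classical.epsilon_spec hex
  refine ⟨_, ?_, ?_, isXZ_seriesXZ _, h.2⟩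
  · rw [extendZ, if_neg (lt_irrefl _)]; exact h.1
  · intro k hk; exact if_pos hk

/-! ### Powers of Bessel operators -/

theorem aeval_mul_eigenvector {F E : Type*} [Field F] [Algebra ℂ F] [Ring E] [Algebra ℂ E]
    {μ : F →ₐ[ℂ] E} {D : E} {δ : Derivation ℂ F F} (hD : ∀ h, D * μ h = μ h * D + μ (δ h))
    {h : F} {c : ℂ} (hc : δ h = algebraMap ℂ F c * h) (p : ℂ[X]) :
    aeval D p * μ h = μ h * aeval D (p.comp (X + C c)) := by
  have h1 : D * μ h = μ h * aeval D (X + C c) := by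
    rw [hD, hc, map_mul, AlgHom.commutes, Algebra.commutes, map_add, aeval_X, aeval_C, mul_add]
  induction p using Polynomial.induction_on with
  | C a => rw [aeval_C, C_comp, aeval_C, Algebra.commutes]
  | add p q hp hq => rw [map_add, add_comp, map_add, mul_add, add_mul, hp, hq]
  | monomial n a ih =>
    rw [pow_succ, ← mul_assoc, map_mul, aeval_X, mul_assoc, h1, ← mul_assoc, ih, mul_assoc,
      ← map_mul, mul_comp _ X, X_comp]

theorem aeval_euler_mul_inv_X_pow (p : ℂ[X]) (j : ℕ) :
    aeval euler p * mulX (RatFunc.X ^ j)⁻¹ =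
      mulX (RatFunc.X ^ j)⁻¹ * aeval euler (p.comp (X - C (j : ℂ))) := by
  have h := aeval_mul_eigenvector (μ := mulXHom) (D := euler) euler_mul_mulX
    (h := (RatFunc.X ^ j)⁻¹) (c := -(j : ℂ)) (by
    rw [eulerDer_inv_X_pow, map_neg, neg_mul]) p
  rwa [map_neg, ← sub_eq_add_neg] at h

/-- Moving `x ^ (-N)` to the left past a polynomial in `D` replaces `D` by `D - N` and so raises its
roots by `N`. This produces the exponents `β^d`. -/
theorem besselL_pow {N : ℕ} (β : Fin N → ℂ) (d : ℕ) :
    besselL β ^ d = mulX (RatFunc.X ^ (N * d))⁻¹ *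
      aeval euler (∏ t ∈ Finset.range d, ∏ s, (X - C (β s + (N : ℂ) * (t : ℂ)))) := by
  induction d with
  | zero =>
    rw [pow_zero, mul_zero, pow_zero, inv_one, Finset.range_zero, Finset.prod_empty, map_one,
      mul_one]
    exact (map_one mulXHom).symm
  | succ d ih =>
    have h : (∏ t ∈ Finset.range d, ∏ s, (X - C (β s + (N : ℂ) * (t : ℂ)))).comp
        (X - C (N : ℂ)) * linProd β Finset.univ =
        ∏ t ∈ Finset.range (d + 1), ∏ s, (X - C (β s + (N : ℂ) * (t : ℂ))) := by
      rw [Finset.prod_range_succ']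
      simp only [prod_comp, sub_comp, X_comp, C_comp, linProd]
      congr 1
      · refine Finset.prod_congr rfl fun t _ => Finset.prod_congr rfl fun s _ => ?_
        simp only [Nat.cast_add, Nat.cast_one, mul_add, mul_one, map_add]
        ring
      · simp
    rw [pow_succ, ih, besselL_eq, mul_assoc, ← mul_assoc (aeval euler _),
      aeval_euler_mul_inv_X_pow, mul_assoc, ← map_mul, h, ← mul_assoc, ← mulXHom_apply,
      ← mulXHom_apply, ← mulXHom_apply, ← map_mul, ← mul_inv, ← pow_add]
    rfl

theorem besselL_pow_eq_besselOp {N : ℕ} (β : Fin N → ℂ) (d : ℕ) :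
    besselL β ^ d = besselOp (betaPow β d) Finset.univ := by
  rw [besselL_pow, besselOp_eq, Finset.card_univ, Fintype.card_fin]
  congr 2
  rw [linProd, ← Equiv.prod_comp finProdFinEquiv, Fintype.prod_prod_type,
    Finset.prod_comm (s := (Finset.univ : Finset (Fin N))),
    ← Fin.prod_univ_eq_prod_range (fun t : ℕ => ∏ s, (X - C (β s + (N : ℂ) * (t : ℂ))))]
  refine Finset.prod_congr rfl fun t _ => Finset.prod_congr rfl fun s _ => ?_
  have h := finProdFinEquiv.symm_apply_apply (s, t)
  rw [finProdFinEquiv_symm_apply, Prod.mk.injEq] at h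
  rw [betaPow, h.1, h.2]

/-! ### Operators in `x` and in `z` with the same effect on the Bessel wave function -/

/-- The eigenvalue equation says that `∏ (D - β i)` multiplies `Ψ` by `(xz) ^ N`. This is symmetric
in `x` and `z`, and dividing by `z ^ N` instead of `x ^ N` leaves `x ^ N`. -/
theorem besselL_appZ {N : ℕ} {β : Fin N → ℂ} {Ψ : M} {A : ℤ → ℂ} (hA : IsXZ Ψ A)
    (hL : (besselL β).app Ψ = zM ^ N * Ψ) : (besselL β).appZ Ψ = cX (RatFunc.X ^ N) * Ψ := by
  have hX : (RatFunc.X : K) ^ N ≠ 0 := pow_ne_zero _ RatFunc.X_ne_zero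
  have h1 : (aeval euler (linProd β Finset.univ)).app Ψ = cX (RatFunc.X ^ N) * (zM ^ N * Ψ) := by
    rw [← hL, besselL_eq, DiffOp.app_mul, mulX_app, ← mul_assoc, ← map_mul, mul_inv_cancel₀ hX,
      map_one, one_mul]
  rw [besselL_eq, DiffOp.appZ_mul, mulX_appZ, hA.aeval_appZ_eq, h1, ratZ_inv, ← ratZHom_apply,
    map_pow, ratZHom_apply, ratZ_X]
  field_simp [zM_ne_zero]

/-- `a(x, ∂_x) Ψ = b(z, ∂_z) Ψ`. -/
def Corr (Ψ : M) (a b : DiffOp) : Prop := a.app Ψ = b.appZ Ψ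

namespace Corr

variable {Ψ : M} {a b a' b' : DiffOp}

/-- The order is reversed because operators in `x` commute with operators in `z`. -/
theorem mul (h : Corr Ψ a b) (h' : Corr Ψ a' b') : Corr Ψ (a * a') (b' * b) := by
  rw [Corr, DiffOp.app_mul, h', DiffOp.app_appZ, h, DiffOp.appZ_mul]

theorem one : Corr Ψ 1 1 := by
  rw [Corr, ← appHom_apply, ← appZAlgHom_apply, map_one, map_one]

theorem pow (h : Corr Ψ a b) (n : ℕ) : Corr Ψ (a ^ n) (b ^ n) := by
  induction n with
  | zero => rw [pow_zero, pow_zero]; exact one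
  | succ n ih => rw [pow_succ, pow_succ']; exact ih.mul h

theorem sum {ι : Type*} {s : Finset ι} {f g : ι → DiffOp} (h : ∀ i ∈ s, Corr Ψ (f i) (g i)) :
    Corr Ψ (∑ i ∈ s, f i) (∑ i ∈ s, g i) := by
  rw [Corr, DiffOp.app_sum, ← appZAlgHom_apply, map_sum, LinearMap.sum_apply]
  exact Finset.sum_congr rfl h

theorem smul (c : ℂ) (h : Corr Ψ a b) : Corr Ψ (c • a) (c • b) := by
  rw [Corr, DiffOp.app_smul, h, ← appZAlgHom_apply, ← appZAlgHom_apply, map_smul]; rfl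

theorem aeval (h : Corr Ψ a b) (p : ℂ[X]) : Corr Ψ (aeval a p) (Polynomial.aeval b p) := by
  rw [aeval_eq_sum_range, aeval_eq_sum_range]
  exact sum fun i _ => (h.pow i).smul _

end Corr

/-! ### Exponents of the kernel functions -/

section Exponents

variable {n m : ℕ}

/-- In a nonzero row `b k` is an occurring exponent of least real part, so the other ones differ
from it by nonnegative multiples of `N`. -/
theorem exists_exponents {N : ℕ} (γ : Fin m → ℂ) (A : Matrix (Fin n) (Fin m) ℂ)
    (hA : ∀ k i j, i ≠ j → A k i * A k j ≠ 0 →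
      ∃ l : ℤ, l ≠ 0 ∧ γ i - γ j = (N : ℂ) * (l : ℂ)) :
    ∃ (b : Fin n → ℂ) (e : Fin n → Fin m → ℕ),
      ∀ k i, A k i ≠ 0 → γ i = b k + e k i ∧ N ∣ e k i := by
  have key : ∀ k, ∃ b : ℂ, ∀ i, ∃ e : ℕ, A k i ≠ 0 → γ i = b + e ∧ N ∣ e := by
    intro k
    by_cases hk : ∃ i, A k i ≠ 0
    · obtain ⟨i₁, hi₁⟩ := hk
      obtain ⟨i₀, hi₀, hmin⟩ := Finset.exists_min_image (Finset.univ.filter fun i => A k i ≠ 0)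
        (fun i => (γ i).re) ⟨i₁, by simpa using hi₁⟩
      simp only [Finset.mem_filter, Finset.mem_univ, true_and] at hi₀ hmin
      refine ⟨γ i₀, fun i => ?_⟩
      by_cases hi : A k i ≠ 0
      · by_cases hii : i = i₀
        · exact ⟨0, fun _ => by simp [hii]⟩
        · obtain ⟨l, -, hl⟩ := hA k i i₀ hii (mul_ne_zero hi hi₀)
          have h1 : (0 : ℝ) ≤ (N : ℝ) * l := by
            have := congrArg Complex.re hl
            simp only [Complex.sub_re, Complex.mul_re, Complex.natCast_re, Complex.intCast_re,
              Complex.natCast_im, Complex.intCast_im, mul_zero, sub_zero] at this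
            linarith [hmin i hi]
          have h2 : (0 : ℤ) ≤ (N : ℤ) * l := by exact_mod_cast h1
          refine ⟨((N : ℤ) * l).toNat, fun _ => ⟨?_, ?_⟩⟩
          · have h3 : ((((N : ℤ) * l).toNat : ℤ) : ℂ) = (N : ℂ) * l := by
              rw [Int.toNat_of_nonneg h2]; push_cast; ring
            rw [Int.cast_natCast] at h3
            rw [h3, ← hl]; ring
          · rw [← Int.natCast_dvd_natCast, Int.toNat_of_nonneg h2]
            exact dvd_mul_right _ _
      · exact ⟨0, fun h => absurd h hi⟩
    · exact ⟨0, fun i => ⟨0, fun h => absurd ⟨i, h⟩ hk⟩⟩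
  choose b e h using key
  exact ⟨b, e, h⟩

/-- The matrix of the monomials `a_{ki} x ^ e_{ki}`. -/
def monMat (A : Matrix (Fin n) (Fin m) ℂ) (e : Fin n → Fin m → ℕ) : Matrix (Fin n) (Fin m) ℂ[X] :=
  .of fun k i => C (A k i) * X ^ e k i

/-- All nonzero terms of the Leibniz expansion carry the same power of `x`: its exponent `∑ γ - ∑ b`
does not depend on the permutation. -/
theorem colMinor_monMat {N : ℕ} {γ : Fin m → ℂ} {A : Matrix (Fin n) (Fin m) ℂ} {b : Fin n → ℂ}
    {e : Fin n → Fin m → ℕ} (h : ∀ k i, A k i ≠ 0 → γ i = b k + e k i ∧ N ∣ e k i)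
    {I : Finset (Fin m)} (hI : I.card = n) :
    ∃ q : ℕ, colMinor (monMat A e) I = C (minor A I) * X ^ q ∧
      (minor A I ≠ 0 → (q : ℂ) = ∑ i ∈ I, γ i - ∑ k, b k ∧ N ∣ q) := by
  rw [← colMinor_eq_minor, colMinor_of_card _ hI, colMinor_of_card _ hI]
  set ι := I.orderEmbOfFin hI
  have hterm : ∀ σ : Equiv.Perm (Fin n), ∏ i, (monMat A e).submatrix id ι (σ i) i =
      C (∏ i, A.submatrix id ι (σ i) i) * X ^ ∑ i, e (σ i) (ι i) := by
    intro σ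
    rw [map_prod, ← Finset.prod_pow_eq_pow_sum, ← Finset.prod_mul_distrib]
    rfl
  have hexp : ∀ σ : Equiv.Perm (Fin n), ∏ i, A.submatrix id ι (σ i) i ≠ 0 →
      ((∑ i, e (σ i) (ι i) : ℕ) : ℂ) = ∑ i ∈ I, γ i - ∑ k, b k ∧
        N ∣ ∑ i, e (σ i) (ι i) := by
    intro σ hσ
    have h1 : ∀ i, γ (ι i) = b (σ i) + e (σ i) (ι i) ∧ N ∣ e (σ i) (ι i) := fun i =>
      h _ _ (Finset.prod_ne_zero_iff.1 hσ i (Finset.mem_univ i))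
    refine ⟨?_, Finset.dvd_sum fun i _ => (h1 i).2⟩
    have h2 : ∑ i ∈ I, γ i = ∑ i, γ (ι i) := by
      rw [← Finset.sum_coe_sort I γ, ← Equiv.sum_comp (I.orderIsoOfFin hI).toEquiv]; rfl
    rw [h2, ← Equiv.sum_comp σ b, ← Finset.sum_sub_distrib, Nat.cast_sum]
    exact Finset.sum_congr rfl fun i _ => by rw [(h1 i).1]; ring
  by_cases hex : ∃ σ : Equiv.Perm (Fin n), ∏ i, A.submatrix id ι (σ i) i ≠ 0
  · obtain ⟨σ₀, hσ₀⟩ := hex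
    refine ⟨_, ?_, fun _ => hexp σ₀ hσ₀⟩
    rw [Matrix.det_apply, Matrix.det_apply, map_sum, Finset.sum_mul]
    refine Finset.sum_congr rfl fun σ _ => ?_
    rw [hterm]
    by_cases hσ : ∏ i, A.submatrix id ι (σ i) i = 0
    · rw [hσ]; simp
    · have h3 : ∑ i, e (σ i) (ι i) = ∑ i, e (σ₀ i) (ι i) := by
        have := (hexp σ hσ).1.trans (hexp σ₀ hσ₀).1.symm
        exact_mod_cast this
      rw [h3, Units.smul_def, Units.smul_def, zsmul_eq_mul, zsmul_eq_mul, map_mul, map_intCast,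
        mul_assoc]
  · push Not at hex
    refine ⟨0, ?_, fun h0 => absurd ?_ h0⟩
    · rw [Matrix.det_apply, Matrix.det_apply]
      simp only [hterm, hex]
      simp
    · rw [Matrix.det_apply]
      simp only [hex]
      simp

/-- The rows of `A` are linearly independent after columns with equal exponents are merged. -/
def RowsIndependent (γ : Fin m → ℂ) (A : Matrix (Fin n) (Fin m) ℂ) : Prop :=
  ∀ c : Fin n → ℂ, (∀ z : ℂ, ∑ i with γ i = z, ∑ k, c k * A k i = 0) → c = 0

theorem rowsIndependent_of_kernelBasis {γ : Fin m → ℂ} {A : Matrix (Fin n) (Fin m) ℂ} {P : DiffOp}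
    (h : IsKernelBasis P (kerFun γ A)) : RowsIndependent γ A := by
  intro c hc
  refine h.1 c (Filter.Eventually.of_forall fun x => ?_)
  have h1 : ∑ k, c k * kerFun γ A k x = ∑ i, (∑ k, c k * A k i) * (x : ℂ) ^ γ i := by
    simp only [kerFun, Finset.mul_sum, Finset.sum_mul]
    rw [Finset.sum_comm]
    exact Finset.sum_congr rfl fun i _ => Finset.sum_congr rfl fun k _ => by ring
  rw [h1, ← Finset.sum_fiberwise_of_maps_to (g := γ) (t := Finset.univ.image γ)
    (fun i _ => Finset.mem_image_of_mem _ (Finset.mem_univ i))]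
  refine Finset.sum_eq_zero fun z _ => ?_
  have h2 : ∑ i with γ i = z, (∑ k, c k * A k i) * (x : ℂ) ^ γ i =
      (∑ i with γ i = z, ∑ k, c k * A k i) * (x : ℂ) ^ z := by
    rw [Finset.sum_mul]
    refine Finset.sum_congr rfl fun i hi => ?_
    rw [(Finset.mem_filter.1 hi).2]
  rw [h2, hc, zero_mul]

/-- An operator with polynomial coefficients that annihilates all rows has at infinity an indicial
polynomial of degree at least the number of rows. -/
theorem le_natDegree_leadingCoeff {N : ℕ} {γ : Fin m → ℂ} {A : Matrix (Fin n) (Fin m) ℂ}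
    (hind : RowsIndependent γ A) {b : Fin n → ℂ} {e : Fin n → Fin m → ℕ}
    (h : ∀ k i, A k i ≠ 0 → γ i = b k + e k i ∧ N ∣ e k i) {R : (ℂ[X])[X]} (hR0 : R ≠ 0)
    (hR : ∀ k, ∑ i, monMat A e k i * R.map (evalRingHom (γ i)) = 0) :
    n ≤ R.leadingCoeff.natDegree := by
  classical
  -- In `R` the outer variable is `x` and the inner one stands for `D`, so `r` is the indicial
  -- polynomial at `x = ∞`.
  set r := R.leadingCoeff with hr
  have hr0 : r ≠ 0 := leadingCoeff_ne_zero.2 hR0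
  by_contra hlt
  rw [not_le] at hlt
  set S := r.roots.toFinset
  have hS : S.card < n := (Multiset.toFinset_card_le _).trans_lt ((card_roots' r).trans_lt hlt)
  let v : (Fin n → ℂ) →ₗ[ℂ] ℂ → ℂ :=
    { toFun := fun c z => ∑ i with γ i = z, ∑ k, c k * A k i
      map_add' := fun c c' => by
        funext z; simp only [Pi.add_apply, add_mul, Finset.sum_add_distrib]
      map_smul' := fun a c => by
        funext z
        simp only [Pi.smul_apply, smul_eq_mul, RingHom.id_apply, Finset.mul_sum, mul_assoc] }
  -- There are fewer roots of `r` than rows, so some nontrivial combination of the rows has no term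
  -- `x ^ z` with `z` a root of `r`.
  obtain ⟨c, hcker, hc0⟩ : ∃ c, (∀ z ∈ S, v c z = 0) ∧ c ≠ 0 := by
    let ρ : (ℂ → ℂ) →ₗ[ℂ] (S → ℂ) := LinearMap.funLeft ℂ ℂ Subtype.val
    have hne : LinearMap.ker (ρ.comp v) ≠ ⊥ :=
      LinearMap.ker_ne_bot_of_finrank_lt (by simpa using hS)
    obtain ⟨c, hc, hc0⟩ := (Submodule.ne_bot_iff _).1 hne
    exact ⟨c, fun z hz => congrFun (LinearMap.mem_ker.1 hc) ⟨z, hz⟩, hc0⟩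
  have hvim : ∀ z, v c z ≠ 0 → z ∈ Finset.univ.image γ := by
    intro z hz
    by_contra hzi
    apply hz
    change ∑ i with γ i = z, ∑ k, c k * A k i = 0
    refine Finset.sum_eq_zero fun i hi => absurd ?_ hzi
    exact Finset.mem_image.2 ⟨i, Finset.mem_univ i, (Finset.mem_filter.1 hi).2⟩
  obtain ⟨z₁, hz₁⟩ : ∃ z, v c z ≠ 0 := by
    by_contra hall
    push Not at hall
    exact hc0 (hind c hall)
  -- An exponent of largest real part in that combination. Applying `R` gives the coefficient of `x
  -- ^ w` a contribution from `x ^ z₀` alone, namely `r(z₀)` times a nonzero number, so `z₀` is a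
  -- root of `r`, a contradiction.
  obtain ⟨z₀, hz₀, hmax⟩ := Finset.exists_max_image ((Finset.univ.image γ).filter fun z => v c z ≠ 0)
    Complex.re ⟨z₁, Finset.mem_filter.2 ⟨hvim z₁ hz₁, hz₁⟩⟩
  have hz₀' := (Finset.mem_filter.1 hz₀).2
  set w : ℂ := z₀ + R.natDegree with hw
  -- The coefficient of `x ^ w` in `R` applied to `x ^ z`.
  let g : ℂ → ℂ := fun z => ∑ p ∈ Finset.range (R.natDegree + 1),
    if z + p = w then (R.coeff p).eval z else 0
  have hrow : ∀ k, ∑ i, A k i * g (γ i) = 0 := by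
    intro k
    by_cases ht : ∃ t : ℕ, w = b k + t
    · obtain ⟨t, ht⟩ := ht
      have h1 := congrArg (fun q => coeff q t) (hR k)
      simp only [finsetSum_coeff, coeff_zero] at h1
      rw [← h1]
      refine Finset.sum_congr rfl fun i _ => ?_
      rw [monMat, Matrix.of_apply, mul_assoc, coeff_C_mul, coeff_X_pow_mul']
      by_cases hi : A k i = 0
      · rw [hi, zero_mul, zero_mul]
      · congr 1
        have h2 : ∀ p : ℕ, (γ i + p = w) = (e k i + p = t) := by
          intro p
          rw [(h k i hi).1, ht, add_assoc, add_right_inj]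
          exact_mod_cast rfl
        simp only [g, h2]
        split_ifs with hle
        · rw [coeff_map, coe_evalRingHom]
          by_cases hd : t - e k i ≤ R.natDegree
          · rw [Finset.sum_eq_single (t - e k i) (fun p _ hp => if_neg (by omega))
              (fun hn => absurd (Finset.mem_range.2 (by omega)) hn), if_pos (by omega)]
          · rw [coeff_eq_zero_of_natDegree_lt (by omega), eval_zero]
            refine Finset.sum_eq_zero fun p hp => if_neg ?_
            have := Finset.mem_range.1 hp
            omega
        · exact Finset.sum_eq_zero fun p _ => if_neg (by omega)
    · refine Finset.sum_eq_zero fun i _ => ?_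
      by_cases hi : A k i = 0
      · rw [hi, zero_mul]
      · have : g (γ i) = 0 := Finset.sum_eq_zero fun p _ => if_neg fun hp => ht ⟨e k i + p, by
          rw [← hp, (h k i hi).1]; push_cast; ring⟩
        rw [this, mul_zero]
  have hsum : ∑ z ∈ Finset.univ.image γ, v c z * g z = 0 := by
    have h1 : ∑ i, (∑ k, c k * A k i) * g (γ i) = 0 := by
      simp only [Finset.sum_mul]
      rw [Finset.sum_comm]
      refine Finset.sum_eq_zero fun k _ => ?_
      simp only [mul_assoc, ← Finset.mul_sum]
      rw [hrow, mul_zero]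
    rw [← h1, ← Finset.sum_fiberwise_of_maps_to (g := γ) (t := Finset.univ.image γ)
      (fun i _ => Finset.mem_image_of_mem _ (Finset.mem_univ i))]
    refine Finset.sum_congr rfl fun z _ => ?_
    simp only [v, LinearMap.coe_mk, AddHom.coe_mk]
    rw [Finset.sum_mul]
    refine Finset.sum_congr rfl fun i hi => ?_
    rw [(Finset.mem_filter.1 hi).2]
  have hg : g z₀ = r.eval z₀ := by
    simp only [g]
    rw [Finset.sum_eq_single R.natDegree (fun p _ hp => if_neg fun hpw => hp ?_) (by simp),
      if_pos rfl]
    · rfl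
    · rw [hw, add_right_inj] at hpw
      exact_mod_cast hpw
  rw [Finset.sum_eq_single z₀ (fun z _ hz => ?_) (fun hn => absurd (hvim z₀ hz₀') hn), hg,
    mul_eq_zero, or_iff_right hz₀'] at hsum
  · exact hz₀' (hcker z₀ (Multiset.mem_toFinset.2 ((mem_roots hr0).2 hsum)))
  · by_cases hvz : v c z = 0
    · rw [hvz, zero_mul]
    · have hre := hmax z (Finset.mem_filter.2 ⟨hvim z hvz, hvz⟩)
      have : g z = 0 := by
        refine Finset.sum_eq_zero fun p hp => if_neg fun hpw => hz ?_
        have hp' := Finset.mem_range.1 hp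
        have hre2 := congrArg Complex.re hpw
        rw [hw, Complex.add_re, Complex.add_re, Complex.natCast_re, Complex.natCast_re] at hre2
        have hle : (R.natDegree : ℝ) ≤ p := by linarith
        have hpe : p = R.natDegree := by
          have : R.natDegree ≤ p := by exact_mod_cast hle
          omega
        rw [hpe, hw] at hpw
        exact add_right_cancel hpw
      rw [this, mul_zero]

/-- The matrix of the monomials `a_{ki} x ^ e_{ki}` over `ℂ(x)`. -/
def ratMat (A : Matrix (Fin n) (Fin m) ℂ) (e : Fin n → Fin m → ℕ) : Matrix (Fin n) (Fin m) K :=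
  (monMat A e).map polyX

theorem polyX_injective : Function.Injective polyX := RatFunc.algebraMap_injective ℂ

theorem polyX_mul (p q : ℂ[X]) : polyX (p * q) = polyX p * polyX q := map_mul _ p q

theorem polyX_sum {ι : Type*} (s : Finset ι) (f : ι → ℂ[X]) :
    polyX (∑ i ∈ s, f i) = ∑ i ∈ s, polyX (f i) := map_sum (algebraMap ℂ[X] K) f s

theorem polyX_X_pow (j : ℕ) : polyX (X ^ j) = RatFunc.X ^ j := by
  rw [polyX, map_pow, RatFunc.algebraMap_X]

theorem polyX_C' (c : ℂ) : polyX (C c) = algebraMap ℂ K c := by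
  rw [polyX_C, RatFunc.algebraMap_eq_C]

theorem colMinor_ratMat (A : Matrix (Fin n) (Fin m) ℂ) (e : Fin n → Fin m → ℕ)
    (I : Finset (Fin m)) : colMinor (ratMat A e) I = polyX (colMinor (monMat A e) I) :=
  colMinor_map (algebraMap ℂ[X] K) (monMat A e) I

theorem eulerDer_ratMat {N : ℕ} {γ : Fin m → ℂ} {A : Matrix (Fin n) (Fin m) ℂ} {b : Fin n → ℂ}
    {e : Fin n → Fin m → ℕ} (h : ∀ k i, A k i ≠ 0 → γ i = b k + e k i ∧ N ∣ e k i)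
    (k : Fin n) (i : Fin m) :
    eulerDer (ratMat A e k i) = algebraMap ℂ K (γ i - b k) * ratMat A e k i := by
  have h1 : ratMat A e k i = algebraMap ℂ K (A k i) * RatFunc.X ^ e k i := by
    rw [ratMat, Matrix.map_apply, monMat, Matrix.of_apply, polyX_mul, polyX_C', polyX_X_pow]
  by_cases hi : A k i = 0
  · rw [h1, hi, map_zero, zero_mul, map_zero, mul_zero]
  · rw [h1, Derivation.leibniz, Derivation.map_algebraMap, smul_zero, add_zero, eulerDer_X_pow,
      (h k i hi).1, add_sub_cancel_left, smul_eq_mul]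
    ring

/-- A kernel vector of the Wronskian matrix is an operator of order less than `n` in `D` that kills
all rows. With denominators cleared, its indicial polynomial at infinity has degree below `n`,
against `le_natDegree_leadingCoeff`. -/
theorem wronskian_ratMat_ne_zero {N : ℕ} {γ : Fin m → ℂ} {A : Matrix (Fin n) (Fin m) ℂ}
    (hind : RowsIndependent γ A) {b : Fin n → ℂ} {e : Fin n → Fin m → ℕ}
    (h : ∀ k i, A k i ≠ 0 → γ i = b k + e k i ∧ N ∣ e k i) :
    (wronskian γ (ratMat A e)).det ≠ 0 := by
  intro hdet
  obtain ⟨c, hc0, hc⟩ := Matrix.exists_mulVec_eq_zero_iff.2 hdet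
  obtain ⟨d, hd, p, hp⟩ := exists_common_denominator Finset.univ c
  obtain ⟨j₀, hj₀⟩ := Function.ne_iff.1 hc0
  have hpj : p j₀ ≠ 0 := by
    intro h0
    have h1 := hp j₀ (Finset.mem_univ _)
    rw [h0, polyX, polyX, map_zero] at h1
    exact mul_ne_zero (RatFunc.algebraMap_ne_zero hd) hj₀ h1
  -- The operator `∑ p_j(x) D ^ j`, rewritten as a polynomial in `x` whose coefficients are
  -- polynomials in `D`.
  set R : (ℂ[X])[X] := ∑ j : Fin n, C (X ^ (j : ℕ)) * (p j).map C with hR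
  have hcoeff : ∀ t, R.coeff t = ∑ j : Fin n, C ((p j).coeff t) * X ^ (j : ℕ) := by
    intro t
    rw [hR, finsetSum_coeff]
    refine Finset.sum_congr rfl fun j _ => ?_
    rw [coeff_C_mul, coeff_map, mul_comm]
  have hR0 : R ≠ 0 := by
    intro h0
    obtain ⟨t, ht⟩ : ∃ t, (p j₀).coeff t ≠ 0 := by
      by_contra hall
      push Not at hall
      exact hpj (ext hall)
    have h1 := congrArg (fun q => coeff q (j₀ : ℕ)) (hcoeff t)
    simp only [h0, coeff_zero, finsetSum_coeff, coeff_C_mul_X_pow] at h1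
    rw [Finset.sum_eq_single j₀ (fun i _ hi => if_neg fun hh => hi (Fin.ext hh.symm)) (by simp),
      if_pos rfl] at h1
    exact ht h1.symm
  have hker : ∀ k, ∑ i, monMat A e k i * R.map (evalRingHom (γ i)) = 0 := by
    intro k
    apply polyX_injective
    have h1 := congrFun hc k
    have h2 : polyX d * (wronskian γ (ratMat A e)).mulVec c k = 0 := by rw [h1]; simp
    rw [polyX, polyX, map_zero, ← polyX, ← h2, Matrix.mulVec, dotProduct, Finset.mul_sum,
      polyX_sum]
    have h3 : ∀ j : Fin n, polyX d * (wronskian γ (ratMat A e) k j * c j) =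
        ∑ i, polyX (monMat A e k i * (C (γ i ^ (j : ℕ)) * p j)) := by
      intro j
      rw [mul_left_comm, hp j (Finset.mem_univ _), wronskian, Matrix.mul_apply, Finset.sum_mul]
      refine Finset.sum_congr rfl fun i _ => ?_
      rw [polyX_mul, polyX_mul, polyX_C', mul_assoc]
      rfl
    rw [Finset.sum_congr rfl fun j _ => h3 j, Finset.sum_comm]
    refine Finset.sum_congr rfl fun i _ => ?_
    rw [← polyX_sum, ← Finset.mul_sum]
    congr 2
    rw [hR, Polynomial.map_sum]
    refine Finset.sum_congr rfl fun j _ => ?_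
    rw [Polynomial.map_mul, map_C, Polynomial.map_map]
    have : (evalRingHom (γ i)).comp C = RingHom.id ℂ := by ext1 z; simp
    rw [this, Polynomial.map_id]
    simp
  have hle := le_natDegree_leadingCoeff hind h hR0 hker
  have hlt : R.leadingCoeff.natDegree < n := by
    have hn : 0 < n := j₀.pos
    rw [leadingCoeff, hcoeff]
    refine Nat.lt_of_le_pred hn (natDegree_sum_le_of_forall_le _ _ fun j _ => ?_)
    exact (natDegree_C_mul_X_pow_le _ _).trans (Nat.le_pred_of_lt j.2)
  omega

end Exponents

/-! ### Kernel functions and symbols -/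

section Kernel

variable {n m : ℕ}

theorem eventually_eval_ne_zero {p : ℂ[X]} (hp : p ≠ 0) :
    ∀ᶠ x : ℝ in atTop, p.eval (x : ℂ) ≠ 0 := by
  have hfin : {x : ℝ | p.eval (x : ℂ) = 0}.Finite := by
    have h1 : (p.roots.toFinset : Set ℂ).Finite := Finset.finite_toSet _
    refine (h1.preimage (f := fun x : ℝ => (x : ℂ)) Complex.ofReal_injective.injOn).subset ?_
    intro x hx
    simp only [Set.mem_preimage, Finset.mem_coe, Multiset.mem_toFinset]
    exact (mem_roots hp).2 hx
  obtain ⟨B, hB⟩ := hfin.bddAbove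
  filter_upwards [eventually_gt_atTop B] with x hx h
  exact absurd (hB h) (not_le.2 hx)

theorem eq_zero_of_eventually_eval {p : ℂ[X]} (h : ∀ᶠ x : ℝ in atTop, p.eval (x : ℂ) = 0) :
    p = 0 := by
  by_contra hp
  obtain ⟨x, hx, hx'⟩ := (h.and (eventually_eval_ne_zero hp)).exists
  exact hx' hx

theorem eventually_eval_mul {r : K} {b p : ℂ[X]} (h : polyX b * r = polyX p) :
    ∀ᶠ x : ℝ in atTop, b.eval (x : ℂ) * r.eval (RingHom.id ℂ) (x : ℂ) = p.eval (x : ℂ) := by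
  have h1 : b * r.num = p * r.denom := by
    apply polyX_injective
    have hd : algebraMap ℂ[X] K r.denom ≠ 0 := RatFunc.algebraMap_ne_zero r.denom_ne_zero
    have h2 := r.num_div_denom
    rw [div_eq_iff hd] at h2
    rw [polyX_mul, polyX_mul, ← h]
    simp only [polyX]
    rw [h2]
    ring
  filter_upwards [eventually_eval_ne_zero r.denom_ne_zero] with x hx
  rw [RatFunc.eval, eval₂_id, eval₂_id, ← mul_div_assoc, div_eq_iff hx, ← eval_mul, h1, eval_mul]

theorem iteratedDeriv_kerFun (γ : Fin m → ℂ) (a : Fin m → ℂ) (j : ℕ) {x : ℝ} (hx : 0 < x) :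
    iteratedDeriv j (fun x : ℝ => ∑ i, a i * (x : ℂ) ^ γ i) x =
      ∑ i, a i * (descPochhammer ℂ j).eval (γ i) * (x : ℂ) ^ (γ i - j) := by
  induction j generalizing x with
  | zero => simp
  | succ j ih =>
    rw [iteratedDeriv_succ]
    have h1 : iteratedDeriv j (fun x : ℝ => ∑ i, a i * (x : ℂ) ^ γ i) =ᶠ[nhds x]
        fun x : ℝ => ∑ i, a i * (descPochhammer ℂ j).eval (γ i) * (x : ℂ) ^ (γ i - j) := by
      filter_upwards [lt_mem_nhds hx] with y hy
      exact ih hy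
    rw [h1.deriv_eq]
    have h2 : ∀ i, HasDerivAt (fun x : ℝ => a i * (descPochhammer ℂ j).eval (γ i) *
        (x : ℂ) ^ (γ i - j)) (a i * (descPochhammer ℂ j).eval (γ i) *
          ((γ i - j) * (x : ℂ) ^ (γ i - j - 1) * 1)) x := by
      intro i
      have h3 : HasDerivAt (fun z : ℂ => z ^ (γ i - j)) ((γ i - j) * (x : ℂ) ^ (γ i - j - 1) * 1)
          (x : ℂ) := (hasDerivAt_id (x : ℂ)).cpow_const (Complex.ofReal_mem_slitPlane.2 hx)
      exact (h3.comp_ofReal).const_mul _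
    rw [(HasDerivAt.fun_sum fun i _ => h2 i).deriv]
    refine Finset.sum_congr rfl fun i _ => ?_
    rw [descPochhammer_succ_right, eval_mul, eval_sub, eval_X, eval_natCast]
    push_cast
    rw [sub_add_eq_sub_sub]
    ring

theorem euler_pow_descPochhammer (j : ℕ) :
    aeval euler (descPochhammer ℂ j) = mulX (RatFunc.X ^ j) * ddx ^ j := by
  have hX : (RatFunc.X : K) ^ j ≠ 0 := pow_ne_zero _ RatFunc.X_ne_zero
  have h : ddx ^ j = mulX (RatFunc.X ^ j)⁻¹ * aeval euler (descPochhammer ℂ j) := by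
    clear hX
    induction j with
    | zero =>
      rw [pow_zero, pow_zero, inv_one, descPochhammer_zero, map_one, mul_one]
      exact (map_one mulXHom).symm
    | succ j ih =>
      have h1 : ddx = mulX (RatFunc.X ^ 1)⁻¹ * aeval euler (X : ℂ[X]) := by
        have hX : (RatFunc.X : K) ≠ 0 := RatFunc.X_ne_zero
        rw [aeval_X, euler, ← mul_assoc, ← mulXHom_apply, ← mulXHom_apply, ← map_mul, pow_one,
          inv_mul_cancel₀ hX, map_one, one_mul]
      rw [pow_succ', ih]
      conv_lhs => rw [h1]
      rw [mul_assoc, ← mul_assoc (aeval euler _),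
        aeval_euler_mul_inv_X_pow, X_comp, mul_assoc, ← map_mul, ← mul_assoc, ← mulXHom_apply,
        ← mulXHom_apply, ← map_mul, ← mul_inv, ← pow_add, descPochhammer_succ_right, add_comm 1 j,
        map_natCast, mul_comm (descPochhammer ℂ j)]
      rfl
  rw [h, ← mul_assoc, ← mulXHom_apply, ← mulXHom_apply, ← map_mul, mul_inv_cancel₀ hX, map_one,
    one_mul]

/-- The symbol with respect to the Euler operator of `x ^ n ∑ j ≤ n, q_j ∂ ^ j`. -/
def eulerSymbol (n : ℕ) (q : K[X]) : K[X] :=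
  ∑ j ∈ Finset.range (n + 1), C (q.coeff j * RatFunc.X ^ (n - j)) *
    (descPochhammer ℂ j).map (algebraMap ℂ K)

theorem leftOp_eulerSymbol {q : K[X]} (hq : q.natDegree ≤ n) :
    leftOp mulXHom euler (eulerSymbol n q) = mulX (RatFunc.X ^ n) * leftOp mulXHom ddx q := by
  rw [leftOp_eq_sum_of_lt mulXHom ddx (Nat.lt_succ_of_le hq), Finset.mul_sum, eulerSymbol,
    leftOp_sum]
  refine Finset.sum_congr rfl fun j hj => ?_
  rw [leftOp_C_mul, leftOp_map, euler_pow_descPochhammer, ← mul_assoc, ← mul_assoc,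
    ← mulXHom_apply, ← mulXHom_apply, ← map_mul, ← map_mul, mul_assoc, ← pow_add,
    Nat.sub_add_cancel (by simpa [Nat.lt_succ_iff] using hj), mul_comm (q.coeff j)]

theorem eulerSymbol_natDegree_le (q : K[X]) : (eulerSymbol n q).natDegree ≤ n := by
  refine natDegree_sum_le_of_forall_le _ _ fun j hj => ?_
  refine (natDegree_C_mul_le _ _).trans (natDegree_map_le.trans ?_)
  rw [descPochhammer_natDegree]
  simpa [Nat.lt_succ_iff] using hj

theorem eulerSymbol_coeff (q : K[X]) : (eulerSymbol n q).coeff n = q.coeff n := by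
  rw [eulerSymbol, finsetSum_coeff, Finset.sum_range_succ, Finset.sum_eq_zero, zero_add,
    coeff_C_mul, coeff_map]
  · have h : (descPochhammer ℂ n).coeff n = 1 := by
      have := monic_descPochhammer ℂ n
      rwa [Monic, leadingCoeff, descPochhammer_natDegree] at this
    rw [h, map_one, mul_one, Nat.sub_self, pow_zero, mul_one]
  · intro j hj
    have h : (descPochhammer ℂ j).coeff n = 0 := coeff_eq_zero_of_natDegree_lt (by
      rw [descPochhammer_natDegree]; exact Finset.mem_range.1 hj)
    rw [coeff_C_mul, coeff_map, h, map_zero, mul_zero]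

theorem appFun_leftOp {q : K[X]} (hq : q.natDegree ≤ n) (φ : ℝ → ℂ) (x : ℝ) :
    (leftOp mulXHom ddx q).appFun φ x = ∑ j ∈ Finset.range (n + 1),
      (q.coeff j).eval (RingHom.id ℂ) (x : ℂ) * iteratedDeriv j φ x := by
  rw [DiffOp.appFun, finsum_eq_sum_of_support_subset (s := Finset.range (n + 1))]
  · exact Finset.sum_congr rfl fun j _ => by rw [DiffOp.coeff_leftOp]
  · intro j hj
    rw [Function.mem_support] at hj
    by_contra h
    apply hj
    rw [DiffOp.coeff_leftOp, coeff_eq_zero_of_natDegree_lt, RatFunc.eval_zero, zero_mul]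
    have : ¬ j < n + 1 := by simpa using h
    omega

/-- Multiplying `P f_k = 0` by `x ^ n`, by `x ^ (-b k)` and by a common denominator gives a
polynomial that vanishes at all large real `x`, hence identically. This converts the analytic kernel
condition into algebra over `ℂ(x)`. -/
theorem rowEval_eulerSymbol {N : ℕ} {γ : Fin m → ℂ} {A : Matrix (Fin n) (Fin m) ℂ} {b : Fin n → ℂ}
    {e : Fin n → Fin m → ℕ} (h : ∀ k i, A k i ≠ 0 → γ i = b k + e k i ∧ N ∣ e k i)
    {q : K[X]} (hq : q.natDegree ≤ n) (k : Fin n)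
    (hker : ∀ᶠ x : ℝ in atTop, (leftOp mulXHom ddx q).appFun (kerFun γ A k) x = 0) :
    rowEval γ (ratMat A e) k (eulerSymbol n q) = 0 := by
  obtain ⟨d, hd, p, hp⟩ := exists_common_denominator (Finset.range (n + 1)) q.coeff
  set G : ℂ[X] := ∑ i, C (A k i) * X ^ e k i * ∑ j ∈ Finset.range (n + 1),
    p j * X ^ (n - j) * C ((descPochhammer ℂ j).eval (γ i)) with hG
  have hG0 : G = 0 := by
    apply eq_zero_of_eventually_eval
    have hev : ∀ᶠ x : ℝ in atTop, ∀ j ∈ Finset.range (n + 1),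
        d.eval (x : ℂ) * (q.coeff j).eval (RingHom.id ℂ) (x : ℂ) = (p j).eval (x : ℂ) :=
      (Filter.eventually_all_finset _).2 fun j hj => eventually_eval_mul (hp j hj)
    filter_upwards [hker, hev, eventually_gt_atTop 0] with x hx hx1 hx0
    have hxc : (x : ℂ) ≠ 0 := by exact_mod_cast hx0.ne'
    rw [appFun_leftOp hq] at hx
    have h1 : G.eval (x : ℂ) = d.eval (x : ℂ) * (x : ℂ) ^ n * (x : ℂ) ^ (-b k) *
        ∑ j ∈ Finset.range (n + 1),
          (q.coeff j).eval (RingHom.id ℂ) (x : ℂ) * iteratedDeriv j (kerFun γ A k) x := by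
      rw [hG, eval_finsetSum, Finset.mul_sum]
      have h2 : ∀ j ∈ Finset.range (n + 1), d.eval (x : ℂ) * (x : ℂ) ^ n * (x : ℂ) ^ (-b k) *
          ((q.coeff j).eval (RingHom.id ℂ) (x : ℂ) * iteratedDeriv j (kerFun γ A k) x) =
          ∑ i, A k i * (x : ℂ) ^ e k i * ((p j).eval (x : ℂ) * (x : ℂ) ^ (n - j) *
            (descPochhammer ℂ j).eval (γ i)) := by
        intro j hj
        rw [← hx1 j hj]
        have h3 := iteratedDeriv_kerFun γ (A k) j hx0
        have h4 : iteratedDeriv j (kerFun γ A k) x =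
          ∑ i, A k i * (descPochhammer ℂ j).eval (γ i) * (x : ℂ) ^ (γ i - j) := h3
        rw [h4, Finset.mul_sum, Finset.mul_sum]
        refine Finset.sum_congr rfl fun i _ => ?_
        by_cases hi : A k i = 0
        · rw [hi]; ring
        · have h5 : (x : ℂ) ^ n * (x : ℂ) ^ (-b k) * (x : ℂ) ^ (γ i - j) =
              (x : ℂ) ^ e k i * (x : ℂ) ^ (n - j) := by
            have hj' : j ≤ n := by simpa [Nat.lt_succ_iff] using hj
            rw [← Complex.cpow_natCast _ n, ← Complex.cpow_natCast _ (e k i),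
              ← Complex.cpow_natCast _ (n - j), ← Complex.cpow_add _ _ hxc,
              ← Complex.cpow_add _ _ hxc, ← Complex.cpow_add _ _ hxc, (h k i hi).1,
              Nat.cast_sub hj']
            congr 1
            ring
          linear_combination (d.eval (x : ℂ) * (q.coeff j).eval (RingHom.id ℂ) (x : ℂ) * A k i *
            (descPochhammer ℂ j).eval (γ i)) * h5
      rw [Finset.sum_congr rfl h2, Finset.sum_comm]
      refine Finset.sum_congr rfl fun i _ => ?_
      rw [eval_mul, eval_mul, eval_pow, eval_C, eval_X, eval_finsetSum, Finset.mul_sum]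
      refine Finset.sum_congr rfl fun j _ => ?_
      rw [eval_mul, eval_mul, eval_pow, eval_C, eval_X]
    rw [h1, hx, mul_zero]
  have hd' : polyX d ≠ 0 := RatFunc.algebraMap_ne_zero hd
  apply mul_left_cancel₀ hd'
  rw [mul_zero, rowEval_apply, Finset.mul_sum]
  have h6 : polyX G = 0 := by rw [hG0]; exact map_zero (algebraMap ℂ[X] K)
  rw [← h6, hG, polyX_sum]
  refine Finset.sum_congr rfl fun i _ => ?_
  rw [polyX_mul, polyX_sum, mul_left_comm]
  congr 1
  rw [eulerSymbol, eval_finsetSum, Finset.mul_sum]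
  refine Finset.sum_congr rfl fun j hj => ?_
  rw [eval_mul, eval_C, eval_map_algebraMap, ← mul_assoc, ← mul_assoc, hp j hj, polyX_mul,
    polyX_mul, polyX_X_pow, polyX_C', aeval_algebraMap_apply, coe_aeval_eq_eval]

/-- Order `n` and leading coefficient `1` are read off from `z ^ n Ψ_W = P Ψ_β`, as both wave
functions start with `1`. -/
theorem symbol_of_darboux {N N' : ℕ} {β : Fin N → ℂ} {γ : Fin m → ℂ}
    {A : Matrix (Fin n) (Fin m) ℂ} {b : Fin n → ℂ} {e : Fin n → Fin m → ℕ}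
    (h : ∀ k i, A k i ≠ 0 → γ i = b k + e k i ∧ N' ∣ e k i) {g : ℂ[X]} {P : DiffOp} {ΨW : M}
    (hW : IsMonomialDarboux β (kerFun γ A) g P ΨW) (hΨ0 : (besselWave β).coeff 0 = 1)
    (hΨ : ∀ k < 0, (besselWave β).coeff k = 0) :
    ∃ p : K[X], p.Monic ∧ p.natDegree = n ∧ (∀ k, rowEval γ (ratMat A e) k p = 0) ∧
      P = mulX (RatFunc.X ^ n)⁻¹ * leftOp mulXHom euler p := by
  obtain ⟨q, hP⟩ := P.exists_leftOp
  have hz : ∀ k, (P.app (besselWave β)).coeff k = ΨW.coeff (k + n) := by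
    intro k
    rw [← hW.darboux, hW.monomial, polyZ_X_pow, M.coeff_zM_pow_mul]
  have hlead := leftOp_app_coeff q hΨ
  rw [← hP, hΨ0, mul_one] at hlead
  have hq0 : q ≠ 0 := by
    intro h0
    have h1 := hz (-n)
    rw [neg_add_cancel, hW.wave.1, hP, h0] at h1
    have h2 : leftOp mulXHom ddx (0 : K[X]) = 0 := by simp [leftOp]
    rw [h2] at h1
    exact zero_ne_one h1
  have hdeg : q.natDegree = n := by
    apply le_antisymm
    · by_contra hlt
      have h1 := hlead.1
      rw [hz, hW.wave.2 _ (by omega), eq_comm, leadingCoeff_eq_zero] at h1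
      exact hq0 h1
    · by_contra hlt
      have h1 := hlead.2 (-n) (by omega)
      rw [hz, neg_add_cancel, hW.wave.1] at h1
      exact one_ne_zero h1
  have hmonic : q.coeff n = 1 := by
    have h1 := hlead.1
    rw [hz, hdeg, zero_sub, neg_add_cancel, hW.wave.1, leadingCoeff, hdeg] at h1
    exact h1.symm
  have hpc : (eulerSymbol n q).coeff n = 1 := by rw [eulerSymbol_coeff, hmonic]
  refine ⟨eulerSymbol n q, monic_of_natDegree_le_of_coeff_eq_one n (eulerSymbol_natDegree_le q) hpc,
    natDegree_eq_of_le_of_coeff_ne_zero (eulerSymbol_natDegree_le q) (by rw [hpc]; exact one_ne_zero),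
    fun k => ?_, ?_⟩
  · refine rowEval_eulerSymbol h hdeg.le k ?_
    have hk : InKer P (kerFun γ A k) := (hW.ker.2 _).2
      ⟨Pi.single k 1, Filter.Eventually.of_forall fun x => by
        rw [Finset.sum_eq_single k (fun i _ hi => by rw [Pi.single_eq_of_ne hi, zero_mul]) (by simp),
          Pi.single_eq_same, one_mul]⟩
    rw [← hP]
    exact hk.2
  · have hX : (RatFunc.X : K) ^ n ≠ 0 := pow_ne_zero _ RatFunc.X_ne_zero
    rw [leftOp_eulerSymbol hdeg.le, ← hP, ← mul_assoc, ← mulXHom_apply, ← mulXHom_apply, ← map_mul,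
      inv_mul_cancel₀ hX, map_one, one_mul]

end Kernel

/-! ### The operators `P` and `Q` -/

section Combinatorics

variable {n m : ℕ}

/-- The coefficient `det A^I Δ_I`. -/
def wt (γ : Fin m → ℂ) (A : Matrix (Fin n) (Fin m) ℂ) (I : Finset (Fin m)) : ℂ :=
  minor A I * vdm γ I

/-- `κ` is the power of `x` in the minor on `J`. Minimality of `J` bounds the powers in the other
nonzero minors below by `κ`, so the floor in `pExp` is taken of a natural number. -/
theorem pExp_spec {N : ℕ} {γ : Fin m → ℂ} {A : Matrix (Fin n) (Fin m) ℂ} {b : Fin n → ℂ}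
    {e : Fin n → Fin m → ℕ} (h : ∀ k i, A k i ≠ 0 → γ i = b k + e k i ∧ N ∣ e k i)
    {J : Finset (Fin m)} (hJ : IsMinimalSet γ A J) :
    ∃ κ : ℕ, ∀ I ∈ subsets n m,
      (minor A I ≠ 0 →
        ((pExp γ J I : ℕ) : ℂ) = ∑ i ∈ I, γ i - ∑ i ∈ J, γ i ∧ N ∣ pExp γ J I) ∧
      colMinor (monMat A e) I = X ^ κ * (C (minor A I) * X ^ pExp γ J I) := by
  obtain ⟨κ, -, hκ⟩ := colMinor_monMat h (card_of_mem_subsets hJ.1)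
  refine ⟨κ, fun I hI => ?_⟩
  obtain ⟨q, hq, hq'⟩ := colMinor_monMat h (card_of_mem_subsets hI)
  by_cases h0 : minor A I = 0
  · exact ⟨fun hne => absurd h0 hne, by rw [hq, h0]; simp⟩
  · obtain ⟨h1, h2⟩ := hκ hJ.2.1
    obtain ⟨h3, h4⟩ := hq' h0
    have hdiff : ∑ i ∈ I, γ i - ∑ i ∈ J, γ i = (q : ℂ) - κ := by rw [h1, h3]; ring
    have hre := congrArg Complex.re hdiff
    rw [Complex.sub_re, Complex.sub_re, Complex.natCast_re, Complex.natCast_re] at hre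
    have hle : κ ≤ q := by
      have : (κ : ℝ) ≤ q := by linarith [hJ.2.2 I hI h0]
      exact_mod_cast this
    have hp : pExp γ J I = q - κ := by
      rw [pExp, hdiff, Complex.sub_re, Complex.natCast_re, Complex.natCast_re, ← Nat.cast_sub hle,
        Nat.floor_natCast]
    refine ⟨fun _ => ⟨?_, ?_⟩, ?_⟩
    · rw [hp, hdiff, Nat.cast_sub hle]
    · rw [hp]; exact Nat.dvd_sub h4 h2
    · rw [hq, hp, mul_left_comm, ← pow_add, Nat.add_sub_cancel' hle]

theorem exists_isMinimalSet {γ : Fin m → ℂ} {A : Matrix (Fin n) (Fin m) ℂ}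
    (h : ∃ I ∈ subsets n m, minor A I ≠ 0) : ∃ J, IsMinimalSet γ A J := by
  obtain ⟨I, hI, h0⟩ := h
  obtain ⟨J, hJ, hmin⟩ := Finset.exists_min_image ((subsets n m).filter fun I => minor A I ≠ 0)
    (fun I => (∑ i ∈ I, γ i).re) ⟨I, Finset.mem_filter.2 ⟨hI, h0⟩⟩
  rw [Finset.mem_filter] at hJ
  exact ⟨J, hJ.1, hJ.2, fun I hI h0 => hmin I (Finset.mem_filter.2 ⟨hI, h0⟩)⟩

/-- The weighted sum `∑ I, det A^I Δ_I x ^ p_I π_I(s)` as a polynomial in `s`. -/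
def wtSymbol (γ : Fin m → ℂ) (A : Matrix (Fin n) (Fin m) ℂ) (J : Finset (Fin m))
    (π : Finset (Fin m) → ℂ[X]) : K[X] :=
  ∑ I ∈ subsets n m, C (polyX (C (wt γ A I) * X ^ pExp γ J I)) * (π I).map (algebraMap ℂ K)

theorem theta_eq (γ : Fin m → ℂ) (A : Matrix (Fin n) (Fin m) ℂ) (J : Finset (Fin m)) :
    theta γ A J = ∑ I ∈ subsets n m, C (wt γ A I) * X ^ pExp γ J I := rfl

section Data

variable {N : ℕ} {γ : Fin m → ℂ} {A : Matrix (Fin n) (Fin m) ℂ}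
  {e : Fin n → Fin m → ℕ} {J : Finset (Fin m)} {κ : ℕ}

theorem wtSymbol_of_colMinor
    (hκ : ∀ I ∈ subsets n m, colMinor (monMat A e) I = X ^ κ * (C (minor A I) * X ^ pExp γ J I))
    (π : Finset (Fin m) → ℂ[X]) :
    ∑ I ∈ subsets n m, C (colMinor (ratMat A e) I * algebraMap ℂ K (vdm γ I)) *
      (π I).map (algebraMap ℂ K) = C (RatFunc.X ^ κ) * wtSymbol γ A J π := by
  rw [wtSymbol, Finset.mul_sum]
  refine Finset.sum_congr rfl fun I hI => ?_
  rw [← mul_assoc, ← map_mul, colMinor_ratMat, hκ I hI, wt]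
  simp only [polyX_mul, polyX_X_pow, polyX_C', map_mul]
  ring

theorem X_pow_mul_theta
    (hκ : ∀ I ∈ subsets n m, colMinor (monMat A e) I = X ^ κ * (C (minor A I) * X ^ pExp γ J I)) :
    RatFunc.X ^ κ * polyX (theta γ A J) =
      algebraMap ℂ K (vdmSign n) * (wronskian γ (ratMat A e)).det := by
  rw [← det_wronskian, theta_eq, polyX_sum, Finset.mul_sum]
  refine Finset.sum_congr rfl fun I hI => ?_
  rw [colMinor_ratMat, hκ I hI, wt]
  simp only [polyX_mul, polyX_X_pow, polyX_C', map_mul]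
  ring

theorem theta_ne_zero
    (hκ : ∀ I ∈ subsets n m, colMinor (monMat A e) I = X ^ κ * (C (minor A I) * X ^ pExp γ J I))
    (hW : (wronskian γ (ratMat A e)).det ≠ 0) : theta γ A J ≠ 0 := by
  intro h0
  have h1 := X_pow_mul_theta hκ
  rw [h0, polyX, map_zero, mul_zero, eq_comm, mul_eq_zero, or_iff_left hW, map_eq_zero] at h1
  exact vdmSign_ne_zero n h1

/-- After multiplication by `x ^ κ` both sides kill all rows and have the same coefficient in degree
`n`, so their difference has degree below `n` and is zero. -/
theorem wtSymbol_ker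
    (hκ : ∀ I ∈ subsets n m, colMinor (monMat A e) I = X ^ κ * (C (minor A I) * X ^ pExp γ J I))
    (hW : (wronskian γ (ratMat A e)).det ≠ 0) {p : K[X]} (hp : p.Monic) (hpd : p.natDegree = n)
    (hpk : ∀ k, rowEval γ (ratMat A e) k p = 0) :
    wtSymbol γ A J (linProd γ) = C (polyX (theta γ A J)) * p := by
  have hX : (C (RatFunc.X ^ κ) : K[X]) ≠ 0 := C_ne_zero.2 (pow_ne_zero _ RatFunc.X_ne_zero)
  apply mul_left_cancel₀ hX
  rw [← wtSymbol_of_colMinor hκ, ← mul_assoc, ← map_mul, X_pow_mul_theta hκ, ← sub_eq_zero]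
  refine eq_zero_of_rowEval_eq_zero hW ?_ fun k => ?_
  · rw [degree_lt_iff_coeff_zero]
    intro j hj
    change (kerSymbol γ (ratMat A e) - _).coeff j = 0
    have hj' : n ≤ j := by exact_mod_cast hj
    rw [coeff_sub, coeff_C_mul]
    rcases hj'.eq_or_lt with rfl | hlt
    · have : p.coeff n = 1 := by rw [← hpd]; exact hp
      rw [kerSymbol_coeff_card, this, mul_one, sub_self]
    · rw [coeff_eq_zero_of_natDegree_lt ((kerSymbol_natDegree_le _ _).trans_lt hlt),
        coeff_eq_zero_of_natDegree_lt (by omega), mul_zero, sub_zero]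
  · rw [map_sub, ← smul_eq_C_mul, map_smul, hpk, smul_zero, sub_zero]
    exact rowEval_kerSymbol hW k

theorem rightOp_wtSymbol_mul_leftOp {b : Fin n → ℂ}
    (h : ∀ k i, A k i ≠ 0 → γ i = b k + e k i ∧ N ∣ e k i)
    (hκ : ∀ I ∈ subsets n m, colMinor (monMat A e) I = X ^ κ * (C (minor A I) * X ^ pExp γ J I))
    (hW : (wronskian γ (ratMat A e)).det ≠ 0) {p : K[X]} (hp : p.Monic) (hpd : p.natDegree = n)
    (hpk : ∀ k, rowEval γ (ratMat A e) k p = 0) :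
    rightOp mulXHom euler (wtSymbol γ A J fun I => linProd γ Iᶜ) *
        mulX (polyX (theta γ A J))⁻¹ * leftOp mulXHom euler p =
      aeval euler (linProd γ Finset.univ) := by
  have hθ : polyX (theta γ A J) ≠ 0 := RatFunc.algebraMap_ne_zero (theta_ne_zero hκ hW)
  -- For `n = 0` there is no last column to expand along, and the left factor is the whole product.
  rcases Nat.eq_zero_or_pos n with hn | hn
  · subst hn
    have hp1 : p = 1 := hp.natDegree_eq_zero.1 hpd
    have hs : subsets 0 m = {∅} := by simp [subsets]
    have h1 : wtSymbol γ A J (fun I => linProd γ Iᶜ) =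
        C (polyX (theta γ A J)) * (linProd γ Finset.univ).map (algebraMap ℂ K) := by
      rw [wtSymbol, theta_eq, hs, Finset.sum_singleton, Finset.sum_singleton, Finset.compl_empty]
    have h2 : leftOp mulXHom euler (1 : K[X]) = 1 := by simp [leftOp]
    rw [h1, hp1, h2, mul_one, rightOp_C_mul, rightOp_map, ← mulXHom_apply, mul_assoc, ← map_mul,
      mul_inv_cancel₀ hθ, map_one, mul_one]
  · let j₀ : Fin n := ⟨n - 1, by omega⟩
    have hj₀ : (j₀ : ℕ) + 1 = n := by simp only [j₀]; omega
    have hX : (C (RatFunc.X ^ κ) : K[X]) ≠ 0 := C_ne_zero.2 (pow_ne_zero _ RatFunc.X_ne_zero)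
    have h1 : wtSymbol γ A J (fun I => linProd γ Iᶜ) = C (polyX (theta γ A J)) *
        ∑ r, C ((wronskian γ (ratMat A e))⁻¹ j₀ r) *
          ∑ i, C (ratMat A e r i) * (linProd γ (Finset.univ.erase i)).map (algebraMap ℂ K) := by
      apply mul_left_cancel₀ hX
      rw [← wtSymbol_of_colMinor hκ, ← mul_assoc, ← map_mul, X_pow_mul_theta hκ]
      refine (cokerSymbol_eq γ (ratMat A e) j₀ hj₀).trans ?_
      rw [map_mul, mul_assoc, Finset.mul_sum (a := C (wronskian γ (ratMat A e)).det)]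
      congr 1
      refine Finset.sum_congr rfl fun r _ => ?_
      rw [← mul_assoc, ← map_mul, Matrix.inv_def, Matrix.smul_apply, smul_eq_mul, ← mul_assoc,
        Ring.mul_inverse_cancel _ (isUnit_iff_ne_zero.2 hW), one_mul]
    have h2 : mulXHom (polyX (theta γ A J)) * mulX (polyX (theta γ A J))⁻¹ = 1 := by
      rw [← mulXHom_apply, ← map_mul, mul_inv_cancel₀ hθ, map_one]
    rw [h1, rightOp_C_mul, mul_assoc _ (mulXHom _), h2, mul_one]
    have hA := eulerDer_ratMat h
    have hD : ∀ r, euler * mulXHom r = mulXHom r * euler + mulXHom (eulerDer r) := euler_mul_mulX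
    have key := rightOp_mul_leftOp (F := K) (E := DiffOp) (μ := mulXHom) (D := euler)
      (δ := eulerDer) (γ := γ) (b := b) (A := ratMat A e)
    have key := key hD
    exact key hA hW hp hpd hpk j₀ hj₀

/-! ### Behaviour at infinity -/

/-- The operator `R = ∑ det A^I Δ_I x ^ p_I ∏_{i ∈ I} (D - γ_i)` kills the rows, so its coefficient
at the highest power of `x` has degree at least `n` in `D`, hence exactly `n`. The coefficient of `D
^ n` in `R` is `θ`, so no power of `x` in `R` exceeds the degree of `θ`. The functional `ℓ` later
records how a symbol acts on the Bessel coefficients. -/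
theorem natDegree_wt_sum_le {b : Fin n → ℂ} (hind : RowsIndependent γ A)
    (h : ∀ k i, A k i ≠ 0 → γ i = b k + e k i ∧ N ∣ e k i)
    (hκ : ∀ I ∈ subsets n m, colMinor (monMat A e) I = X ^ κ * (C (minor A I) * X ^ pExp γ J I))
    (hW : (wronskian γ (ratMat A e)).det ≠ 0) (ℓ : ℂ[X] →ₗ[ℂ] ℂ) :
    (∑ I ∈ subsets n m, C (wt γ A I * ℓ (linProd γ I)) * X ^ pExp γ J I).natDegree ≤
      (theta γ A J).natDegree := by
  classical
  set R : (ℂ[X])[X] := ∑ I ∈ subsets n m, C (C (wt γ A I) * linProd γ I) * X ^ pExp γ J I with hR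
  have hRc : ∀ t, R.coeff t =
      ∑ I ∈ subsets n m, if t = pExp γ J I then C (wt γ A I) * linProd γ I else 0 := by
    intro t
    rw [hR, finsetSum_coeff]
    exact Finset.sum_congr rfl fun I _ => by rw [coeff_C_mul_X_pow]
  have hθc : ∀ t, (R.coeff t).coeff n = (theta γ A J).coeff t := by
    intro t
    rw [hRc, theta_eq, finsetSum_coeff, finsetSum_coeff]
    refine Finset.sum_congr rfl fun I hI => ?_
    rw [coeff_C_mul_X_pow]
    split_ifs
    · have h1 := linProd_coeff_card γ I
      rw [card_of_mem_subsets hI] at h1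
      rw [coeff_C_mul, h1, mul_one]
    · rw [coeff_zero]
  have hθ := theta_ne_zero hκ hW
  have hR0 : R ≠ 0 := by
    intro h0
    apply hθ
    ext t
    rw [← hθc, h0, coeff_zero, coeff_zero, coeff_zero]
  have hker : ∀ k, ∑ i, monMat A e k i * R.map (evalRingHom (γ i)) = 0 := by
    intro k
    apply polyX_injective
    have hX : (RatFunc.X ^ κ : K) ≠ 0 := pow_ne_zero _ RatFunc.X_ne_zero
    apply mul_left_cancel₀ hX
    have h1 := rowEval_kerSymbol hW k
    have h2 : kerSymbol γ (ratMat A e) = C (RatFunc.X ^ κ) * wtSymbol γ A J (linProd γ) :=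
      wtSymbol_of_colMinor hκ _
    rw [h2, ← smul_eq_C_mul, map_smul, smul_eq_mul] at h1
    have h3 : polyX 0 = 0 := map_zero (algebraMap ℂ[X] K)
    rw [h3, mul_zero, ← h1, rowEval_apply, polyX_sum]
    congr 1
    refine Finset.sum_congr rfl fun i _ => ?_
    rw [polyX_mul]
    congr 1
    rw [hR, Polynomial.map_sum, polyX_sum, wtSymbol, eval_finsetSum]
    refine Finset.sum_congr rfl fun I _ => ?_
    rw [Polynomial.map_mul, map_C, Polynomial.map_pow, map_X, coe_evalRingHom, eval_mul, eval_C,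
      eval_mul, eval_C, eval_map_algebraMap, aeval_algebraMap_apply, coe_aeval_eq_eval, map_mul,
      polyX_mul, polyX_mul, polyX_mul, polyX_C', polyX_C']
    ring
  have hle := le_natDegree_leadingCoeff hind h hR0 hker
  have hdeg : R.natDegree ≤ (theta γ A J).natDegree := by
    have h1 : R.leadingCoeff.natDegree ≤ n := by
      rw [leadingCoeff, hRc]
      refine natDegree_sum_le_of_forall_le _ _ fun I hI => ?_
      split_ifs
      · refine (natDegree_C_mul_le _ _).trans ?_
        rw [linProd_natDegree, card_of_mem_subsets hI]
      · simp
    have h2 : R.leadingCoeff.natDegree = n := le_antisymm h1 hle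
    refine le_natDegree_of_ne_zero ?_
    rw [← hθc]
    have h3 : R.leadingCoeff.leadingCoeff ≠ 0 :=
      leadingCoeff_ne_zero.2 (leadingCoeff_ne_zero.2 hR0)
    rwa [leadingCoeff, h2] at h3
  rw [natDegree_le_iff_coeff_eq_zero]
  intro t ht
  have h1 : ℓ (R.coeff t) = 0 := by
    rw [coeff_eq_zero_of_natDegree_lt (hdeg.trans_lt ht), map_zero]
  rw [← h1, hRc, map_sum, finsetSum_coeff]
  refine Finset.sum_congr rfl fun I _ => ?_
  rw [coeff_C_mul_X_pow]
  split_ifs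
  · rw [← smul_eq_C_mul, map_smul, smul_eq_mul]
  · rw [map_zero]

end Data

end Combinatorics

/-! ### Normal forms in `D` and `x ^ N`, and their images under the bispectral involution. -/

section Duality

variable {n m N : ℕ}

/-- The coefficient of `s ^ k` in `∑ I, det A^I Δ_I x ^ p_I π_I(s)`, as a polynomial in `x ^ N`. -/
def dualCoeff (N : ℕ) (γ : Fin m → ℂ) (A : Matrix (Fin n) (Fin m) ℂ) (J : Finset (Fin m))
    (π : Finset (Fin m) → ℂ[X]) (k : ℕ) : ℂ[X] :=
  ∑ I ∈ subsets n m, C (wt γ A I * (π I).coeff k) * X ^ (pExp γ J I / N)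

section Abstract

variable {E : Type*} [Ring E] [Algebra ℂ E]

/-- Kept abstract in `L` because it serves twice: with `L = x ^ N` for the given operators and with
`L = L_β` for their images. -/
theorem sum_pow_mul_aeval_dualCoeff (D L : E) (γ : Fin m → ℂ) (A : Matrix (Fin n) (Fin m) ℂ)
    (J : Finset (Fin m)) {π : Finset (Fin m) → ℂ[X]} {B : ℕ}
    (hπ : ∀ I ∈ subsets n m, (π I).natDegree < B) :
    ∑ k ∈ Finset.range B, D ^ k * aeval L (dualCoeff N γ A J π k) =
      ∑ I ∈ subsets n m, wt γ A I • (aeval D (π I) * L ^ (pExp γ J I / N)) := by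
  simp only [dualCoeff, map_sum, Finset.mul_sum]
  rw [Finset.sum_comm]
  refine Finset.sum_congr rfl fun I hI => ?_
  rw [aeval_eq_sum_range' (hπ I hI), Finset.sum_mul, Finset.smul_sum]
  refine Finset.sum_congr rfl fun k _ => ?_
  rw [map_mul, aeval_C, map_pow, aeval_X, ← Algebra.smul_def, mul_smul_comm, smul_mul_assoc,
    smul_smul]

theorem sum_aeval_dualCoeff_mul_pow (D L : E) (γ : Fin m → ℂ) (A : Matrix (Fin n) (Fin m) ℂ)
    (J : Finset (Fin m)) {π : Finset (Fin m) → ℂ[X]} {B : ℕ}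
    (hπ : ∀ I ∈ subsets n m, (π I).natDegree < B) :
    ∑ k ∈ Finset.range B, aeval L (dualCoeff N γ A J π k) * D ^ k =
      ∑ I ∈ subsets n m, wt γ A I • (L ^ (pExp γ J I / N) * aeval D (π I)) := by
  simp only [dualCoeff, map_sum, Finset.sum_mul]
  rw [Finset.sum_comm]
  refine Finset.sum_congr rfl fun I hI => ?_
  rw [aeval_eq_sum_range' (hπ I hI), Finset.mul_sum, Finset.smul_sum]
  refine Finset.sum_congr rfl fun k _ => ?_
  rw [map_mul, aeval_C, map_pow, aeval_X, ← Algebra.smul_def, mul_smul_comm, smul_mul_assoc,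
    smul_smul]

end Abstract

variable {γ : Fin m → ℂ} {A : Matrix (Fin n) (Fin m) ℂ} {J : Finset (Fin m)}

theorem dualCoeff_comp (hdvd : ∀ I ∈ subsets n m, minor A I ≠ 0 → N ∣ pExp γ J I)
    {π : Finset (Fin m) → ℂ[X]} {B : ℕ}
    (hπ : ∀ I ∈ subsets n m, (π I).Monic ∧ (π I).natDegree = B) :
    (dualCoeff N γ A J π B).comp (X ^ N) = theta γ A J := by
  rw [dualCoeff, theta_eq, Polynomial.sum_comp]
  refine Finset.sum_congr rfl fun I hI => ?_
  have h1 : (π I).coeff B = 1 := by rw [← (hπ I hI).2]; exact (hπ I hI).1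
  rw [h1, mul_one, mul_comp, C_comp, pow_comp, X_comp, ← pow_mul]
  by_cases h0 : minor A I = 0
  · rw [wt, h0, zero_mul, map_zero, zero_mul, zero_mul]
  · rw [Nat.mul_div_cancel' (hdvd I hI h0)]

theorem mulX_polyX_comp (N : ℕ) (q : ℂ[X]) :
    mulX (polyX (q.comp (X ^ N))) = aeval (mulX (polyX (X ^ N))) q := by
  have h1 : ∀ r, (mulXHom.comp (Algebra.ofId ℂ[X] K |>.restrictScalars ℂ)) r = mulX (polyX r) :=
    fun r => rfl
  rw [← h1, ← h1, comp_eq_aeval, aeval_algHom_apply]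

theorem mulX_polyX_pow_div {I : Finset (Fin m)} {w : ℂ} (h : w ≠ 0 → N ∣ pExp γ J I)
    (T S : DiffOp) :
    w • (T * mulX (polyX (X ^ N)) ^ (pExp γ J I / N) * S) =
      w • (T * mulX (polyX (X ^ pExp γ J I)) * S) := by
  by_cases hw : w = 0
  · rw [hw, zero_smul, zero_smul]
  · have h1 : mulX (polyX (X ^ N)) ^ (pExp γ J I / N) = mulX (polyX (X ^ pExp γ J I)) := by
      rw [← mulXHom_apply, ← map_pow, polyX_X_pow, polyX_X_pow, ← pow_mul,
        Nat.mul_div_cancel' (h hw), mulXHom_apply]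
    rw [h1]

theorem sum_pow_mul_dualCoeff (hdvd : ∀ I ∈ subsets n m, minor A I ≠ 0 → N ∣ pExp γ J I)
    {π : Finset (Fin m) → ℂ[X]} {B : ℕ} (hπ : ∀ I ∈ subsets n m, (π I).natDegree < B) :
    ∑ k ∈ Finset.range B, euler ^ k * mulX (polyX ((dualCoeff N γ A J π k).comp (X ^ N))) =
      ∑ I ∈ subsets n m, wt γ A I • (aeval euler (π I) * mulX (polyX (X ^ pExp γ J I))) := by
  simp only [mulX_polyX_comp]
  refine (sum_pow_mul_aeval_dualCoeff euler (mulX (polyX (X ^ N))) γ A J hπ).trans ?_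
  refine Finset.sum_congr rfl fun I hI => ?_
  have h := mulX_polyX_pow_div (γ := γ) (J := J) (I := I) (w := wt γ A I) (N := N)
    (fun hw => hdvd I hI fun h0 => hw (by rw [wt, h0, zero_mul])) (aeval euler (π I)) 1
  rwa [mul_one, mul_one] at h

theorem sum_dualCoeff_mul_pow (hdvd : ∀ I ∈ subsets n m, minor A I ≠ 0 → N ∣ pExp γ J I)
    {π : Finset (Fin m) → ℂ[X]} {B : ℕ} (hπ : ∀ I ∈ subsets n m, (π I).natDegree < B) :
    ∑ k ∈ Finset.range B, mulX (polyX ((dualCoeff N γ A J π k).comp (X ^ N))) * euler ^ k =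
      ∑ I ∈ subsets n m, wt γ A I • (mulX (polyX (X ^ pExp γ J I)) * aeval euler (π I)) := by
  simp only [mulX_polyX_comp]
  refine (sum_aeval_dualCoeff_mul_pow euler (mulX (polyX (X ^ N))) γ A J hπ).trans ?_
  refine Finset.sum_congr rfl fun I hI => ?_
  have h := mulX_polyX_pow_div (γ := γ) (J := J) (I := I) (w := wt γ A I) (N := N)
    (fun hw => hdvd I hI fun h0 => hw (by rw [wt, h0, zero_mul])) 1 (aeval euler (π I))
  rwa [one_mul, one_mul] at h

theorem mulXHom_polyX_C_mul (c : ℂ) (q : ℂ[X]) :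
    mulXHom (polyX (C c * q)) = c • mulX (polyX q) := by
  rw [polyX_mul, polyX_C', ← Algebra.smul_def, map_smul, mulXHom_apply]

theorem leftOp_wtSymbol (γ : Fin m → ℂ) (A : Matrix (Fin n) (Fin m) ℂ) (J : Finset (Fin m))
    (π : Finset (Fin m) → ℂ[X]) :
    leftOp mulXHom euler (wtSymbol γ A J π) =
      ∑ I ∈ subsets n m, wt γ A I • (mulX (polyX (X ^ pExp γ J I)) * aeval euler (π I)) := by
  rw [wtSymbol, leftOp_sum]
  refine Finset.sum_congr rfl fun I _ => ?_
  rw [leftOp_C_mul, leftOp_map, mulXHom_polyX_C_mul, smul_mul_assoc]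

theorem rightOp_wtSymbol (γ : Fin m → ℂ) (A : Matrix (Fin n) (Fin m) ℂ) (J : Finset (Fin m))
    (π : Finset (Fin m) → ℂ[X]) :
    rightOp mulXHom euler (wtSymbol γ A J π) =
      ∑ I ∈ subsets n m, wt γ A I • (aeval euler (π I) * mulX (polyX (X ^ pExp γ J I))) := by
  rw [wtSymbol, rightOp_sum]
  refine Finset.sum_congr rfl fun I _ => ?_
  rw [rightOp_C_mul, rightOp_map, mulXHom_polyX_C_mul, mul_smul_comm]

/-! ### Shifting complementary products -/

theorem linProd_comp_X_sub_C (δ : Fin m → ℂ) (I : Finset (Fin m)) (j : ℂ) :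
    (linProd δ I).comp (X - C j) = linProd (fun i => δ i + j) I := by
  rw [linProd, linProd, prod_comp]
  refine Finset.prod_congr rfl fun i _ => ?_
  rw [sub_comp, X_comp, C_comp, map_add, sub_sub, add_comm]

theorem mulX_mul_mulX (r s : K) : mulX r * mulX s = mulX (r * s) := (map_mul mulXHom r s).symm

theorem mulX_one : mulX 1 = 1 := map_one mulXHom

/-- The roots of the complementary products in `Q = ∑ s, D ^ s q_s(x ^ N) ⋯`. -/
def coRoots (n : ℕ) (γ : Fin m → ℂ) : Fin m → ℂ := fun i => γ i - n - (m - n : ℕ)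

theorem besselOp_compl (γ : Fin m → ℂ) {I : Finset (Fin m)} (hI : I ∈ subsets n m) :
    besselOp (fun i => γ i - n) Iᶜ =
      aeval euler (linProd (coRoots n γ) Iᶜ) * mulX (RatFunc.X ^ (m - n))⁻¹ := by
  have hc : Iᶜ.card = m - n := by
    rw [Finset.card_compl, card_of_mem_subsets hI, Fintype.card_fin]
  rw [besselOp_eq, hc, aeval_euler_mul_inv_X_pow, linProd_comp_X_sub_C]
  simp only [coRoots, sub_add_cancel]

/-- Moving `x ^ (-n)` to the left raises the roots by `n`; this is why the exponents of `Q` are `γ i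
- n`. -/
theorem besselOp_compl_mul (γ : Fin m → ℂ) {I : Finset (Fin m)} (hI : I ∈ subsets n m) :
    besselOp (fun i => γ i - n) Iᶜ * mulX (RatFunc.X ^ n)⁻¹ =
      mulX (RatFunc.X ^ m)⁻¹ * aeval euler (linProd γ Iᶜ) := by
  have hI' := card_of_mem_subsets hI
  have hle : n ≤ m := by
    rw [← hI']; simpa using Finset.card_le_univ I
  have hc : Iᶜ.card = m - n := by rw [Finset.card_compl, hI', Fintype.card_fin]
  rw [besselOp_eq, hc, mul_assoc, aeval_euler_mul_inv_X_pow, linProd_comp_X_sub_C, ← mul_assoc,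
    mulX_mul_mulX, ← mul_inv, ← pow_add, Nat.sub_add_cancel hle]
  simp only [sub_add_cancel]

end Duality

/-! ### Explicit forms of `P`, `Q`, `P_b` and `Q_b`. -/

section Operators

variable {n m N d : ℕ}

/-- The operator `Q`. -/
def inverseOp (γ : Fin m → ℂ) (A : Matrix (Fin n) (Fin m) ℂ) (J : Finset (Fin m)) : DiffOp :=
  (∑ I ∈ subsets n m, wt γ A I •
    (besselOp (fun i => γ i - n) Iᶜ * mulX (polyX (X ^ pExp γ J I)))) *
      mulX (polyX (theta γ A J))⁻¹

/-- The operator `P_b`. -/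
def dualOp (β : Fin N → ℂ) (γ : Fin m → ℂ) (A : Matrix (Fin n) (Fin m) ℂ) (J : Finset (Fin m)) :
    DiffOp :=
  ∑ I ∈ subsets n m, wt γ A I • (besselOp γ I * besselL β ^ (pExp γ J I / N))

/-- The operator `Q_b`. -/
def dualInverseOp (β : Fin N → ℂ) (γ : Fin m → ℂ) (A : Matrix (Fin n) (Fin m) ℂ)
    (J : Finset (Fin m)) : DiffOp :=
  ∑ I ∈ subsets n m, wt γ A I •
    (besselL β ^ (pExp γ J I / N) * besselOp (fun i => γ i - n) Iᶜ)

/-- The facts about a monomial Darboux transformation on which the duality rests. -/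
structure DarbouxData (d : ℕ) (β : Fin N → ℂ) (γ : Fin m → ℂ) (A : Matrix (Fin n) (Fin m) ℂ)
    (J : Finset (Fin m)) (P : DiffOp) : Prop where
  le : n ≤ m
  dvd : ∀ I ∈ subsets n m, minor A I ≠ 0 → N ∣ pExp γ J I
  theta_ne : theta γ A J ≠ 0
  left : leftOp mulXHom euler (wtSymbol γ A J (linProd γ)) =
    mulX (polyX (theta γ A J)) * (mulX (RatFunc.X ^ n) * P)
  right : rightOp mulXHom euler (wtSymbol γ A J fun I => linProd γ Iᶜ) *
    mulX (polyX (theta γ A J))⁻¹ * (mulX (RatFunc.X ^ n) * P) = aeval euler (linProd γ Finset.univ)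
  pow : besselL β ^ d = besselOp γ Finset.univ
  natDegree_le : ∀ ℓ : ℂ[X] →ₗ[ℂ] ℂ,
    (∑ I ∈ subsets n m, C (wt γ A I * ℓ (linProd γ I)) * X ^ pExp γ J I).natDegree ≤
      (theta γ A J).natDegree

theorem X_pow_ne_zero (j : ℕ) : (RatFunc.X ^ j : K) ≠ 0 := pow_ne_zero _ RatFunc.X_ne_zero

theorem linProd_spec (γ : Fin m → ℂ) {I : Finset (Fin m)} (hI : I ∈ subsets n m) :
    (linProd γ I).Monic ∧ (linProd γ I).natDegree = n :=
  ⟨linProd_monic γ I, by rw [linProd_natDegree, card_of_mem_subsets hI]⟩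

theorem linProd_compl_spec (γ : Fin m → ℂ) {I : Finset (Fin m)} (hI : I ∈ subsets n m) :
    (linProd γ Iᶜ).Monic ∧ (linProd γ Iᶜ).natDegree = m - n :=
  ⟨linProd_monic γ _, by
    rw [linProd_natDegree, Finset.card_compl, card_of_mem_subsets hI, Fintype.card_fin]⟩

theorem besselOp_of_mem_subsets (γ : Fin m → ℂ) {I : Finset (Fin m)} (hI : I ∈ subsets n m) :
    besselOp γ I = mulX (RatFunc.X ^ n)⁻¹ * aeval euler (linProd γ I) := by
  rw [besselOp_eq, card_of_mem_subsets hI]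

theorem mulX_mul_mulX_mul (r s : K) (T : DiffOp) : mulX r * (mulX s * T) = mulX (r * s) * T := by
  rw [← mul_assoc, mulX_mul_mulX]

theorem mulX_one_mul (T : DiffOp) : mulX 1 * T = T := by rw [mulX_one, one_mul]

namespace DarbouxData

variable {β : Fin N → ℂ} {γ : Fin m → ℂ} {A : Matrix (Fin n) (Fin m) ℂ} {J : Finset (Fin m)}
  {P : DiffOp}

theorem polyX_theta_ne (s : DarbouxData d β γ A J P) : polyX (theta γ A J) ≠ 0 :=
  RatFunc.algebraMap_ne_zero s.theta_ne

theorem op_eq (s : DarbouxData d β γ A J P) : P = mulX (polyX (theta γ A J))⁻¹ *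
    ∑ I ∈ subsets n m, wt γ A I • (mulX (polyX (X ^ pExp γ J I)) * besselOp γ I) := by
  have h1 : ∑ I ∈ subsets n m, wt γ A I • (mulX (polyX (X ^ pExp γ J I)) * besselOp γ I) =
      mulX (RatFunc.X ^ n)⁻¹ * leftOp mulXHom euler (wtSymbol γ A J (linProd γ)) := by
    rw [leftOp_wtSymbol, Finset.mul_sum]
    refine Finset.sum_congr rfl fun I hI => ?_
    rw [besselOp_of_mem_subsets γ hI, mulX_mul_mulX_mul, mul_smul_comm, mulX_mul_mulX_mul,
      mul_comm (polyX _)]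
  rw [h1, s.left, mulX_mul_mulX_mul, mulX_mul_mulX_mul, mulX_mul_mulX_mul]
  have h2 : (polyX (theta γ A J))⁻¹ * (RatFunc.X ^ n)⁻¹ * polyX (theta γ A J) *
      RatFunc.X ^ n = 1 := by
    have := s.polyX_theta_ne
    have := X_pow_ne_zero n
    field_simp
  rw [h2, mulX_one_mul]

theorem isDualLeft (s : DarbouxData d β γ A J P) :
    IsDualLeft β n (X ^ n) P (X ^ n * theta γ A J) (dualOp β γ A J) := by
  have hc := dualCoeff_comp s.dvd (π := linProd γ) (B := n) fun I hI => linProd_spec γ hI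
  have hlt : ∀ I ∈ subsets n m, (linProd γ I).natDegree < n + 1 := fun I hI => by
    rw [(linProd_spec γ hI).2]; exact Nat.lt_succ_self n
  refine ⟨dualCoeff N γ A J (linProd γ), ?_, ?_, ?_, ?_⟩
  · intro h0
    rw [h0, zero_comp] at hc
    exact s.theta_ne hc.symm
  · rw [hc, sum_dualCoeff_mul_pow s.dvd hlt, ← leftOp_wtSymbol, s.left, mulX_mul_mulX_mul,
      mulX_mul_mulX_mul, polyX_mul, polyX_X_pow]
    have h2 : (RatFunc.X ^ n * polyX (theta γ A J))⁻¹ * polyX (theta γ A J) *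
        RatFunc.X ^ n = 1 := by
      rw [mul_assoc, mul_comm (polyX _),
        inv_mul_cancel₀ (mul_ne_zero (X_pow_ne_zero n) s.polyX_theta_ne)]
    rw [h2, mulX_one_mul]
  · rw [sum_pow_mul_aeval_dualCoeff euler (besselL β) γ A J hlt, Finset.mul_sum, dualOp]
    refine Finset.sum_congr rfl fun I hI => ?_
    rw [besselOp_of_mem_subsets γ hI, mul_smul_comm, polyX_X_pow, mul_assoc]
  · rw [hc]

theorem inverseOp_eq (γ : Fin m → ℂ) (A : Matrix (Fin n) (Fin m) ℂ) (J : Finset (Fin m)) :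
    inverseOp γ A J =
      rightOp mulXHom euler (wtSymbol γ A J fun I => linProd (coRoots n γ) Iᶜ) *
      mulX (polyX (X ^ (m - n) * theta γ A J))⁻¹ := by
  rw [inverseOp, polyX_mul, mul_inv, ← mulX_mul_mulX, ← mul_assoc, polyX_X_pow]
  congr 1
  rw [rightOp_wtSymbol, Finset.sum_mul]
  refine Finset.sum_congr rfl fun I hI => ?_
  rw [besselOp_compl γ hI, mul_assoc, mulX_mul_mulX, smul_mul_assoc, mul_assoc, mulX_mul_mulX,
    mul_comm (polyX _)]

theorem isDualRight (s : DarbouxData d β γ A J P) :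
    IsDualRight β (m - n) (X ^ (m - n)) (inverseOp γ A J)
      (X ^ (m - n) * theta γ A J) (dualInverseOp β γ A J) := by
  have hc := dualCoeff_comp s.dvd (π := fun I => linProd (coRoots n γ) Iᶜ) (B := m - n)
    fun I hI => linProd_compl_spec _ hI
  have hlt : ∀ I ∈ subsets n m, (linProd (coRoots n γ) Iᶜ).natDegree < m - n + 1 := fun I hI => by
    rw [(linProd_compl_spec _ hI).2]; exact Nat.lt_succ_self _
  refine ⟨dualCoeff N γ A J fun I => linProd (coRoots n γ) Iᶜ, ?_, ?_, ?_, ?_⟩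
  · intro h0
    rw [h0, zero_comp] at hc
    exact s.theta_ne hc.symm
  · rw [hc, sum_pow_mul_dualCoeff s.dvd hlt, ← rightOp_wtSymbol, inverseOp_eq]
  · rw [sum_aeval_dualCoeff_mul_pow euler (besselL β) γ A J hlt, Finset.sum_mul, dualInverseOp]
    refine Finset.sum_congr rfl fun I hI => ?_
    rw [besselOp_compl γ hI, smul_mul_assoc, polyX_X_pow, mul_assoc]
  · rw [hc]

/-- Writing `P` as `x ^ (-n)` times `x ^ n P` and moving `x ^ (-n)` to the left by
`besselOp_compl_mul` leaves `x ^ (-m)` times the factorization `right`. -/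
theorem inverseOp_mul (s : DarbouxData d β γ A J P) : inverseOp γ A J * P = besselL β ^ d := by
  have h1 : (∑ I ∈ subsets n m, wt γ A I •
      (besselOp (fun i => γ i - n) Iᶜ * mulX (polyX (X ^ pExp γ J I)))) *
        mulX (RatFunc.X ^ n)⁻¹ = mulX (RatFunc.X ^ m)⁻¹ *
          rightOp mulXHom euler (wtSymbol γ A J fun I => linProd γ Iᶜ) := by
    rw [rightOp_wtSymbol, Finset.mul_sum, Finset.sum_mul]
    refine Finset.sum_congr rfl fun I hI => ?_
    rw [smul_mul_assoc, mul_smul_comm, mul_assoc, mulX_mul_mulX, mul_comm (polyX _),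
      ← mulX_mul_mulX, ← mul_assoc, besselOp_compl_mul γ hI, mul_assoc]
  have h2 : P = mulX (RatFunc.X ^ n)⁻¹ * (mulX (RatFunc.X ^ n) * P) := by
    rw [mulX_mul_mulX_mul, inv_mul_cancel₀ (X_pow_ne_zero n), mulX_one_mul]
  have h3 : inverseOp γ A J * P = mulX (RatFunc.X ^ m)⁻¹ *
      (rightOp mulXHom euler (wtSymbol γ A J fun I => linProd γ Iᶜ) *
        mulX (polyX (theta γ A J))⁻¹ * (mulX (RatFunc.X ^ n) * P)) := by
    conv_lhs => rw [h2]
    rw [inverseOp, mul_assoc, mulX_mul_mulX_mul, mul_comm _ (RatFunc.X ^ n)⁻¹, ← mulX_mul_mulX,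
      mul_assoc (mulX (RatFunc.X ^ n)⁻¹), ← mul_assoc, h1]
    simp only [mul_assoc]
  rw [h3, s.right, s.pow, besselOp_eq, Finset.card_univ, Fintype.card_fin]

end DarbouxData

end Operators

/-! ### Expansion at infinity and the exchange of `x` and `z` -/

/-- Laurent series with constant coefficients inside `ℂ(x)((z⁻¹))`. -/
def constSeries : LaurentSeries ℂ →+* LaurentSeries K where
  toFun u := HahnSeries.map u (RatFunc.C : ℂ →+* K)
  map_one' := by
    ext k
    simp only [HahnSeries.map_coeff, HahnSeries.coeff_one]
    split_ifs <;> simp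
  map_zero' := by ext k; simp
  map_add' u v := by ext k; simp
  map_mul' u v := HahnSeries.map_mul ((RatFunc.C : ℂ →+* K) : ℂ →ₙ+* K)

theorem constSeries_coeff (u : LaurentSeries ℂ) (k : ℤ) :
    (constSeries u).coeff k = RatFunc.C (u.coeff k) := rfl

theorem constSeries_C (c : ℂ) :
    constSeries (HahnSeries.C c) = HahnSeries.C (RatFunc.C c) := by
  ext k
  rw [constSeries_coeff, HahnSeries.C_apply, HahnSeries.C_apply, HahnSeries.coeff_single,
    HahnSeries.coeff_single]
  split_ifs <;> simp

theorem constSeries_single : constSeries (HahnSeries.single (-1) 1) = HahnSeries.single (-1) 1 := by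
  ext k
  rw [constSeries_coeff, HahnSeries.coeff_single, HahnSeries.coeff_single]
  split_ifs <;> simp

theorem ratZ_eq_constSeries (r : K) :
    (ratZ r : LaurentSeries K) = constSeries
      (RatFunc.eval (HahnSeries.C : ℂ →+* LaurentSeries ℂ) (HahnSeries.single (-1) 1) r) := by
  have h (p : ℂ[X]) : constSeries (p.eval₂ HahnSeries.C (HahnSeries.single (-1) 1)) =
      p.eval₂ ((HahnSeries.C : K →+* LaurentSeries K).comp RatFunc.C)
        (HahnSeries.single (-1) 1) := by
    rw [hom_eval₂, constSeries_single]
    congr 1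
    ext c : 1
    exact constSeries_C c
  rw [RatFunc.eval, map_div₀, h, h]
  rfl

/-- Expansions at `x = ∞` thereby become elements of `M`, where products with polynomials in `z` can
be computed. -/
theorem coeff_ratZ (r : K) (l : ℤ) : (ratZ r).coeff l = RatFunc.C (coeffInfty r l) :=
  congrArg (fun u : LaurentSeries K => u.coeff l) (ratZ_eq_constSeries r)

theorem C_injective {a b : ℂ} (h : (RatFunc.C a : K) = RatFunc.C b) : a = b :=
  RatFunc.C_injective h

theorem coeffInfty_zero (l : ℤ) : coeffInfty 0 l = 0 := by
  apply C_injective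
  rw [← coeff_ratZ, map_zero, ← ratZHom_apply, map_zero, M.coeff_zero]

theorem coeffInfty_add (r s : K) (l : ℤ) :
    coeffInfty (r + s) l = coeffInfty r l + coeffInfty s l := by
  apply C_injective
  rw [map_add, ← coeff_ratZ, ← coeff_ratZ, ← coeff_ratZ, ← ratZHom_apply, map_add]
  rfl

theorem coeffInfty_sum {ι : Type*} (s : Finset ι) (f : ι → K) (l : ℤ) :
    coeffInfty (∑ i ∈ s, f i) l = ∑ i ∈ s, coeffInfty (f i) l :=
  map_sum (AddMonoidHom.mk' (fun r => coeffInfty r l) fun r s => coeffInfty_add r s l) f s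

theorem coeff_zM_zpow (k l : ℤ) : (zM ^ (-k)).coeff l = if k = l then 1 else 0 := by
  obtain ⟨j, rfl | rfl⟩ := k.eq_nat_or_neg
  · have h := M.coeff_zM_pow_mul j (zM ^ (-(j : ℤ))) (l - j)
    rw [← zpow_natCast, ← zpow_add₀ zM_ne_zero, add_neg_cancel, zpow_zero, sub_add_cancel,
      M.coeff_one] at h
    rw [← h]
    congr 1
    simp only [eq_iff_iff]
    omega
  · rw [neg_neg, zpow_natCast, M.coeff_zM_pow]
    congr 1
    simp only [eq_iff_iff]
    omega

theorem coeffInfty_C_mul_zpow (c : ℂ) (k l : ℤ) :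
    coeffInfty (RatFunc.C c * RatFunc.X ^ (-k)) l = if k = l then c else 0 := by
  apply C_injective
  rw [← coeff_ratZ, ratZ_mul, ← ratZHom_apply (RatFunc.X ^ _), map_zpow₀, ratZHom_apply, ratZ_X]
  have h1 : ratZ (RatFunc.C c) = cX (RatFunc.C c) := RatFunc.eval_C _ _
  rw [h1, M.coeff_cX_mul]
  rw [coeff_zM_zpow]
  split_ifs <;> simp

/-- `Ψ(z, x)`, when every coefficient of `Ψ` is expanded at `x = ∞`. -/
def swapWave (Ψ : M) : M :=
  (HahnSeries.ofPowerSeries ℤ K (PowerSeries.mk fun l =>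
    ∑ k ∈ Finset.Icc (0 : ℤ) l, RatFunc.C (coeffInfty (Ψ.coeff k) l) * RatFunc.X ^ (-k)) :
      LaurentSeries K)

section SwapWave

variable {Ψ : M}

/-- The two vanishing conditions leave only the terms with `0 ≤ k ≤ l`, so any larger finite index
set may be used, in particular one common to several `l`. -/
theorem swapWave_coeff (hΨ : ∀ k < 0, Ψ.coeff k = 0)
    (hc : ∀ k l, l < k → coeffInfty (Ψ.coeff k) l = 0) {l : ℤ} {S : Finset ℤ}
    (hS : Finset.Icc 0 l ⊆ S) :
    (swapWave Ψ).coeff l =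
      ∑ k ∈ S, RatFunc.C (coeffInfty (Ψ.coeff k) l) * RatFunc.X ^ (-k) := by
  have h : (swapWave Ψ).coeff l = if l < 0 then 0 else
      PowerSeries.coeff l.natAbs (PowerSeries.mk fun l : ℕ =>
        ∑ k ∈ Finset.Icc (0 : ℤ) l, RatFunc.C (coeffInfty (Ψ.coeff k) l) * RatFunc.X ^ (-k)) :=
    PowerSeries.coeff_coe _ l
  have h0 : ∀ k ∉ Finset.Icc (0 : ℤ) l, coeffInfty (Ψ.coeff k) l = 0 := by
    intro k hk
    rcases lt_or_ge k 0 with h1 | h1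
    · rw [hΨ k h1, coeffInfty_zero]
    · refine hc k l (lt_of_not_ge fun h2 => hk (Finset.mem_Icc.2 ⟨h1, h2⟩))
  rw [← Finset.sum_subset hS fun k _ hk => by rw [h0 k hk, map_zero, zero_mul], h]
  split_ifs with hl
  · rw [Finset.Icc_eq_empty (not_le.2 hl), Finset.sum_empty]
  · obtain ⟨j, rfl⟩ := Int.eq_ofNat_of_zero_le (not_lt.1 hl)
    rw [PowerSeries.coeff_mk, Int.natAbs_natCast]

theorem isWave_swapWave (hΨ : IsWave Ψ)
    (hc : ∀ k l, l < k → coeffInfty (Ψ.coeff k) l = 0) : IsWave (swapWave Ψ) := by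
  constructor
  · have h1 : coeffInfty 1 0 = 1 := by
      have h := coeffInfty_C_mul_zpow 1 0 0
      rwa [map_one, neg_zero, zpow_zero, mul_one, if_pos rfl] at h
    rw [swapWave_coeff hΨ.2 hc (Finset.Subset.refl _), Finset.Icc_self, Finset.sum_singleton,
      hΨ.1, h1, neg_zero, zpow_zero, mul_one, map_one]
  · intro l hl
    rw [swapWave_coeff hΨ.2 hc (Finset.Subset.refl _), Finset.Icc_eq_empty (not_le.2 hl),
      Finset.sum_empty]

theorem isSwap_swapWave (hΨ : ∀ k < 0, Ψ.coeff k = 0)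
    (hc : ∀ k l, l < k → coeffInfty (Ψ.coeff k) l = 0) : IsSwap Ψ (swapWave Ψ) := by
  intro k l
  rw [swapWave_coeff hΨ hc (S := insert k (Finset.Icc 0 l)) (Finset.subset_insert _ _),
    coeffInfty_sum]
  simp only [coeffInfty_C_mul_zpow]
  rw [Finset.sum_ite_eq', if_pos (Finset.mem_insert_self _ _)]

end SwapWave

/-! ### Quotients of polynomials in `z` -/

theorem coeff_polyZ_eq_zero {p : ℂ[X]} {i : ℤ} (hi : i < -p.natDegree) : (polyZ p).coeff i = 0 := by
  have h := coeff_polyZ_mul (Nat.lt_succ_self p.natDegree) 1 i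
  rw [mul_one] at h
  rw [h]
  refine Finset.sum_eq_zero fun j hj => ?_
  have := Finset.mem_range.1 hj
  rw [M.coeff_one, if_neg (by omega), mul_zero]

/-- A positive power of `z` in `u` would make the product exceed the degree of `p`, hence that of
`q`. -/
theorem coeff_eq_zero_of_polyZ_mul_eq {p q : ℂ[X]} (hp : p ≠ 0) (hq : q.natDegree ≤ p.natDegree)
    {u : M} (h : polyZ p * u = polyZ q) {i : ℤ} (hi : i < 0) : u.coeff i = 0 := by
  by_cases hu : u = 0
  · rw [hu, M.coeff_zero]
  · obtain ⟨k, hk, hk'⟩ := M.exists_leading hu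
    suffices 0 ≤ k from hk' i (hi.trans_le this)
    by_contra! hk0
    have h1 := coeff_polyZ_mul (Nat.lt_succ_self p.natDegree) u (k - p.natDegree)
    rw [h, coeff_polyZ_eq_zero (by omega), Finset.sum_range_succ, Finset.sum_eq_zero, zero_add,
      sub_add_cancel, eq_comm, mul_eq_zero, or_iff_left hk, map_eq_zero] at h1
    · exact hp (leadingCoeff_eq_zero.1 h1)
    · intro j hj
      have := Finset.mem_range.1 hj
      rw [hk' _ (by omega), mul_zero]

/-! ### The wave function `Ψ_{bW}` and its expression through `P_b`. -/

section DualWave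

variable {n m N d : ℕ}

/-- The numerator of the coefficient of `z ^ (-k)` in `Ψ_W`. -/
def waveNum (γ : Fin m → ℂ) (A : Matrix (Fin n) (Fin m) ℂ) (J : Finset (Fin m)) (a : ℤ → ℂ)
    (k : ℤ) : ℂ[X] :=
  ∑ I ∈ subsets n m, C (wt γ A I * aeval eulerXi (linProd γ I) a (k - n)) * X ^ pExp γ J I

theorem besselL_pow_app {β : Fin N → ℂ} {Ψ : M} (hL : (besselL β).app Ψ = zM ^ N * Ψ) (j : ℕ) :
    (besselL β ^ j).app Ψ = polyZ (X ^ (N * j)) * Ψ := by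
  induction j with
  | zero =>
    have h : (1 : DiffOp).app Ψ = Ψ := rfl
    rw [pow_zero, h, mul_zero, pow_zero, polyZ, map_one, one_mul]
  | succ j ih =>
    rw [pow_succ, DiffOp.app_mul, hL, ← polyZ_X_pow, DiffOp.app_polyZ_mul, ih, ← mul_assoc,
      ← polyZ_mul, ← pow_add, Nat.mul_succ, add_comm]

namespace DarbouxData

variable {β : Fin N → ℂ} {γ : Fin m → ℂ} {A : Matrix (Fin n) (Fin m) ℂ} {J : Finset (Fin m)}
  {P : DiffOp} {Ψ ΨW : M} {a : ℤ → ℂ}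

theorem theta_mul_coeff (s : DarbouxData d β γ A J P) (hΨ : IsXZ Ψ a)
    (hW : zM ^ n * ΨW = P.app Ψ) (k : ℤ) :
    polyX (theta γ A J) * ΨW.coeff k = RatFunc.X ^ (-k) * polyX (waveNum γ A J a k) := by
  have h1 := congrArg (fun T => (T.app Ψ).coeff (k - n)) s.left
  simp only [DiffOp.app_mul, mulX_app, ← hW, M.coeff_cX_mul, M.coeff_zM_pow_mul, sub_add_cancel,
    leftOp_wtSymbol, DiffOp.app_sum, DiffOp.app_smul, M.coeff_sum, M.coeff_smul] at h1
  have hX : (RatFunc.X : K) ≠ 0 := RatFunc.X_ne_zero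
  apply mul_left_cancel₀ (X_pow_ne_zero n)
  rw [mul_left_comm, ← h1, waveNum, polyX_sum, Finset.mul_sum, Finset.mul_sum]
  refine Finset.sum_congr rfl fun I _ => ?_
  rw [hΨ.aeval_app (linProd γ I), polyX_mul, polyX_X_pow, polyX_C, map_mul, neg_sub,
    sub_eq_add_neg (n : ℤ) k, zpow_add₀ hX, zpow_natCast]
  ring

theorem coeff_polyZ_theta_mul (s : DarbouxData d β γ A J P) (hΨ : IsXZ Ψ a)
    (hW : zM ^ n * ΨW = P.app Ψ) (hwave : IsWave ΨW) (k l : ℤ) :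
    (polyZ (theta γ A J) * ratZ (ΨW.coeff k)).coeff l =
      (polyZ (waveNum γ A J a k)).coeff (l - k) := by
  have h1 := s.theta_mul_coeff hΨ hW k
  have hX : (RatFunc.X : K) ≠ 0 := RatFunc.X_ne_zero
  rcases lt_or_ge k 0 with hk | hk
  · rw [hwave.2 k hk, mul_zero, eq_comm, mul_eq_zero, or_iff_right (zpow_ne_zero _ hX)] at h1
    have h2 : ratZ 0 = 0 := map_zero ratZHom
    rw [hwave.2 k hk, h2, mul_zero, ← ratZ_polyX, h1, h2, M.coeff_zero, M.coeff_zero]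
  · obtain ⟨j, rfl⟩ := Int.eq_ofNat_of_zero_le hk
    have h2 : RatFunc.X ^ j * (polyX (theta γ A J) * ΨW.coeff j) = polyX (waveNum γ A J a j) := by
      rw [h1, zpow_neg, zpow_natCast, mul_inv_cancel_left₀ (X_pow_ne_zero j)]
    have h3 : zM ^ j * (polyZ (theta γ A J) * ratZ (ΨW.coeff j)) = polyZ (waveNum γ A J a j) := by
      rw [← ratZ_polyX, ← ratZ_polyX, ← h2, ratZ_mul, ratZ_mul, ← polyX_X_pow,
        ratZ_polyX (X ^ j), polyZ_X_pow]
    rw [← h3, M.coeff_zM_pow_mul, sub_add_cancel]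

/-- By `theta_mul_coeff`, `x ^ k θ w_k` is the polynomial `waveNum`, whose degree is at most that of
`θ`. Hence `w_k = O(x ^ (-k))`. -/
theorem coeffInfty_eq_zero (s : DarbouxData d β γ A J P) (hΨ : IsXZ Ψ a)
    (hW : zM ^ n * ΨW = P.app Ψ) (hwave : IsWave ΨW) (k l : ℤ) (hl : l < k) :
    coeffInfty (ΨW.coeff k) l = 0 := by
  rcases lt_or_ge k 0 with hk | hk
  · rw [hwave.2 k hk, coeffInfty_zero]
  · obtain ⟨j, rfl⟩ := Int.eq_ofNat_of_zero_le hk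
    have h3 : polyZ (theta γ A J) * (zM ^ j * ratZ (ΨW.coeff j)) =
        polyZ (waveNum γ A J a j) := by
      refine M.ext fun i => ?_
      rw [mul_left_comm, M.coeff_zM_pow_mul, s.coeff_polyZ_theta_mul hΨ hW hwave,
        add_sub_cancel_right]
    have hdeg : (waveNum γ A J a j).natDegree ≤ (theta γ A J).natDegree := by
      -- The functional taking a symbol to the entry at index `j - n` of its action on the Bessel
      -- coefficients; the shift by `n` comes from `z ^ n Ψ_W = P Ψ`.
      let ℓ : ℂ[X] →ₗ[ℂ] ℂ := LinearMap.proj ((j : ℤ) - n) ∘ₗ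
        LinearMap.applyₗ a ∘ₗ (aeval eulerXi : ℂ[X] →ₐ[ℂ] Module.End ℂ (ℤ → ℂ)).toLinearMap
      exact s.natDegree_le ℓ
    have h4 := coeff_eq_zero_of_polyZ_mul_eq s.theta_ne hdeg h3 (i := l - j) (by omega)
    rw [M.coeff_zM_pow_mul, sub_add_cancel, coeff_ratZ, map_eq_zero] at h4
    exact h4

theorem dualOp_app_coeff (s : DarbouxData d β γ A J P) (hΨ : IsXZ Ψ a)
    (hL : (besselL β).app Ψ = zM ^ N * Ψ) (l : ℤ) :
    ((dualOp β γ A J).app Ψ).coeff l = ∑ I ∈ subsets n m,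
      RatFunc.C (wt γ A I * aeval eulerXi (linProd γ I) a (l + pExp γ J I)) *
        RatFunc.X ^ (-(l + n + pExp γ J I)) := by
  have hX : (RatFunc.X : K) ≠ 0 := RatFunc.X_ne_zero
  rw [dualOp, DiffOp.app_sum, M.coeff_sum]
  refine Finset.sum_congr rfl fun I hI => ?_
  rw [DiffOp.app_smul, M.coeff_smul, DiffOp.app_mul, besselL_pow_app hL]
  by_cases h0 : wt γ A I = 0
  · rw [h0, zero_mul, map_zero, zero_mul, zero_mul]
  · have hdvd := s.dvd I hI fun h => h0 (by rw [wt, h, zero_mul])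
    rw [Nat.mul_div_cancel' hdvd, DiffOp.app_polyZ_mul, polyZ_X_pow, M.coeff_zM_pow_mul,
      besselOp_of_mem_subsets γ hI, DiffOp.app_mul, mulX_app, M.coeff_cX_mul,
      hΨ.aeval_app (linProd γ I), map_mul, ← zpow_natCast, ← zpow_neg]
    have h1 : -(l + n + pExp γ J I : ℤ) = -(n : ℤ) + -(l + pExp γ J I) := by ring
    rw [h1, zpow_add₀ hX]
    ring

/-- Comparison of coefficients of `x ^ (-k) z ^ (-l)`. On the left they are those of `θ w_k`
expanded at infinity; on the right `L_β ^ (p_I / N)` acts on `Ψ` as `z ^ p_I`. -/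
theorem polyZ_mul_swapWave (s : DarbouxData d β γ A J P) (hΨ : IsXZ Ψ a)
    (hL : (besselL β).app Ψ = zM ^ N * Ψ) (hW : zM ^ n * ΨW = P.app Ψ) (hwave : IsWave ΨW) :
    polyZ (X ^ n * theta γ A J) * swapWave ΨW = (dualOp β γ A J).app Ψ := by
  refine M.ext fun l => ?_
  have hc := s.coeffInfty_eq_zero hΨ hW hwave
  set T : ℕ := (theta γ A J).natDegree + ∑ I ∈ subsets n m, pExp γ J I with hT
  -- One finite range of `k` for the whole computation: it contains every range required by
  -- `swapWave_coeff` and every index `l + n + p_I`, also when `l + n` is negative.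
  set S : Finset ℤ := Finset.Icc (min 0 (l + n)) (l + n + T) with hS
  have hkey : ∀ k, ∑ j ∈ Finset.range ((theta γ A J).natDegree + 1),
      RatFunc.C ((theta γ A J).coeff j) * RatFunc.C (coeffInfty (ΨW.coeff k) (l + n + j)) =
        ∑ I ∈ subsets n m, if k = l + n + pExp γ J I then
          RatFunc.C (wt γ A I * aeval eulerXi (linProd γ I) a (k - n)) else 0 := by
    intro k
    simp only [← coeff_ratZ]
    rw [← coeff_polyZ_mul (Nat.lt_succ_self _), s.coeff_polyZ_theta_mul hΨ hW hwave, waveNum,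
      ← polyZHom_apply, map_sum, M.coeff_sum]
    refine Finset.sum_congr rfl fun I _ => ?_
    rw [← smul_eq_C_mul, map_smul, M.coeff_smul, polyZHom_apply, polyZ_X_pow, M.coeff_zM_pow]
    by_cases h : k = l + n + pExp γ J I
    · rw [if_pos h, if_pos (by omega), mul_one]
    · rw [if_neg h, if_neg (by omega), mul_zero]
  rw [s.dualOp_app_coeff hΨ hL, polyZ_mul, polyZ_X_pow, mul_assoc, M.coeff_zM_pow_mul,
    coeff_polyZ_mul (Nat.lt_succ_self _)]
  have h1 : ∀ j ∈ Finset.range ((theta γ A J).natDegree + 1),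
      RatFunc.C ((theta γ A J).coeff j) * (swapWave ΨW).coeff (l + n + j) =
        ∑ k ∈ S, RatFunc.C ((theta γ A J).coeff j) *
          RatFunc.C (coeffInfty (ΨW.coeff k) (l + n + j)) * RatFunc.X ^ (-k) := by
    intro j hj
    have := Finset.mem_range.1 hj
    rw [swapWave_coeff hwave.2 hc (S := S), Finset.mul_sum]
    · simp only [mul_assoc]
    · refine Finset.Icc_subset_Icc (min_le_left _ _) ?_
      have : (j : ℤ) ≤ T := by omega
      omega
  rw [Finset.sum_congr rfl h1, Finset.sum_comm]
  simp only [← Finset.sum_mul]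
  simp only [hkey, Finset.sum_mul]
  rw [Finset.sum_comm]
  refine Finset.sum_congr rfl fun I hI => ?_
  have hmem : l + n + pExp γ J I ∈ S := by
    have h2 : pExp γ J I ≤ ∑ I ∈ subsets n m, pExp γ J I :=
      Finset.single_le_sum (f := fun I => pExp γ J I) (fun _ _ => Nat.zero_le _) hI
    rw [hS, Finset.mem_Icc]
    omega
  simp only [ite_mul, zero_mul]
  rw [Finset.sum_ite_eq', if_pos hmem]
  have h3 : l + n + pExp γ J I - n = l + pExp γ J I := by ring
  rw [h3]

end DarbouxData

end DualWave

/-! ### The bispectral equations -/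

section Bispectral

variable {n m N d : ℕ}

/-- The properties of the Bessel wave function used below. -/
structure BesselData (β : Fin N → ℂ) (Ψ : M) (a : ℤ → ℂ) : Prop where
  ne_zero : Ψ ≠ 0
  isXZ : IsXZ Ψ a
  eigen : (besselL β).app Ψ = zM ^ N * Ψ

namespace BesselData

variable {β : Fin N → ℂ} {Ψ : M} {a : ℤ → ℂ}

theorem corr_aeval_euler (t : BesselData β Ψ a) (p : ℂ[X]) :
    Corr Ψ (aeval euler p) (aeval euler p) := (t.isXZ.aeval_appZ_eq p).symm

theorem corr_mulX (t : BesselData β Ψ a) : Corr Ψ (mulX (polyX (X ^ N))) (besselL β) := by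
  rw [Corr, besselL_appZ t.isXZ t.eigen, mulX_app, polyX_X_pow]

theorem corr_besselL (t : BesselData β Ψ a) : Corr Ψ (besselL β) (mulX (polyX (X ^ N))) := by
  rw [Corr, mulX_appZ, t.eigen, ratZ_polyX, polyZ_X_pow]

theorem aeval_besselL_app (t : BesselData β Ψ a) (q : ℂ[X]) :
    (aeval (besselL β) q).app Ψ = polyZ (q.comp (X ^ N)) * Ψ := by
  rw [t.corr_besselL.aeval q, ← mulX_polyX_comp, mulX_appZ, ratZ_polyX]

theorem aeval_besselL_appZ (t : BesselData β Ψ a) (q : ℂ[X]) :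
    (aeval (besselL β) q).appZ Ψ = cX (polyX (q.comp (X ^ N))) * Ψ := by
  rw [← t.corr_mulX.aeval q, ← mulX_polyX_comp, mulX_app]

end BesselData

theorem Corr.zero (Ψ : M) : Corr Ψ 0 0 := by
  rw [Corr, ← appHom_apply, ← appZAlgHom_apply, map_zero, map_zero]

theorem cX_mul_cX_mul (r s : K) (u : M) : cX r * (cX s * u) = cX (r * s) * u := by
  rw [← mul_assoc, ← map_mul]

theorem cX_inv_mul_cancel {r : K} (hr : r ≠ 0) (u : M) : cX r⁻¹ * (cX r * u) = u := by
  rw [cX_mul_cX_mul, inv_mul_cancel₀ hr, map_one, one_mul]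

namespace DarbouxData

variable {β : Fin N → ℂ} {γ : Fin m → ℂ} {A : Matrix (Fin n) (Fin m) ℂ} {J : Finset (Fin m)}
  {P : DiffOp} {Ψ ΨW : M} {a : ℤ → ℂ}

theorem corr_pow_pExp (s : DarbouxData d β γ A J P) (t : BesselData β Ψ a) {I : Finset (Fin m)}
    (hI : I ∈ subsets n m) (h0 : wt γ A I ≠ 0) :
    Corr Ψ (mulX (polyX (X ^ pExp γ J I))) (besselL β ^ (pExp γ J I / N)) := by
  have hdvd := s.dvd I hI fun h => h0 (by rw [wt, h, zero_mul])
  have h1 := t.corr_mulX.pow (pExp γ J I / N)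
  rwa [← mulXHom_apply, ← map_pow, polyX_X_pow, ← pow_mul, Nat.mul_div_cancel' hdvd,
    mulXHom_apply, ← polyX_X_pow] at h1

theorem corr_left (s : DarbouxData d β γ A J P) (t : BesselData β Ψ a)
    (π : Finset (Fin m) → ℂ[X]) :
    Corr Ψ (∑ I ∈ subsets n m, wt γ A I • (mulX (polyX (X ^ pExp γ J I)) * aeval euler (π I)))
      (∑ I ∈ subsets n m, wt γ A I • (aeval euler (π I) * besselL β ^ (pExp γ J I / N))) := by
  refine Corr.sum fun I hI => ?_
  by_cases h0 : wt γ A I = 0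
  · rw [h0, zero_smul, zero_smul]; exact Corr.zero Ψ
  · exact ((s.corr_pow_pExp t hI h0).mul (t.corr_aeval_euler (π I))).smul _

theorem corr_right (s : DarbouxData d β γ A J P) (t : BesselData β Ψ a)
    (π : Finset (Fin m) → ℂ[X]) :
    Corr Ψ (∑ I ∈ subsets n m, wt γ A I • (aeval euler (π I) * mulX (polyX (X ^ pExp γ J I))))
      (∑ I ∈ subsets n m, wt γ A I • (besselL β ^ (pExp γ J I / N) * aeval euler (π I))) := by
  refine Corr.sum fun I hI => ?_
  by_cases h0 : wt γ A I = 0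
  · rw [h0, zero_smul, zero_smul]; exact Corr.zero Ψ
  · exact ((t.corr_aeval_euler (π I)).mul (s.corr_pow_pExp t hI h0)).smul _

/-- `Corr` transfers `θ x ^ n P` to `x ^ n P_b` in the variable `z`; the resulting factor `z ^ n`
cancels that of `z ^ n Ψ_W = P Ψ`. -/
theorem dualOp_appZ (s : DarbouxData d β γ A J P) (t : BesselData β Ψ a)
    (hW : zM ^ n * ΨW = P.app Ψ) :
    (dualOp β γ A J).appZ Ψ = cX (polyX (X ^ n * theta γ A J)) * ΨW := by
  have h1 : ∑ I ∈ subsets n m, wt γ A I •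
      (aeval euler (linProd γ I) * besselL β ^ (pExp γ J I / N)) =
        mulX (RatFunc.X ^ n) * dualOp β γ A J := by
    rw [dualOp, Finset.mul_sum]
    refine Finset.sum_congr rfl fun I hI => ?_
    rw [mul_smul_comm, besselOp_of_mem_subsets γ hI, mul_assoc (mulX (RatFunc.X ^ n)⁻¹),
      mulX_mul_mulX_mul, mul_inv_cancel₀ (X_pow_ne_zero n), mulX_one_mul]
  have h2 := s.corr_left t (linProd γ)
  rw [h1, ← leftOp_wtSymbol, s.left, Corr, DiffOp.app_mul, DiffOp.app_mul, mulX_app, mulX_app,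
    DiffOp.appZ_mul, mulX_appZ, cX_mul_cX_mul, ← polyX_X_pow, ← polyX_mul, ratZ_polyX,
    polyZ_X_pow, ← hW, mul_left_comm, mul_comm (theta γ A J)] at h2
  exact (mul_left_cancel₀ (pow_ne_zero n zM_ne_zero) h2).symm

theorem inverseOp_app (s : DarbouxData d β γ A J P) (t : BesselData β Ψ a) (hm : m = N * d)
    (hW : zM ^ n * ΨW = P.app Ψ) :
    (inverseOp γ A J).app ΨW = polyZ (X ^ (m - n)) * Ψ := by
  apply mul_left_cancel₀ (pow_ne_zero n zM_ne_zero)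
  rw [← polyZ_X_pow, ← DiffOp.app_polyZ_mul, polyZ_X_pow, hW, ← DiffOp.app_mul, s.inverseOp_mul,
    besselL_pow_app t.eigen, ← polyZ_X_pow, ← mul_assoc, ← polyZ_mul, ← pow_add,
    Nat.add_sub_cancel' s.le, hm]

theorem inverseOp_ne_zero (s : DarbouxData d β γ A J P) (t : BesselData β Ψ a) :
    inverseOp γ A J ≠ 0 := by
  intro h0
  have h1 := besselL_pow_app t.eigen d
  rw [← s.inverseOp_mul, h0, zero_mul, ← appHom_apply, map_zero, LinearMap.zero_apply, eq_comm,
    mul_eq_zero, or_iff_left t.ne_zero] at h1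
  exact polyZ_ne_zero (pow_ne_zero _ X_ne_zero) h1

/-- It suffices to compare after applying `Q`, which is injective on series and commutes with
operators in `z`. Since `Q Ψ_W` is a power of `z` times `Ψ`, the left side becomes the action of
`Q_b` on a multiple of `Ψ`, where `Corr` identifies it with the numerator of `Q`. -/
theorem dualInverseOp_appZ (s : DarbouxData d β γ A J P) (t : BesselData β Ψ a) (hm : m = N * d)
    (hW : zM ^ n * ΨW = P.app Ψ) :
    (dualInverseOp β γ A J).appZ ΨW = cX (polyX (X ^ (m - n) * theta γ A J)) * Ψ := by
  have hne : polyX (X ^ (m - n) * theta γ A J) ≠ 0 :=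
    RatFunc.algebraMap_ne_zero (mul_ne_zero (pow_ne_zero _ X_ne_zero) s.theta_ne)
  apply DiffOp.app_injective (s.inverseOp_ne_zero t)
  have h1 : dualInverseOp β γ A J = (∑ I ∈ subsets n m, wt γ A I •
      (besselL β ^ (pExp γ J I / N) * aeval euler (linProd (coRoots n γ) Iᶜ))) *
        mulX (polyX (X ^ (m - n)))⁻¹ := by
    rw [dualInverseOp, Finset.sum_mul]
    refine Finset.sum_congr rfl fun I hI => ?_
    rw [besselOp_compl γ hI, smul_mul_assoc, polyX_X_pow, mul_assoc]
  have h2 : (mulX (polyX (X ^ (m - n)))⁻¹).appZ (polyZ (X ^ (m - n)) * Ψ) = Ψ := by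
    rw [mulX_appZ, ratZ_inv, ratZ_polyX,
      inv_mul_cancel_left₀ (polyZ_ne_zero (pow_ne_zero _ X_ne_zero))]
  have h3 := s.corr_right t fun I => linProd (coRoots n γ) Iᶜ
  rw [DiffOp.app_appZ, s.inverseOp_app t hm hW, h1, DiffOp.appZ_mul, h2, ← h3, inverseOp_eq,
    DiffOp.app_mul, mulX_app, cX_inv_mul_cancel hne, rightOp_wtSymbol]

/-- The polynomial `Θ` with `Θ(x ^ N) = f_b(x) g_b(x)`. -/
theorem exists_eigenvalue (s : DarbouxData d β γ A J P) (hm : m = N * d) :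
    ∃ Θ : ℂ[X], Θ.comp (X ^ N) = X ^ (m - n) * theta γ A J * (X ^ n * theta γ A J) := by
  have hc := dualCoeff_comp s.dvd (π := linProd γ) (B := n) fun I hI => linProd_spec γ hI
  refine ⟨X ^ d * dualCoeff N γ A J (linProd γ) n ^ 2, ?_⟩
  have h1 : (X ^ m : ℂ[X]) = X ^ (m - n) * X ^ n := by rw [← pow_add, Nat.sub_add_cancel s.le]
  rw [mul_comp, pow_comp, pow_comp, X_comp, hc, ← pow_mul, ← hm, h1]
  ring

/-- In the variable `z` both operators multiply `Ψ` by `f_b(x) g_b(x)`, and the action on a nonzero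
series determines an operator. -/
theorem dualInverseOp_mul_dualOp (s : DarbouxData d β γ A J P) (t : BesselData β Ψ a)
    (hm : m = N * d) (hW : zM ^ n * ΨW = P.app Ψ) {Θ : ℂ[X]}
    (hΘ : Θ.comp (X ^ N) = X ^ (m - n) * theta γ A J * (X ^ n * theta γ A J)) :
    dualInverseOp β γ A J * dualOp β γ A J = aeval (besselL β) Θ := by
  rw [← sub_eq_zero]
  apply DiffOp.eq_zero_of_appZ_eq_zero t.ne_zero
  rw [← appZAlgHom_apply, map_sub, LinearMap.sub_apply, appZAlgHom_apply, appZAlgHom_apply,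
    t.aeval_besselL_appZ, DiffOp.appZ_mul, s.dualOp_appZ t hW, DiffOp.appZ_cX_mul,
    s.dualInverseOp_appZ t hm hW, cX_mul_cX_mul, ← polyX_mul, hΘ, mul_comm (X ^ n * _), sub_self]

/-- After multiplication by `g_b(z)` the right side is `Q_b P_b Ψ = Θ(L_β) Ψ`, which equals `Θ(z ^
N) Ψ = f_b(z) g_b(z) Ψ`. -/
theorem dualInverseOp_app_swapWave (s : DarbouxData d β γ A J P) (t : BesselData β Ψ a)
    (hm : m = N * d) (hW : zM ^ n * ΨW = P.app Ψ) (hwave : IsWave ΨW) :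
    polyZ (X ^ (m - n) * theta γ A J) * Ψ = (dualInverseOp β γ A J).app (swapWave ΨW) := by
  obtain ⟨Θ, hΘ⟩ := s.exists_eigenvalue hm
  have hne : polyZ (X ^ n * theta γ A J) ≠ 0 :=
    polyZ_ne_zero (mul_ne_zero (pow_ne_zero _ X_ne_zero) s.theta_ne)
  apply mul_left_cancel₀ hne
  rw [← DiffOp.app_polyZ_mul, s.polyZ_mul_swapWave t.isXZ t.eigen hW hwave, ← DiffOp.app_mul,
    s.dualInverseOp_mul_dualOp t hm hW hΘ, t.aeval_besselL_app, hΘ, ← mul_assoc, ← polyZ_mul,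
    mul_comm (X ^ n * _)]

theorem dualOp_mul_dualInverseOp_appZ (s : DarbouxData d β γ A J P) (t : BesselData β Ψ a)
    (hm : m = N * d) (hW : zM ^ n * ΨW = P.app Ψ) :
    (dualOp β γ A J * dualInverseOp β γ A J).appZ ΨW =
      cX (polyX (X ^ (m - n) * theta γ A J * (X ^ n * theta γ A J))) * ΨW := by
  rw [DiffOp.appZ_mul, s.dualInverseOp_appZ t hm hW, DiffOp.appZ_cX_mul, s.dualOp_appZ t hW,
    cX_mul_cX_mul, ← polyX_mul]

theorem op_mul_inverseOp_app (s : DarbouxData d β γ A J P) (t : BesselData β Ψ a)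
    (hm : m = N * d) (hW : zM ^ n * ΨW = P.app Ψ) :
    (P * inverseOp γ A J).app ΨW = polyZ ((X ^ d : ℂ[X]).comp (X ^ N)) * ΨW := by
  rw [DiffOp.app_mul, s.inverseOp_app t hm hW, DiffOp.app_polyZ_mul, ← hW, ← polyZ_X_pow,
    ← mul_assoc, ← polyZ_mul, ← pow_add, Nat.sub_add_cancel s.le, pow_comp, X_comp, ← pow_mul, hm]

end DarbouxData

theorem IsWave.ne_zero {Ψ : M} (h : IsWave Ψ) : Ψ ≠ 0 := by
  rintro rfl
  have h1 := h.1
  rw [M.coeff_zero] at h1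
  exact zero_ne_one h1

theorem app_eq_app_iff {Ψ : M} (hΨ : Ψ ≠ 0) {S T : DiffOp} : S.app Ψ = T.app Ψ ↔ T = S := by
  constructor
  · intro h
    rw [← sub_eq_zero]
    apply DiffOp.eq_zero_of_app_eq_zero hΨ
    rw [DiffOp.app_sub, h, sub_self]
  · rintro rfl; rfl

/-- The polynomial `f` is forced by `f g = z ^ (N d)`, and `Q` by its value on the nonzero series
`Ψ_W`. -/
theorem DarbouxData.isInverseDarboux_iff {β : Fin N → ℂ} {γ : Fin m → ℂ}
    {A : Matrix (Fin n) (Fin m) ℂ} {J : Finset (Fin m)} {P : DiffOp} {ΨW : M} {a : ℤ → ℂ}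
    (s : DarbouxData d β γ A J P) (t : BesselData β (besselWave β) a) (hm : m = N * d)
    (hW : zM ^ n * ΨW = P.app (besselWave β)) (hwave : IsWave ΨW) (f : ℂ[X]) (Q : DiffOp) :
    IsInverseDarboux β (X ^ d) (X ^ n) P ΨW f Q ↔ f = X ^ (m - n) ∧ Q = inverseOp γ A J := by
  have h0 : (X ^ d : ℂ[X]).comp (X ^ N) = X ^ (m - n) * X ^ n := by
    rw [pow_comp, X_comp, ← pow_mul, ← hm, ← pow_add, Nat.sub_add_cancel s.le]
  constructor
  · intro h
    have hf : f = X ^ (m - n) :=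
      mul_right_cancel₀ (pow_ne_zero n X_ne_zero) (h.mul_eq.trans h0)
    refine ⟨hf, (app_eq_app_iff hwave.ne_zero).1 ?_⟩
    rw [s.inverseOp_app t hm hW, ← hf, h.darboux]
  · rintro ⟨rfl, rfl⟩
    exact ⟨monic_X_pow _, (s.inverseOp_app t hm hW).symm, h0.symm, by
      rw [s.inverseOp_mul, map_pow, aeval_X]⟩

end Bispectral

/-! ### Monomial Darboux transformations -/

section Main

variable {n m N d : ℕ} {β : Fin N → ℂ} {γ : Fin m → ℂ} {A : Matrix (Fin n) (Fin m) ℂ}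
  {b : Fin n → ℂ} {e : Fin n → Fin m → ℕ} {J : Finset (Fin m)} {g : ℂ[X]} {P : DiffOp} {ΨW : M}

/-- If all minors of `A` vanished, so would those of the monomial matrix, and with them the
Cauchy–Binet expansion of the Wronskian. -/
theorem exists_minor_ne_zero (hW : (wronskian γ (ratMat A e)).det ≠ 0)
    (h : ∀ k i, A k i ≠ 0 → γ i = b k + e k i ∧ N ∣ e k i) :
    ∃ I ∈ subsets n m, minor A I ≠ 0 := by
  by_contra! h0
  have h1 := det_wronskian γ (ratMat A e)
  rw [Finset.sum_eq_zero, eq_comm, mul_eq_zero, or_iff_left hW, map_eq_zero] at h1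
  · exact vdmSign_ne_zero n h1
  · intro I hI
    obtain ⟨q, hq, -⟩ := colMinor_monMat h (card_of_mem_subsets hI)
    rw [colMinor_ratMat, hq, h0 I hI]
    simp [polyX]

theorem darbouxData (h : ∀ k i, A k i ≠ 0 → γ i = b k + e k i ∧ N ∣ e k i)
    (hΨ : IsWave (besselWave β)) (hW : IsMonomialDarboux β (kerFun γ A) g P ΨW)
    (hL : besselL β ^ d = besselOp γ Finset.univ) (hJ : IsMinimalSet γ A J) :
    DarbouxData d β γ A J P := by
  obtain ⟨κ, hκ⟩ := pExp_spec h hJ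
  have hind := rowsIndependent_of_kernelBasis hW.ker
  have hw := wronskian_ratMat_ne_zero hind h
  have hκ' := fun I hI => (hκ I hI).2
  obtain ⟨p, hp, hpd, hpk, hP⟩ := symbol_of_darboux h hW hΨ.1 hΨ.2
  have hp' : mulX (RatFunc.X ^ n) * P = leftOp mulXHom euler p := by
    rw [hP, mulX_mul_mulX_mul, mul_inv_cancel₀ (X_pow_ne_zero n), mulX_one_mul]
  exact {
    le := by simpa [card_of_mem_subsets hJ.1] using Finset.card_le_univ J
    dvd := fun I hI h0 => ((hκ I hI).1 h0).2
    theta_ne := theta_ne_zero hκ' hw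
    left := by rw [wtSymbol_ker hκ' hw hp hpd hpk, leftOp_C_mul, hp', mulXHom_apply]
    right := by rw [hp']; exact rightOp_wtSymbol_mul_leftOp h hκ' hw hp hpd hpk
    pow := hL
    natDegree_le := natDegree_wt_sum_le hind h hκ' hw }

theorem besselWave_data (hN : 0 < N) (β : Fin N → ℂ)
    (hβ : ∑ s, β s = (N : ℂ) * ((N : ℂ) - 1) / 2) :
    IsWave (besselWave β) ∧ ∃ a, BesselData β (besselWave β) a := by
  obtain ⟨a, h0, h1, h2, h3⟩ := besselWave_spec hN β hβ
  have h4 : IsWave (besselWave β) := by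
    refine ⟨by rw [h2, h0, neg_zero, zpow_zero, mul_one, map_one], fun k hk => ?_⟩
    rw [h2, h1 k hk, map_zero, zero_mul]
  exact ⟨h4, a, h4.ne_zero, h2, h3⟩

end Main

end

end BesselDarboux

theorem mainTheorem11 {N n d : ℕ} (hN : 0 < N) (β : Fin N → ℂ)
    (hβ : ∑ s, β s = (N : ℂ) * ((N : ℂ) - 1) / 2)
    (γ : Fin (N * d) → ℂ) (hγ : γ = betaPow β d)
    (A : Matrix (Fin n) (Fin (N * d)) ℂ)
    (hA : ∀ k i j, i ≠ j → A k i * A k j ≠ 0 → ∃ l : ℤ, l ≠ 0 ∧ γ i - γ j = (N : ℂ) * (l : ℂ))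
    (g : ℂ[X]) (P : DiffOp) (ΨW : M)
    (hW : IsMonomialDarboux β (kerFun γ A) g P ΨW) :
    (∃ Imin, IsMinimalSet γ A Imin) ∧
    ∀ Imin, IsMinimalSet γ A Imin →
      -- the numbers `p_I` are nonnegative integers divisible by `N`
      (∀ I ∈ subsets n (N * d), minor A I ≠ 0 →
        ((pExp γ Imin I : ℕ) : ℂ) = ∑ i ∈ I, γ i - ∑ i ∈ Imin, γ i ∧ N ∣ pExp γ Imin I) ∧
      theta γ A Imin ≠ 0 ∧ n ≤ d * N ∧
      -- (a)
      g = X ^ n ∧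
      P = mulX (polyX (theta γ A Imin))⁻¹ *
        ∑ I ∈ subsets n (N * d), (minor A I * vdm γ I) •
          (mulX (polyX (X ^ pExp γ Imin I)) * besselOp γ I) ∧
      ∃ (f : ℂ[X]) (Q : DiffOp) (gb fb : ℂ[X]) (Pb Qb : DiffOp) (ΨbW : M),
        -- (b)
        f = X ^ (d * N - n) ∧
        Q = (∑ I ∈ subsets n (N * d), (minor A I * vdm γ I) •
            (besselOp (fun i => γ i - n) Iᶜ * mulX (polyX (X ^ pExp γ Imin I)))) *
          mulX (polyX (theta γ A Imin))⁻¹ ∧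
        -- (c)
        gb = X ^ n * ∑ I ∈ subsets n (N * d),
          C (minor A I * vdm γ I) * X ^ pExp γ Imin I ∧
        Pb = ∑ I ∈ subsets n (N * d), (minor A I * vdm γ I) •
          (besselOp γ I * besselL β ^ (pExp γ Imin I / N)) ∧
        -- (d)
        fb = X ^ (d * N - n) * ∑ I ∈ subsets n (N * d),
          C (minor A I * vdm γ I) * X ^ pExp γ Imin I ∧
        Qb = ∑ I ∈ subsets n (N * d), (minor A I * vdm γ I) •
          (besselL β ^ (pExp γ Imin I / N) * besselOp (fun i => γ i - n) Iᶜ) ∧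
        -- `f`, `Q` are the unique data of the inverse transformation with `h(z) = z ^ d`
        (∀ f' Q', IsInverseDarboux β (X ^ d) g P ΨW f' Q' ↔ f' = f ∧ Q' = Q) ∧
        -- `Ψ_{bW}` is the image of `Ψ_W` under the bispectral involution
        IsWave ΨbW ∧ IsSwap ΨW ΨbW ∧
        -- `P_b`, `g_b` and `Q_b`, `f_b` are the corresponding data for `Ψ_{bW}`
        IsDualLeft β n g P gb Pb ∧ IsDualRight β (d * N - n) f Q fb Qb ∧
        (∀ T : DiffOp, polyZ gb * ΨbW = T.app (besselWave β) ↔ T = Pb) ∧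
        (∀ T : DiffOp, polyZ fb * besselWave β = T.app ΨbW ↔ T = Qb) ∧
        -- the two bispectral equations, with `L = P Q` and `Λ = P_b Q_b`
        (P * Q).app ΨW = polyZ ((X ^ d : ℂ[X]).comp (X ^ N)) * ΨW ∧
        ∃ Θ : ℂ[X], Θ.comp (X ^ N) = fb * gb ∧
          (Pb * Qb).appZ ΨW = cX (polyX (Θ.comp (X ^ N))) * ΨW := by
  obtain ⟨hΨ, a, t⟩ := besselWave_data hN β hβ
  obtain ⟨b, e, h⟩ := exists_exponents γ A hA
  have hL : besselL β ^ d = besselOp γ Finset.univ := by rw [hγ, besselL_pow_eq_besselOp]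
  refine ⟨exists_isMinimalSet (exists_minor_ne_zero (wronskian_ratMat_ne_zero
    (rowsIndependent_of_kernelBasis hW.ker) h) h), fun J hJ => ?_⟩
  obtain ⟨κ, hκ⟩ := pExp_spec h hJ
  have s := darbouxData h hΨ hW hL hJ
  obtain rfl := hW.monomial
  have hD : zM ^ n * ΨW = P.app (besselWave β) := by rw [← polyZ_X_pow]; exact hW.darboux
  rw [mul_comm d N]
  refine ⟨fun I hI => (hκ I hI).1, s.theta_ne, s.le, rfl, s.op_eq, X ^ (N * d - n),
    inverseOp γ A J, X ^ n * theta γ A J, X ^ (N * d - n) * theta γ A J, dualOp β γ A J,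
    dualInverseOp β γ A J, swapWave ΨW, rfl, rfl, rfl, rfl, rfl, rfl,
    s.isInverseDarboux_iff t rfl hD hW.wave,
    isWave_swapWave hW.wave (s.coeffInfty_eq_zero t.isXZ hD hW.wave),
    isSwap_swapWave hW.wave.2 (s.coeffInfty_eq_zero t.isXZ hD hW.wave), s.isDualLeft, s.isDualRight,
    fun T => ?_, fun T => ?_, s.op_mul_inverseOp_app t rfl hD, ?_⟩
  · rw [s.polyZ_mul_swapWave t.isXZ t.eigen hD hW.wave]
    exact app_eq_app_iff t.ne_zero
  · rw [s.dualInverseOp_app_swapWave t rfl hD hW.wave]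
    exact app_eq_app_iff
      (isWave_swapWave hW.wave (s.coeffInfty_eq_zero t.isXZ hD hW.wave)).ne_zero
  · obtain ⟨Θ, hΘ⟩ := s.exists_eigenvalue rfl
    exact ⟨Θ, hΘ, by rw [hΘ]; exact s.dualOp_mul_dualInverseOp_appZ t rfl hD⟩
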